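/- Let $n\ge 0$, let $g$ be a smooth Riemannian metric on $\mathbb R^{n+1}=\{(t,x):t\in\mathbb R,\ x\in\mathbb R^n\}$, let $\Delta\ge 0$ be its Laplace–Beltrami operator on $L^2(\mathbb R^{n+1},\sqrt g\,dt\,dx)$ (the Friedrichs extension from $C_c^\infty$), let $m>0$, and let $E_m$ be the integral kernel of $(\Delta+m^2)^{-1}$. Put $d\mu_\sigma(x)=\sqrt{g(\sigma,x)}\,d^nx$. Functions on $\mathbb R^{n+1}$ and on the slice $t=\sigma$ are regarded as distributions by integration against $\sqrt g\,dt\,dx$ and $d\mu_\sigma$, respectively. Let $N$ be the Hilbert space of all complex distributions $f$ on $\mathbb R^{n+1}$ with $\|f\|_N^2=\langle f,(\Delta+m^2)^{-1}f\rangle<\infty$, i.e. which are bounded on test functions with respect to the energy norm $\langle\varphi,(\Delta+m^2)\varphi\rangle^{1/2}$, with $\langle f,h\rangle_N=\langle f,(\Delta+m^2)^{-1}h\rangle$. For $\sigma\in\mathbb R$ let $N_\sigma$ be the Hilbert space of all complex distributions $\psi$ on $\mathbb R^n$ for which the form $\iint\bar\psi(x)E_m(\sigma,x;\sigma,y)\psi(y)\,d\mu_\sigma(x)d\mu_\sigma(y)$,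 understood as $\langle\psi\,\delta(t-\sigma),(\Delta+m^2)^{-1}\psi\,\delta(t-\sigma)\rangle$, is finite, with this form as the square of the norm. Let $j_\sigma:N_\sigma\to N$, $(j_\sigma\psi)(t,x)=\psi(x)\delta(t-\sigma)$, let $j_\sigma^*$ be its adjoint, and let $$U_{\sigma,\sigma'}=j_\sigma^*\circ j_{\sigma'}:N_{\sigma'}\to N_\sigma .$$ For a closed set $\Lambda\subset\mathbb R^{n+1}$ let $e_\Lambda$ be the orthogonal projection of $N$ onto the subspace of the distributions in $N$ supported in $\Lambda$. A set $C$ separates $A$ and $B$ if $\mathbb R^{n+1}\setminus C$ is the union of two disjoint open sets, one containing $A\setminus C$ and the other containing $B\setminus C$. Then the operators $U_{\sigma,\sigma'}$ form a propagator: 1. $U_{\sigma,\sigma'}U_{\sigma',\sigma''}=U_{\sigma,\sigma''}$ whenever $\sigma'$ lies between $\sigma$ and $\sigma''$ (that is, $\sigma\le\sigma'\le\sigma''$ or $\sigma''\le\sigma'\le\sigma$); 2. $U_{\sigma,\sigma}=1_{N_\sigma}$ for all $\sigma$; 3. $\|U_{\sigma,\sigma'}\|\le 1$ for all $\sigma,\sigma'$.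 Moreover, the Markoff property $e_Ae_Ce_B=e_Ae_B$ holds for all closed sets $A,B,C\subset\mathbb R^{n+1}$ such that $C$ separates $A$ and $B$. Finally, for every real integral kernel $E_m$ of $(\Delta+m^2)^{-1}$ that is continuous off the diagonal, the norms above are the ones given by $E_m$: every test function $f\in C_c^\infty(\mathbb R^{n+1},\mathbb C)$ is in $N$, with $$\|f\|_N^2=\iint \bar f(t,x)\,E_m(t,x;s,y)\,f(s,y)\sqrt{g(t,x)}\sqrt{g(s,y)}\,dt\,dx\,ds\,dy,$$ and, if $n\ge1$, every $\psi\in C_c^\infty(\mathbb R^n,\mathbb C)$ is in $N_\sigma$ for each $\sigma$, with $$\|\psi\|_{N_\sigma}^2=\iint\bar\psi(x)E_m(\sigma,x;\sigma,y)\psi(y)\,d\mu_\sigma(x)\,d\mu_\sigma(y),$$ the integrals being absolutely convergent. -/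

import Mathlib

open MeasureTheory TopologicalSpace Filter Topology
open scoped Distributions ContDiff ComplexConjugate

noncomputable section

namespace CurvedField

/-- Points `x ∈ ℝⁿ` of a slice. -/
abbrev Slice (n : ℕ) := Fin n → ℝ

/-- Points `(t, x)` of `ℝⁿ⁺¹ = ℝ × ℝⁿ`. -/
abbrev Spacetime (n : ℕ) := ℝ × (Fin n → ℝ)

/-- The coordinate vectors of `ℝⁿ⁺¹`; the index `0` is the `t`-direction. -/
def coordVec {n : ℕ} : Fin (n + 1) → Spacetime n :=
  Fin.cons ((1 : ℝ), (0 : Fin n → ℝ)) (fun i => ((0 : ℝ), Pi.single i (1 : ℝ)))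

/-- A smooth Riemannian metric on `ℝⁿ⁺¹`, given by its coefficients `g_{ij}`. -/
structure Metric (n : ℕ) where
  coeff : Spacetime n → Matrix (Fin (n + 1)) (Fin (n + 1)) ℝ
  smooth : ∀ i j, ContDiff ℝ ∞ (fun p => coeff p i j)
  posDef : ∀ p, (coeff p).PosDef

/-- Real-valued test functions on `ℝⁿ⁺¹` and on `ℝⁿ`. -/
abbrev Test (n : ℕ) := 𝓓((⊤ : Opens (Spacetime n)), ℝ)
abbrev SliceTest (n : ℕ) := 𝓓((⊤ : Opens (Slice n)), ℝ)

/-- The spaces `D'(ℝⁿ⁺¹)` and `D'(ℝⁿ)` of complex distributions. -/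
abbrev Distr (n : ℕ) := 𝓓'((⊤ : Opens (Spacetime n)), ℂ)
abbrev SliceDistr (n : ℕ) := 𝓓'((⊤ : Opens (Slice n)), ℂ)

variable {n : ℕ}

namespace Metric

/-- `√g = √(det g_{ij})`. -/
def density (g : Metric n) (p : Spacetime n) : ℝ := √(g.coeff p).det

/-- The volume measure `√g dt dx`. -/
def vol (g : Metric n) : Measure (Spacetime n) :=
  volume.withDensity fun p => ENNReal.ofReal (g.density p)

/-- The measure `dμ_σ(x) = √g(σ, x) dⁿx` on `ℝⁿ`. -/
def sliceVol (g : Metric n) (σ : ℝ) : Measure (Slice n) :=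
  volume.withDensity fun x => ENNReal.ofReal (g.density (σ, x))

/-- The vector of partial derivatives of a function. -/
def partials (f : Spacetime n → ℝ) (p : Spacetime n) : Fin (n + 1) → ℝ :=
  fun i => fderiv ℝ f p (coordVec i)

/-- `⟨∇f, ∇h⟩_g = ∑ g^{ij} ∂_i f ∂_j h`. -/
def gradInner (g : Metric n) (f h : Spacetime n → ℝ) (p : Spacetime n) : ℝ :=
  partials f p ⬝ᵥ ((g.coeff p)⁻¹.mulVec (partials h p))

/-- The (nonnegative) Laplace-Beltrami operator
`Δ f = -(1/√g) ∑ ∂_i (√g g^{ij} ∂_j f)`. -/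
def laplaceBeltrami (g : Metric n) (f : Spacetime n → ℝ) (p : Spacetime n) : ℝ :=
  -(g.density p)⁻¹ * ∑ i, partials
    (fun q => g.density q * (g.coeff q)⁻¹.mulVec (partials f q) i) p i

/-- The quadratic form of `Δ + m²`: `∫ (⟨∇f, ∇h⟩_g + m² f h) √g dt dx`. -/
def energy (g : Metric n) (m : ℝ) (f h : Spacetime n → ℝ) : ℝ :=
  ∫ p, (g.gradInner f h p + m ^ 2 * (f p * h p)) ∂g.vol

lemma continuous_coeff (g : Metric n) : Continuous g.coeff :=
  continuous_matrix fun i j => (g.smooth i j).continuous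

lemma continuous_density (g : Metric n) : Continuous g.density :=
  g.continuous_coeff.matrix_det.sqrt

lemma continuous_inv (g : Metric n) : Continuous fun p => (g.coeff p)⁻¹ := by
  simp only [Matrix.inv_def, Ring.inverse_eq_inv']
  exact (g.continuous_coeff.matrix_det.inv₀ fun p => (g.posDef p).det_pos.ne').smul
    g.continuous_coeff.matrix_adjugate

instance (g : Metric n) : IsLocallyFiniteMeasure g.vol :=
  IsLocallyFiniteMeasure.withDensity_ofReal g.continuous_density

lemma continuous_partials (φ : Test n) : Continuous (partials (φ : Spacetime n → ℝ)) :=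
  continuous_pi fun _ =>
    (φ.contDiff.continuous_fderiv (by simp)).clm_apply continuous_const

lemma partials_add (φ ψ : Test n) (p : Spacetime n) :
    partials (φ + ψ : Test n) p = partials φ p + partials ψ p := by
  ext i
  have h1 : DifferentiableAt ℝ φ p := (φ.contDiff.differentiable (by simp)) p
  have h2 : DifferentiableAt ℝ ψ p := (ψ.contDiff.differentiable (by simp)) p
  have : ((φ + ψ : Test n) : Spacetime n → ℝ) = (φ : Spacetime n → ℝ) + ψ := rfl
  simp [partials, this, fderiv_add h1 h2]

lemma partials_smul (c : ℝ) (φ : Test n) (p : Spacetime n) :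
    partials (c • φ : Test n) p = c • partials φ p := by
  ext i
  have h1 : DifferentiableAt ℝ φ p := (φ.contDiff.differentiable (by simp)) p
  have : ((c • φ : Test n) : Spacetime n → ℝ) = c • (φ : Spacetime n → ℝ) := rfl
  simp [partials, this, fderiv_const_smul h1]

lemma gradInner_comm (g : Metric n) (f h : Spacetime n → ℝ) (p : Spacetime n) :
    g.gradInner f h p = g.gradInner h f p := by
  have hs : ((g.coeff p)⁻¹).transpose = (g.coeff p)⁻¹ := by
    have := (g.posDef p).inv.isHermitian
    simpa [Matrix.IsHermitian, Matrix.conjTranspose_eq_transpose_of_trivial] using this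
  rw [gradInner, gradInner, Matrix.dotProduct_mulVec, dotProduct_comm, ← Matrix.mulVec_transpose,
    hs]

lemma gradInner_self_nonneg (g : Metric n) (f : Spacetime n → ℝ) (p : Spacetime n) :
    0 ≤ g.gradInner f f p := by
  have h := (g.posDef p).inv.posSemidef.dotProduct_mulVec_nonneg (partials f p)
  rw [star_trivial] at h
  exact h

lemma integrable_energy (g : Metric n) (m : ℝ) (φ ψ : Test n) :
    Integrable (fun p => g.gradInner φ ψ p + m ^ 2 * (φ p * ψ p)) g.vol := by
  refine Continuous.integrable_of_hasCompactSupport ?_ ?_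
  · refine Continuous.add ?_ (continuous_const.mul (φ.continuous.mul ψ.continuous))
    exact (continuous_partials φ).dotProduct (g.continuous_inv.matrix_mulVec (continuous_partials ψ))
  · refine HasCompactSupport.intro φ.hasCompactSupport fun p hp => ?_
    have h0 : φ p = 0 := image_eq_zero_of_notMem_tsupport hp
    have h1 : partials φ p = 0 := by
      ext i
      have : fderiv ℝ φ p = 0 :=
        image_eq_zero_of_notMem_tsupport fun h => hp (tsupport_fderiv_subset ℝ h)
      simp [partials, this]
    simp [gradInner, h0, h1]

end Metric

/-- Test functions with the energy inner product `⟨φ, (Δ + m²) ψ⟩`. -/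
def EnergyTest (_g : Metric n) (_m : ℝ) := Test n

instance (g : Metric n) (m : ℝ) : AddCommGroup (EnergyTest g m) :=
  inferInstanceAs (AddCommGroup (Test n))

instance (g : Metric n) (m : ℝ) : Module ℝ (EnergyTest g m) :=
  inferInstanceAs (Module ℝ (Test n))

/-- A test function regarded as a vector of the energy space. -/
def EnergyTest.of (g : Metric n) (m : ℝ) : Test n ≃ₗ[ℝ] EnergyTest g m := LinearEquiv.refl ℝ (Test n)

/-- A vector of the energy pre-Hilbert space regarded as a test function. -/
def EnergyTest.fn {g : Metric n} {m : ℝ} (φ : EnergyTest g m) : Test n := φ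

@[reducible]
def energyCore (g : Metric n) (m : ℝ) : PreInnerProductSpace.Core ℝ (EnergyTest g m) where
  inner φ ψ := g.energy m φ.fn ψ.fn
  conj_inner_symm φ ψ := by
    simp only [Metric.energy, conj_trivial]
    exact integral_congr_ae (.of_forall fun p => by
      simp only [g.gradInner_comm ψ.fn, mul_comm (ψ.fn p)])
  re_inner_nonneg φ := by
    refine integral_nonneg fun p => ?_
    have := g.gradInner_self_nonneg φ.fn p
    have h2 := mul_self_nonneg (φ.fn p)
    positivity
  add_left φ ψ χ := by
    simp only [Metric.energy]
    rw [← integral_add (g.integrable_energy m _ _) (g.integrable_energy m _ _)]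
    refine integral_congr_ae (.of_forall fun p => ?_)
    have h : (φ + ψ).fn p = φ.fn p + ψ.fn p := rfl
    have h' : Metric.partials ((φ + ψ).fn) p = _ := Metric.partials_add φ.fn ψ.fn p
    simp only [Metric.gradInner, h, h', add_dotProduct]
    ring
  smul_left φ χ c := by
    simp only [Metric.energy, conj_trivial]
    rw [← integral_const_mul]
    refine integral_congr_ae (.of_forall fun p => ?_)
    have h : (c • φ).fn p = c * φ.fn p := rfl
    have h' : Metric.partials ((c • φ).fn) p = _ := Metric.partials_smul c φ.fn p
    simp only [Metric.gradInner, h, h', smul_dotProduct, smul_eq_mul]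
    ring

instance (g : Metric n) (m : ℝ) : SeminormedAddCommGroup (EnergyTest g m) :=
  @InnerProductSpace.Core.toSeminormedAddCommGroup ℝ (EnergyTest g m) _ _ _ (energyCore g m)

instance (g : Metric n) (m : ℝ) : InnerProductSpace ℝ (EnergyTest g m) :=
  InnerProductSpace.ofCore (energyCore g m)

lemma EnergyTest.inner_of (g : Metric n) (m : ℝ) (φ ψ : Test n) :
    inner ℝ (EnergyTest.of g m φ) (EnergyTest.of g m ψ) = g.energy m φ ψ := rfl

/-- The energy space: the form domain of `Δ + m²`, i.e. the Hilbert completion of the test functions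
in the energy norm. -/
abbrev EnergySpace (g : Metric n) (m : ℝ) := UniformSpace.Completion (EnergyTest g m)

/-- The inclusion of the test functions into the energy space. -/
def toEnergy (g : Metric n) (m : ℝ) : Test n →ₗ[ℝ] EnergySpace g m :=
  (UniformSpace.Completion.toComplL (𝕜 := ℝ) (E := EnergyTest g m)).toLinearMap ∘ₗ
    (EnergyTest.of g m).toLinearMap

lemma inner_toEnergy (g : Metric n) (m : ℝ) (φ ψ : Test n) :
    inner ℝ (toEnergy g m φ) (toEnergy g m ψ) = g.energy m φ ψ := by
  simp [toEnergy, EnergyTest.inner_of]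

lemma norm_toEnergy (g : Metric n) (m : ℝ) (φ : Test n) :
    ‖toEnergy g m φ‖ = √(g.energy m φ φ) := by
  rw [← inner_toEnergy, real_inner_self_eq_norm_sq, Real.sqrt_sq (norm_nonneg _)]

lemma denseRange_toEnergy (g : Metric n) (m : ℝ) : DenseRange (toEnergy g m) :=
  UniformSpace.Completion.denseRange_coe (α := EnergyTest g m)


lemma energy_le (g : Metric n) (m : ℝ) (K : Compacts (Spacetime n)) :
    ∃ C : ℝ, 0 ≤ C ∧ ∀ (φ : Test n) (B : ℝ), 0 ≤ B → tsupport φ ⊆ K → (∀ p, |φ p| ≤ B) →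
      (∀ p, ‖fderiv ℝ φ p‖ ≤ B) → g.energy m φ φ ≤ C * B ^ 2 := by
  have hc : Continuous fun p => ∑ i, ∑ j, |(g.coeff p)⁻¹ i j| * (‖coordVec (n := n) i‖ *
      ‖coordVec (n := n) j‖) :=
    continuous_finsetSum _ fun i _ => continuous_finsetSum _ fun j _ =>
      ((g.continuous_inv.matrix_elem i j).abs).mul continuous_const
  obtain ⟨M, hM⟩ := K.isCompact.bddAbove_image hc.continuousOn
  have hfin : g.vol K ≠ ⊤ := K.isCompact.measure_lt_top.ne
  refine ⟨(max M 0 + m ^ 2) * g.vol.real K, by positivity, fun φ B hB hK h0 h1 => ?_⟩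
  have key : ∀ p, ‖g.gradInner φ φ p + m ^ 2 * (φ p * φ p)‖ ≤
      (K : Set (Spacetime n)).indicator (fun _ => (max M 0 + m ^ 2) * B ^ 2) p := by
    intro p
    by_cases hp : p ∈ (K : Set (Spacetime n))
    · rw [Set.indicator_of_mem hp]
      have hpart : ∀ i, |Metric.partials φ p i| ≤ B * ‖coordVec (n := n) i‖ := fun i =>
        ((fderiv ℝ φ p).le_opNorm _).trans (by gcongr; exact h1 p)
      have e1 : |g.gradInner φ φ p| ≤ max M 0 * B ^ 2 := by
        have hMp := hM ⟨p, hp, rfl⟩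
        calc |g.gradInner φ φ p|
            ≤ ∑ i, ∑ j, |Metric.partials φ p i * ((g.coeff p)⁻¹ i j * Metric.partials φ p j)| := by
              simp only [Metric.gradInner, dotProduct, Matrix.mulVec, Finset.mul_sum]
              exact (Finset.abs_sum_le_sum_abs _ _).trans
                (Finset.sum_le_sum fun i _ => Finset.abs_sum_le_sum_abs _ _)
          _ ≤ ∑ i, ∑ j, B ^ 2 * (|(g.coeff p)⁻¹ i j| * (‖coordVec (n := n) i‖ *
                ‖coordVec (n := n) j‖)) := by
              refine Finset.sum_le_sum fun i _ => Finset.sum_le_sum fun j _ => ?_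
              rw [abs_mul, abs_mul]
              calc _ ≤ (B * ‖coordVec (n := n) i‖) * (|(g.coeff p)⁻¹ i j| *
                    (B * ‖coordVec (n := n) j‖)) := by
                    gcongr
                    · exact hpart i
                    · exact hpart j
                _ = _ := by ring
          _ = B ^ 2 * ∑ i, ∑ j, (|(g.coeff p)⁻¹ i j| * (‖coordVec (n := n) i‖ *
                ‖coordVec (n := n) j‖)) := by simp only [Finset.mul_sum]
          _ ≤ max M 0 * B ^ 2 := by
              rw [mul_comm]
              gcongr
              exact hMp.trans (le_max_left _ _)
      have e2 : |φ p * φ p| ≤ B ^ 2 := by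
        rw [abs_mul, sq]
        gcongr <;> exact h0 p
      calc _ ≤ |g.gradInner φ φ p| + |m ^ 2 * (φ p * φ p)| := abs_add_le _ _
        _ ≤ max M 0 * B ^ 2 + m ^ 2 * B ^ 2 := by
          rw [abs_mul (m ^ 2), abs_of_nonneg (sq_nonneg m)]
          gcongr
        _ = _ := by ring
    · rw [Set.indicator_of_notMem hp]
      have hp' : p ∉ tsupport φ := fun h => hp (hK h)
      have h0 : φ p = 0 := image_eq_zero_of_notMem_tsupport hp'
      have h1 : Metric.partials φ p = 0 := by
        ext i
        have : fderiv ℝ φ p = 0 :=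
          image_eq_zero_of_notMem_tsupport fun h => hp' (tsupport_fderiv_subset ℝ h)
        simp [Metric.partials, this]
      simp [Metric.gradInner, h0, h1]
  have hint : Integrable ((K : Set (Spacetime n)).indicator
      (fun _ : Spacetime n => (max M 0 + m ^ 2) * B ^ 2)) g.vol :=
    (integrable_indicator_iff K.isCompact.measurableSet).2 (integrableOn_const hfin)
  calc g.energy m φ φ ≤ ∫ p, ‖g.gradInner φ φ p + m ^ 2 * (φ p * φ p)‖ ∂g.vol :=
        (le_abs_self _).trans (norm_integral_le_integral_norm
          (fun p => g.gradInner φ φ p + m ^ 2 * (φ p * φ p)))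
    _ ≤ ∫ p, (K : Set (Spacetime n)).indicator
          (fun _ => (max M 0 + m ^ 2) * B ^ 2) p ∂g.vol :=
        integral_mono (g.integrable_energy m φ φ).norm hint key
    _ = _ := by
        rw [integral_indicator_const _ K.isCompact.measurableSet, smul_eq_mul]
        ring

/-- The inclusion of the test functions into the energy space is continuous. -/
def toEnergyCLM (g : Metric n) (m : ℝ) : Test n →L[ℝ] EnergySpace g m :=
  TestFunction.limitCLM ℝ (toEnergy g m)
    (fun K hK => ContDiffMapSupportedIn.mkCLMtoNormedSpace ℝ
      (fun φ => toEnergy g m (TestFunction.ofSupportedIn hK φ))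
      (fun φ ψ => (toEnergy g m).map_add (TestFunction.ofSupportedIn hK φ)
        (TestFunction.ofSupportedIn hK ψ))
      (fun c φ => (toEnergy g m).map_smul c (TestFunction.ofSupportedIn hK φ))
      (by
        obtain ⟨C, hC, h⟩ := energy_le g m K
        refine ⟨{0, 1}, √C, Real.sqrt_nonneg _, fun φ => ?_⟩
        set B : ℝ := (({0, 1} : Finset ℕ).sup
          fun i => ContDiffMapSupportedIn.seminorm ℝ _ ℝ ⊤ K i) φ with hB
        have hle : ∀ i ∈ ({0, 1} : Finset ℕ), ContDiffMapSupportedIn.seminorm ℝ _ ℝ ⊤ K i φ ≤ B :=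
          fun i hi => Seminorm.le_def.1 (Finset.le_sup (f := fun i =>
            ContDiffMapSupportedIn.seminorm ℝ (Spacetime n) ℝ ⊤ K i) hi) φ
        have hB0 : 0 ≤ B := apply_nonneg _ _
        rw [norm_toEnergy]
        refine (Real.sqrt_le_sqrt (h (TestFunction.ofSupportedIn hK φ) B hB0
          φ.tsupport_subset (fun p => ?_) (fun p => ?_))).trans ?_
        · exact (ContDiffMapSupportedIn.norm_apply_le_seminorm ℝ).trans (hle 0 (by simp))
        · rw [← norm_iteratedFDeriv_one]
          exact (ContDiffMapSupportedIn.norm_iteratedFDeriv_apply_le_seminorm_top ℝ).trans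
            (hle 1 (by simp))
        · rw [Real.sqrt_mul hC, Real.sqrt_sq hB0]))
    (fun _ _ _ => rfl)

@[simp] lemma toEnergyCLM_apply (g : Metric n) (m : ℝ) (φ : Test n) :
    toEnergyCLM g m φ = toEnergy g m φ := rfl

/-- The distributions `f` for which `⟨f, (Δ + m²)⁻¹ f⟩` is finite, that is,
which are bounded on test functions with respect to the energy norm. -/
def fieldSubmodule (g : Metric n) (m : ℝ) : Submodule ℂ (Distr n) where
  carrier := {f | ∃ C : ℝ, ∀ φ : Test n, ‖f φ‖ ≤ C * √(g.energy m φ φ)}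
  zero_mem' := ⟨0, fun φ => by simp⟩
  add_mem' := by
    rintro f h ⟨C, hC⟩ ⟨D, hD⟩
    exact ⟨C + D, fun φ => (norm_add_le (f φ) (h φ)).trans (by linarith [hC φ, hD φ])⟩
  smul_mem' := by
    rintro c f ⟨C, hC⟩
    refine ⟨‖c‖ * C, fun φ => ?_⟩
    have : (c • f) φ = c * f φ := rfl
    rw [this, norm_mul, mul_assoc]
    gcongr
    exact hC φ

/-- The space `N`. -/
def FieldSpace (g : Metric n) (m : ℝ) : Type := fieldSubmodule g m

namespace FieldSpace

variable {g : Metric n} {m : ℝ}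

instance : AddCommGroup (FieldSpace g m) := inferInstanceAs (AddCommGroup (fieldSubmodule g m))
instance : Module ℂ (FieldSpace g m) := inferInstanceAs (Module ℂ (fieldSubmodule g m))

/-- The inclusion `N ⊆ D'(ℝⁿ⁺¹)`. -/
def toDistr (g : Metric n) (m : ℝ) : FieldSpace g m →ₗ[ℂ] Distr n := (fieldSubmodule g m).subtype

lemma toDistr_injective : Function.Injective (toDistr g m) := Subtype.val_injective

lemma exists_riesz {T : Test n →ₗ[ℝ] ℝ} (hT : ∃ C : ℝ, ∀ φ : Test n, |T φ| ≤ C * √(g.energy m φ φ)) :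
    ∃ u : EnergySpace g m, ∀ φ, inner ℝ u (toEnergy g m φ) = T φ := by
  refine ⟨(InnerProductSpace.toDual ℝ (EnergySpace g m)).symm
    (T.extendOfNorm (toEnergy g m)), fun φ => ?_⟩
  rw [InnerProductSpace.toDual_symm_apply]
  refine LinearMap.extendOfNorm_eq (denseRange_toEnergy g m) ?_ φ
  obtain ⟨C, hC⟩ := hT
  exact ⟨C, fun φ => by rw [norm_toEnergy]; exact hC φ⟩

lemma energySpace_ext {u v : EnergySpace g m}
    (h : ∀ φ, inner ℝ u (toEnergy g m φ) = inner ℝ v (toEnergy g m φ)) : u = v := by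
  refine ext_inner_right ℝ fun w => ?_
  exact congrFun (DenseRange.equalizer (f := toEnergy g m) (denseRange_toEnergy g m)
    (continuous_const.inner continuous_id) (continuous_const.inner continuous_id) (funext h)) w

lemma exists_rePotential (f : FieldSpace g m) :
    ∃ u : EnergySpace g m, ∀ φ, inner ℝ u (toEnergy g m φ) = (toDistr g m f φ).re := by
  obtain ⟨C, hC⟩ := f.2
  exact exists_riesz (T := Complex.reLm ∘ₗ (toDistr g m f).toLinearMap)
    ⟨C, fun φ => (Complex.abs_re_le_norm _).trans (hC φ)⟩

lemma exists_imPotential (f : FieldSpace g m) :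
    ∃ u : EnergySpace g m, ∀ φ, inner ℝ u (toEnergy g m φ) = (toDistr g m f φ).im := by
  obtain ⟨C, hC⟩ := f.2
  exact exists_riesz (T := Complex.imLm ∘ₗ (toDistr g m f).toLinearMap)
    ⟨C, fun φ => (Complex.abs_im_le_norm _).trans (hC φ)⟩

/-- The real part of `(Δ + m²)⁻¹ f`: the vector `u` of the energy space with
`⟨u, (Δ + m²) φ⟩ = Re f(φ)` for all test functions `φ`. -/
def rePotential (f : FieldSpace g m) : EnergySpace g m := (exists_rePotential f).choose

/-- The imaginary part of `(Δ + m²)⁻¹ f`. -/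
def imPotential (f : FieldSpace g m) : EnergySpace g m := (exists_imPotential f).choose

lemma inner_rePotential (f : FieldSpace g m) (φ : Test n) :
    inner ℝ (rePotential f) (toEnergy g m φ) = (toDistr g m f φ).re :=
  (exists_rePotential f).choose_spec φ

lemma inner_imPotential (f : FieldSpace g m) (φ : Test n) :
    inner ℝ (imPotential f) (toEnergy g m φ) = (toDistr g m f φ).im :=
  (exists_imPotential f).choose_spec φ

lemma toDistr_add_apply (f h : FieldSpace g m) (φ : Test n) :
    toDistr g m (f + h) φ = toDistr g m f φ + toDistr g m h φ := rfl

lemma toDistr_smul_apply (c : ℂ) (f : FieldSpace g m) (φ : Test n) :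
    toDistr g m (c • f) φ = c * toDistr g m f φ := rfl

lemma rePotential_add (f h : FieldSpace g m) :
    rePotential (f + h) = rePotential f + rePotential h :=
  energySpace_ext fun φ => by simp [inner_rePotential, inner_add_left]

lemma imPotential_add (f h : FieldSpace g m) :
    imPotential (f + h) = imPotential f + imPotential h :=
  energySpace_ext fun φ => by simp [inner_imPotential, inner_add_left]

lemma rePotential_smul (c : ℂ) (f : FieldSpace g m) :
    rePotential (c • f) = c.re • rePotential f - c.im • imPotential f :=
  energySpace_ext fun φ => by
    simp [inner_rePotential, inner_imPotential, inner_sub_left, real_inner_smul_left]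

lemma imPotential_smul (c : ℂ) (f : FieldSpace g m) :
    imPotential (c • f) = c.re • imPotential f + c.im • rePotential f :=
  energySpace_ext fun φ => by
    simp [inner_rePotential, inner_imPotential, inner_add_left, real_inner_smul_left]

/-- The inner product `⟨f, h⟩_N = ∬ f̄ E_m h = ⟨f, (Δ + m²)⁻¹ h⟩`: with `u = (Δ + m²)⁻¹ f` and
`v = (Δ + m²)⁻¹ h` it is the energy inner product `⟨u, (Δ + m²) v⟩`. -/
@[reducible]
def core (g : Metric n) (m : ℝ) : InnerProductSpace.Core ℂ (FieldSpace g m) where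
  inner f h :=
    ⟨inner ℝ (rePotential f) (rePotential h) + inner ℝ (imPotential f) (imPotential h),
      inner ℝ (rePotential f) (imPotential h) - inner ℝ (imPotential f) (rePotential h)⟩
  conj_inner_symm f h := by
    apply Complex.ext
    · simp [real_inner_comm]
    · simp [real_inner_comm]
  re_inner_nonneg f := add_nonneg real_inner_self_nonneg real_inner_self_nonneg
  add_left f h k := by
    apply Complex.ext <;> simp [rePotential_add, imPotential_add, inner_add_left] <;> ring
  smul_left f h c := by
    apply Complex.ext <;>
      simp [rePotential_smul, imPotential_smul, inner_add_left, inner_sub_left,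
        real_inner_smul_left] <;> ring
  definite f hf := by
    have h : inner ℝ (rePotential f) (rePotential f) + inner ℝ (imPotential f) (imPotential f)
      = 0 := congrArg Complex.re hf
    have h1 : 0 ≤ inner ℝ (rePotential f) (rePotential f) := real_inner_self_nonneg
    have h2 : 0 ≤ inner ℝ (imPotential f) (imPotential f) := real_inner_self_nonneg
    have h3 : rePotential f = 0 := (inner_self_eq_zero (𝕜 := ℝ)).1 (by linarith)
    have h4 : imPotential f = 0 := (inner_self_eq_zero (𝕜 := ℝ)).1 (by linarith)
    apply toDistr_injective
    ext φ
    apply Complex.ext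
    · rw [← inner_rePotential, h3]; simp
    · rw [← inner_imPotential, h4]; simp

instance : NormedAddCommGroup (FieldSpace g m) :=
  @InnerProductSpace.Core.toNormedAddCommGroup ℂ (FieldSpace g m) _ _ _ (core g m)

instance : InnerProductSpace ℂ (FieldSpace g m) := InnerProductSpace.ofCore (core g m).toCore

lemma norm_sq_eq (f : FieldSpace g m) :
    ‖f‖ ^ 2 = ‖rePotential f‖ ^ 2 + ‖imPotential f‖ ^ 2 := by
  have h : (inner ℂ f f).re = inner ℝ (rePotential f) (rePotential f) +
    inner ℝ (imPotential f) (imPotential f) := rfl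
  rw [← inner_self_eq_norm_sq (𝕜 := ℂ), ← real_inner_self_eq_norm_sq, ← real_inner_self_eq_norm_sq]
  exact h

/-- The element of `N` with prescribed potentials. -/
def ofPotentials (u v : EnergySpace g m) : FieldSpace g m :=
  ⟨Complex.ofRealCLM ∘L (innerSL ℝ u ∘L toEnergyCLM g m) +
    Complex.I • (Complex.ofRealCLM ∘L (innerSL ℝ v ∘L toEnergyCLM g m)), by
    refine ⟨‖u‖ + ‖v‖, fun φ => ?_⟩
    have h1 : |inner ℝ u (toEnergy g m φ)| ≤ _ := abs_real_inner_le_norm _ _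
    have h2 : |inner ℝ v (toEnergy g m φ)| ≤ _ := abs_real_inner_le_norm _ _
    change ‖((inner ℝ u (toEnergy g m φ) : ℝ) : ℂ) +
      Complex.I * ((inner ℝ v (toEnergy g m φ) : ℝ) : ℂ)‖ ≤ _
    refine (norm_add_le _ _).trans ?_
    rw [norm_mul, Complex.norm_I, one_mul, Complex.norm_real, Complex.norm_real, add_mul,
      ← norm_toEnergy]
    exact add_le_add h1 h2⟩

lemma toDistr_ofPotentials (u v : EnergySpace g m) (φ : Test n) :
    toDistr g m (ofPotentials u v) φ = ((inner ℝ u (toEnergy g m φ) : ℝ) : ℂ) +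
      Complex.I * ((inner ℝ v (toEnergy g m φ) : ℝ) : ℂ) := rfl

lemma rePotential_ofPotentials (u v : EnergySpace g m) : rePotential (ofPotentials u v) = u :=
  energySpace_ext fun φ => by simp [inner_rePotential, toDistr_ofPotentials]

lemma imPotential_ofPotentials (u v : EnergySpace g m) : imPotential (ofPotentials u v) = v :=
  energySpace_ext fun φ => by simp [inner_imPotential, toDistr_ofPotentials]

lemma rePotential_sub (f h : FieldSpace g m) :
    rePotential (f - h) = rePotential f - rePotential h :=
  eq_sub_of_add_eq (by rw [← rePotential_add, sub_add_cancel])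

lemma imPotential_sub (f h : FieldSpace g m) :
    imPotential (f - h) = imPotential f - imPotential h :=
  eq_sub_of_add_eq (by rw [← imPotential_add, sub_add_cancel])

lemma norm_rePotential_le (f : FieldSpace g m) : ‖rePotential f‖ ≤ ‖f‖ :=
  abs_le_of_sq_le_sq' (by nlinarith [norm_sq_eq f, sq_nonneg ‖imPotential f‖]) (norm_nonneg _) |>.2

lemma norm_imPotential_le (f : FieldSpace g m) : ‖imPotential f‖ ≤ ‖f‖ :=
  abs_le_of_sq_le_sq' (by nlinarith [norm_sq_eq f, sq_nonneg ‖rePotential f‖]) (norm_nonneg _) |>.2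

lemma norm_le_add (f : FieldSpace g m) : ‖f‖ ≤ ‖rePotential f‖ + ‖imPotential f‖ := by
  have h1 := norm_nonneg (rePotential f)
  have h2 := norm_nonneg (imPotential f)
  have h3 := mul_nonneg h1 h2
  refine (abs_le_of_sq_le_sq' ?_ (add_nonneg h1 h2)).2
  nlinarith [norm_sq_eq f]

instance : CompleteSpace (FieldSpace g m) := by
  refine Metric.complete_of_cauchySeq_tendsto fun u hu => ?_
  have hR : CauchySeq fun k => rePotential (u k) := by
    rw [Metric.cauchySeq_iff'] at hu ⊢
    intro ε hε
    obtain ⟨k₀, hk₀⟩ := hu ε hε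
    refine ⟨k₀, fun k hk => lt_of_le_of_lt ?_ (hk₀ k hk)⟩
    rw [dist_eq_norm, dist_eq_norm, ← rePotential_sub]
    exact norm_rePotential_le _
  have hI : CauchySeq fun k => imPotential (u k) := by
    rw [Metric.cauchySeq_iff'] at hu ⊢
    intro ε hε
    obtain ⟨k₀, hk₀⟩ := hu ε hε
    refine ⟨k₀, fun k hk => lt_of_le_of_lt ?_ (hk₀ k hk)⟩
    rw [dist_eq_norm, dist_eq_norm, ← imPotential_sub]
    exact norm_imPotential_le _
  obtain ⟨a, ha⟩ := cauchySeq_tendsto_of_complete hR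
  obtain ⟨b, hb⟩ := cauchySeq_tendsto_of_complete hI
  refine ⟨ofPotentials a b, ?_⟩
  rw [tendsto_iff_norm_sub_tendsto_zero] at ha hb ⊢
  refine squeeze_zero (fun _ => norm_nonneg _) (fun k => norm_le_add _) ?_
  simpa [rePotential_sub, imPotential_sub, rePotential_ofPotentials, imPotential_ofPotentials]
    using ha.add hb

/-- Evaluation at a test function is continuous on `N`. -/
lemma norm_toDistr_apply_le (f : FieldSpace g m) (φ : Test n) :
    ‖toDistr g m f φ‖ ≤ 2 * √(g.energy m φ φ) * ‖f‖ := by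
  have h1 : |inner ℝ (rePotential f) (toEnergy g m φ)| ≤ _ := abs_real_inner_le_norm _ _
  have h2 : |inner ℝ (imPotential f) (toEnergy g m φ)| ≤ _ := abs_real_inner_le_norm _ _
  rw [inner_rePotential, norm_toEnergy] at h1
  rw [inner_imPotential, norm_toEnergy] at h2
  have h3 := Complex.norm_le_abs_re_add_abs_im (toDistr g m f φ)
  have h4 := mul_le_mul_of_nonneg_right (norm_rePotential_le f) (Real.sqrt_nonneg (g.energy m φ φ))
  have h5 := mul_le_mul_of_nonneg_right (norm_imPotential_le f) (Real.sqrt_nonneg (g.energy m φ φ))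
  linarith

/-- Evaluation of the elements of `N` at a test function. -/
def evalCLM (g : Metric n) (m : ℝ) (φ : Test n) : FieldSpace g m →L[ℂ] ℂ :=
  LinearMap.mkContinuous
    { toFun := fun f => toDistr g m f φ
      map_add' := fun _ _ => rfl
      map_smul' := fun _ _ => rfl } (2 * √(g.energy m φ φ)) fun f => norm_toDistr_apply_le f φ

end FieldSpace


/-- The embedding `x ↦ (σ, x)` of the slice `t = σ`. -/
lemma contDiff_slice (σ : ℝ) : ContDiff ℝ ∞ (fun x : Slice n => ((σ, x) : Spacetime n)) :=
  contDiff_const.prodMk contDiff_id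

lemma norm_iteratedFDeriv_slice_le (σ : ℝ) {f : Spacetime n → ℝ} (hf : ContDiff ℝ ∞ f) (i : ℕ)
    (x : Slice n) : ‖iteratedFDeriv ℝ i (fun y : Slice n => f (σ, y)) x‖ ≤
      ‖ContinuousLinearMap.inr ℝ ℝ (Slice n)‖ ^ i * ‖iteratedFDeriv ℝ i f (σ, x)‖ := by
  have hf' : ContDiff ℝ ∞ (fun p : Spacetime n => f ((σ, 0) + p)) :=
    hf.comp (contDiff_const.add contDiff_id)
  have h := (ContinuousLinearMap.inr ℝ ℝ (Slice n)).iteratedFDeriv_comp_right hf' x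
    (i := i) (by exact_mod_cast le_top)
  have e : ((fun p : Spacetime n => f ((σ, 0) + p)) ∘ ContinuousLinearMap.inr ℝ ℝ (Slice n)) =
      fun y : Slice n => f (σ, y) := by
    ext y; simp
  rw [e, iteratedFDeriv_comp_add_left] at h
  rw [h]
  refine (ContinuousMultilinearMap.norm_compContinuousLinearMap_le _ _).trans ?_
  simp [mul_comm]

lemma norm_iteratedFDeriv_comp_snd_le {f : Slice n → ℝ} (hf : ContDiff ℝ ∞ f) (i : ℕ)
    (p : Spacetime n) : ‖iteratedFDeriv ℝ i (fun q : Spacetime n => f q.2) p‖ ≤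
      ‖ContinuousLinearMap.snd ℝ ℝ (Slice n)‖ ^ i * ‖iteratedFDeriv ℝ i f p.2‖ := by
  have h := (ContinuousLinearMap.snd ℝ ℝ (Slice n)).iteratedFDeriv_comp_right hf p
    (i := i) (by exact_mod_cast le_top)
  have e : (f ∘ ContinuousLinearMap.snd ℝ ℝ (Slice n)) = fun q : Spacetime n => f q.2 := rfl
  rw [e] at h
  rw [h]
  refine (ContinuousMultilinearMap.norm_compContinuousLinearMap_le _ _).trans ?_
  simp [mul_comm]

/-- The restriction `φ ↦ φ(σ, ·)` of a test function to the slice `t = σ`. -/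
def restrictFun (σ : ℝ) (φ : Test n) : SliceTest n where
  toFun x := φ (σ, x)
  contDiff' := φ.contDiff.comp (contDiff_slice σ)
  hasCompactSupport' := by
    refine HasCompactSupport.intro (φ.hasCompactSupport.isCompact.image continuous_snd)
      fun x hx => ?_
    by_contra h
    exact hx ⟨(σ, x), subset_tsupport _ h, rfl⟩
  tsupport_subset' := fun _ _ => trivial

/-- A linear map between spaces of test functions on different vector spaces is continuous if it
satisfies seminorm bounds. -/
lemma continuous_of_seminorm_bound {E₁ E₂ : Type} [NormedAddCommGroup E₁] [NormedSpace ℝ E₁]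
    [NormedAddCommGroup E₂] [NormedSpace ℝ E₂] {K₁ : Compacts E₁} {K₂ : Compacts E₂}
    (Φ : 𝓓^{⊤}_{K₁}(E₁, ℝ) →ₗ[ℝ] 𝓓^{⊤}_{K₂}(E₂, ℝ))
    (hbound : ∀ i : ℕ, ∃ (s : Finset ℕ) (C : ℝ), 0 ≤ C ∧ ∀ φ, ∀ x ∈ K₂,
      ‖iteratedFDeriv ℝ i (Φ φ) x‖ ≤
        C * (s.sup fun k => ContDiffMapSupportedIn.seminorm ℝ E₁ ℝ ⊤ K₁ k) φ) :
    Continuous Φ := by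
  refine WithSeminorms.continuous_of_isBounded (ContDiffMapSupportedIn.withSeminorms ℝ E₁ ℝ ⊤ K₁)
    (ContDiffMapSupportedIn.withSeminorms ℝ E₂ ℝ ⊤ K₂) _ (.of_real fun i => ?_)
  obtain ⟨s, C, hC, h⟩ := hbound i
  exact ⟨s, C, fun φ => ((Φ φ).seminorm_top_le_iff ℝ (mul_nonneg hC (apply_nonneg _ _)) i).2
    fun x hx => h φ x hx⟩

/-- The projection to `ℝⁿ` of a compact set. -/
def sliceCompact (K : Compacts (Spacetime n)) : Compacts (Slice n) :=
  ⟨Prod.snd '' (K : Set (Spacetime n)), K.isCompact.image continuous_snd⟩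

/-- The restriction of test functions with support in `K`. -/
def restrictAux (σ : ℝ) (K : Compacts (Spacetime n)) :
    𝓓^{⊤}_{K}(Spacetime n, ℝ) →L[ℝ] 𝓓^{⊤}_{sliceCompact K}(Slice n, ℝ) :=
  letI Φ : 𝓓^{⊤}_{K}(Spacetime n, ℝ) →ₗ[ℝ] 𝓓^{⊤}_{sliceCompact K}(Slice n, ℝ) :=
    { toFun := fun φ => ⟨fun x => φ (σ, x), φ.contDiff.comp (contDiff_slice σ),
        fun x hx => φ.zero_on_compl (x := (σ, x)) fun h => hx ⟨(σ, x), h, rfl⟩⟩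
      map_add' := fun _ _ => rfl
      map_smul' := fun _ _ => rfl }
  { toLinearMap := Φ
    cont := continuous_of_seminorm_bound Φ fun i =>
      ⟨{i}, ‖ContinuousLinearMap.inr ℝ ℝ (Slice n)‖ ^ i, by positivity, fun φ x _ =>
        (norm_iteratedFDeriv_slice_le σ φ.contDiff i x).trans (by
          rw [Finset.sup_singleton]
          gcongr
          exact ContDiffMapSupportedIn.norm_iteratedFDeriv_apply_le_seminorm_top ℝ)⟩ }

/-- The restriction to the slice `t = σ` as a continuous linear map. -/
def restrictCLM (σ : ℝ) : Test n →L[ℝ] SliceTest n :=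
  TestFunction.limitCLM ℝ (restrictFun σ)
    (fun K _ => TestFunction.ofSupportedInCLM ℝ (K := sliceCompact K) (fun _ _ => trivial) ∘L
      restrictAux σ K)
    (fun _ _ _ => rfl)

lemma restrictCLM_apply (σ : ℝ) (φ : Test n) (x : Slice n) : restrictCLM σ φ x = φ (σ, x) := rfl

/-- A fixed smooth cutoff in the `t`-direction which is `1` at `t = σ`. -/
def cutoff (σ : ℝ) : ContDiffBump σ := ⟨1, 2, one_pos, one_lt_two⟩

lemma contDiff_lift (σ : ℝ) {f : Slice n → ℝ} (hf : ContDiff ℝ ∞ f) :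
    ContDiff ℝ ∞ (fun p : Spacetime n => cutoff σ p.1 * f p.2) :=
  ((cutoff σ).contDiff.comp contDiff_fst).mul (hf.comp contDiff_snd)

/-- The extension of a test function on `ℝⁿ` to a test function on `ℝⁿ⁺¹`. -/
def liftFun (σ : ℝ) (χ : SliceTest n) : Test n where
  toFun p := cutoff σ p.1 * χ p.2
  contDiff' := contDiff_lift σ χ.contDiff
  hasCompactSupport' := by
    refine HasCompactSupport.intro
      ((cutoff σ).hasCompactSupport.isCompact.prod χ.hasCompactSupport.isCompact) fun p hp => ?_
    rw [Set.mem_prod, not_and_or] at hp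
    rcases hp with hp | hp
    · rw [image_eq_zero_of_notMem_tsupport hp, zero_mul]
    · rw [image_eq_zero_of_notMem_tsupport hp, mul_zero]
  tsupport_subset' := fun _ _ => trivial

/-- The compact set which carries the extensions of test functions with support in `K`. -/
def liftCompact (σ : ℝ) (K : Compacts (Slice n)) : Compacts (Spacetime n) :=
  ⟨tsupport (cutoff σ) ×ˢ (K : Set (Slice n)),
    (cutoff σ).hasCompactSupport.isCompact.prod K.isCompact⟩

/-- The extension of test functions with support in `K`. -/
def liftAux (σ : ℝ) (K : Compacts (Slice n)) :
    𝓓^{⊤}_{K}(Slice n, ℝ) →L[ℝ] 𝓓^{⊤}_{liftCompact σ K}(Spacetime n, ℝ) :=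
  letI Φ : 𝓓^{⊤}_{K}(Slice n, ℝ) →ₗ[ℝ] 𝓓^{⊤}_{liftCompact σ K}(Spacetime n, ℝ) :=
    { toFun := fun χ => ⟨fun p => cutoff σ p.1 * χ p.2, contDiff_lift σ χ.contDiff, fun p hp => by
        have hp' : p ∉ tsupport (cutoff σ) ×ˢ (K : Set (Slice n)) := hp
        rw [Set.mem_prod, not_and_or] at hp'
        rcases hp' with hp | hp
        · simp [image_eq_zero_of_notMem_tsupport hp]
        · simp [χ.zero_on_compl hp]⟩
      map_add' := fun _ _ => ContDiffMapSupportedIn.ext fun _ => mul_add _ _ _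
      map_smul' := fun _ _ => ContDiffMapSupportedIn.ext fun _ => mul_left_comm _ _ _ }
  { toLinearMap := Φ
    cont := continuous_of_seminorm_bound Φ fun i => by
      have hη : ContDiff ℝ ∞ (fun p : Spacetime n => cutoff σ p.1) :=
        (cutoff σ).contDiff.comp contDiff_fst
      have hb : ∀ k, ∃ M : ℝ, ∀ p ∈ liftCompact σ K,
          ‖iteratedFDeriv ℝ k (fun p : Spacetime n => cutoff σ p.1) p‖ ≤ M := fun k =>
        (liftCompact σ K).isCompact.exists_bound_of_continuousOn
          (hη.continuous_iteratedFDeriv (by exact_mod_cast le_top)).continuousOn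
      choose M hM using hb
      refine ⟨Finset.range (i + 1), ∑ k ∈ Finset.range (i + 1), (i.choose k : ℝ) *
        max (M k) 0 * ‖ContinuousLinearMap.snd ℝ ℝ (Slice n)‖ ^ (i - k),
        Finset.sum_nonneg fun k _ => by positivity, fun χ p hp => ?_⟩
      have hχ : ContDiff ℝ ∞ (fun p : Spacetime n => χ p.2) := χ.contDiff.comp contDiff_snd
      refine (norm_iteratedFDeriv_mul_le hη hχ p (n := i) (by exact_mod_cast le_top)).trans ?_
      rw [Finset.sum_mul]
      refine Finset.sum_le_sum fun k hk => ?_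
      rw [mul_assoc _ (_ ^ _)]
      gcongr
      · exact (hM k p hp).trans (le_max_left _ _)
      · refine (norm_iteratedFDeriv_comp_snd_le χ.contDiff _ p).trans ?_
        gcongr
        refine (ContDiffMapSupportedIn.norm_iteratedFDeriv_apply_le_seminorm_top ℝ).trans ?_
        exact Seminorm.le_def.1 (Finset.le_sup (f := fun i =>
          ContDiffMapSupportedIn.seminorm ℝ (Slice n) ℝ ⊤ K i)
          (Finset.mem_range.2 (by omega))) χ }

/-- The extension of test functions as a continuous linear map. -/
def liftCLM (σ : ℝ) : SliceTest n →L[ℝ] Test n :=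
  TestFunction.limitCLM ℝ (liftFun σ)
    (fun K _ => TestFunction.ofSupportedInCLM ℝ (K := liftCompact σ K) (fun _ _ => trivial) ∘L
      liftAux σ K)
    (fun _ _ _ => rfl)

lemma liftCLM_apply (σ : ℝ) (χ : SliceTest n) (p : Spacetime n) :
    liftCLM σ χ p = cutoff σ p.1 * χ p.2 := rfl

lemma restrictCLM_liftCLM (σ : ℝ) (χ : SliceTest n) : restrictCLM σ (liftCLM σ χ) = χ := by
  ext x
  rw [restrictCLM_apply, liftCLM_apply,
    (cutoff σ).one_of_mem_closedBall (Metric.mem_closedBall_self (cutoff σ).rIn_pos.le), one_mul]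

/-- The map `ψ ↦ ψ(x) δ(t - σ)` from `D'(ℝⁿ)` to `D'(ℝⁿ⁺¹)`. Functions on `ℝⁿ⁺¹` and on `ℝⁿ` are
regarded as distributions by integration against `√g dt dx` and `√g(σ, x) dx`, so that
`∬ ψ(x) δ(t - σ) φ(t, x) √g(t, x) dt dx = ∫ ψ(x) φ(σ, x) √g(σ, x) dx` reads
`(ψ δ(t - σ))(φ) = ψ(φ(σ, ·))`. -/
def tensorDelta (σ : ℝ) : SliceDistr n →ₗ[ℂ] Distr n where
  toFun ψ := (restrictCLM σ).precompCompactConvergenceCLM ℂ ψ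
  map_add' _ _ := rfl
  map_smul' _ _ := rfl

lemma tensorDelta_apply (σ : ℝ) (ψ : SliceDistr n) (φ : Test n) :
    tensorDelta σ ψ φ = ψ (restrictCLM σ φ) := rfl

lemma tensorDelta_injective (σ : ℝ) : Function.Injective (tensorDelta (n := n) σ) := by
  intro ψ χ h
  ext φ
  have := congrArg (fun T : Distr n => T (liftCLM σ φ)) h
  simpa [tensorDelta_apply, restrictCLM_liftCLM] using this

/-- The space `N_σ` of the distributions `ψ` on `ℝⁿ` for which
`∬ ψ̄(x) E_m(σ, x; σ, y) ψ(y) dμ_σ(x) dμ_σ(y) = ⟨ψ δ(t - σ), (Δ + m²)⁻¹ ψ δ(t - σ)⟩` is finite. -/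
def SliceSpace (g : Metric n) (m σ : ℝ) : Type :=
  (fieldSubmodule g m).comap (tensorDelta σ)

namespace SliceSpace

variable {g : Metric n} {m σ : ℝ}

instance : AddCommGroup (SliceSpace g m σ) :=
  inferInstanceAs (AddCommGroup ((fieldSubmodule g m).comap (tensorDelta σ)))
instance : Module ℂ (SliceSpace g m σ) :=
  inferInstanceAs (Module ℂ ((fieldSubmodule g m).comap (tensorDelta σ)))

/-- The inclusion `N_σ ⊆ D'(ℝⁿ)`. -/
def toDistr (g : Metric n) (m σ : ℝ) : SliceSpace g m σ →ₗ[ℂ] SliceDistr n :=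
  ((fieldSubmodule g m).comap (tensorDelta σ)).subtype

lemma toDistr_injective : Function.Injective (toDistr g m σ) := Subtype.val_injective

/-- `ψ ↦ ψ δ(t - σ)` as a linear map `N_σ → N`. -/
def delta (g : Metric n) (m σ : ℝ) : SliceSpace g m σ →ₗ[ℂ] FieldSpace g m where
  toFun ψ := ⟨tensorDelta σ (toDistr g m σ ψ), ψ.2⟩
  map_add' _ _ := rfl
  map_smul' _ _ := rfl

lemma toDistr_delta (ψ : SliceSpace g m σ) :
    FieldSpace.toDistr g m (delta g m σ ψ) = tensorDelta σ (toDistr g m σ ψ) := rfl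

lemma delta_injective : Function.Injective (delta g m σ) := fun _ _ h =>
  toDistr_injective (tensorDelta_injective σ (congrArg (FieldSpace.toDistr g m) h))

/-- The inner product of `N_σ`, given by the kernel `E_m(σ, x; σ, y)`, i.e. by the quadratic form of
`(Δ + m²)⁻¹` on distributions carried by the slice. -/
@[reducible]
def core (g : Metric n) (m σ : ℝ) : InnerProductSpace.Core ℂ (SliceSpace g m σ) where
  inner ψ χ := inner ℂ (delta g m σ ψ) (delta g m σ χ)
  conj_inner_symm _ _ := inner_conj_symm _ _
  re_inner_nonneg _ := inner_self_nonneg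
  add_left _ _ _ := by rw [map_add, inner_add_left]
  smul_left _ _ _ := by rw [map_smul, inner_smul_left]
  definite ψ h := delta_injective (by rw [map_zero]; exact inner_self_eq_zero.1 h)

instance : NormedAddCommGroup (SliceSpace g m σ) :=
  @InnerProductSpace.Core.toNormedAddCommGroup ℂ (SliceSpace g m σ) _ _ _ (core g m σ)

instance : InnerProductSpace ℂ (SliceSpace g m σ) := InnerProductSpace.ofCore (core g m σ).toCore

lemma inner_delta (ψ χ : SliceSpace g m σ) :
    inner ℂ (delta g m σ ψ) (delta g m σ χ) = inner ℂ ψ χ := rfl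

lemma norm_delta (ψ : SliceSpace g m σ) : ‖delta g m σ ψ‖ = ‖ψ‖ := by
  rw [norm_eq_sqrt_re_inner (𝕜 := ℂ), norm_eq_sqrt_re_inner (𝕜 := ℂ), inner_delta]

/-- The isometry underlying `j_σ`. -/
def deltaIsometry (g : Metric n) (m σ : ℝ) : SliceSpace g m σ →ₗᵢ[ℂ] FieldSpace g m :=
  ⟨delta g m σ, norm_delta⟩

/-- The elements of `N` of the form `ψ δ(t - σ)` are those which only depend on the values of test
functions at `t = σ`. -/
lemma mem_range_delta (f : FieldSpace g m) :
    f ∈ Set.range (delta g m σ) ↔ ∀ φ : Test n,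
      FieldSpace.toDistr g m f φ =
        FieldSpace.toDistr g m f (liftCLM σ (restrictCLM σ φ)) := by
  constructor
  · rintro ⟨ψ, rfl⟩ φ
    rw [toDistr_delta, tensorDelta_apply, tensorDelta_apply, restrictCLM_liftCLM]
  · intro h
    have e : tensorDelta σ ((liftCLM σ).precompCompactConvergenceCLM ℂ
        (FieldSpace.toDistr g m f)) = FieldSpace.toDistr g m f := by
      ext φ
      exact (h φ).symm
    refine ⟨⟨(liftCLM σ).precompCompactConvergenceCLM ℂ (FieldSpace.toDistr g m f), ?_⟩,
      FieldSpace.toDistr_injective e⟩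
    rw [Submodule.mem_comap, e]
    exact f.2

instance : CompleteSpace (SliceSpace g m σ) := by
  have hcl : IsClosed (Set.range (delta g m σ)) := by
    have : Set.range (delta g m σ) = ⋂ φ : Test n, {f | FieldSpace.evalCLM g m φ f =
        FieldSpace.evalCLM g m (liftCLM σ (restrictCLM σ φ)) f} := by
      ext f
      simp only [Set.mem_iInter]
      exact mem_range_delta f
    rw [this]
    exact isClosed_iInter fun φ => isClosed_eq (ContinuousLinearMap.continuous _)
      (ContinuousLinearMap.continuous _)
  exact (completeSpace_iff_isComplete_range
    (deltaIsometry g m σ).isometry.isUniformInducing).2 hcl.isComplete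

end SliceSpace

/-- The operator `j_σ : N_σ → N`, `(j_σ ψ)(t, x) = ψ(x) δ(t - σ)`. -/
def j (g : Metric n) (m σ : ℝ) : SliceSpace g m σ →L[ℂ] FieldSpace g m :=
  (SliceSpace.deltaIsometry g m σ).toContinuousLinearMap

/-- The operator `U_{σ,σ'} = j_σ^* ∘ j_σ' : N_σ' → N_σ`. -/
def U (g : Metric n) (m σ σ' : ℝ) : SliceSpace g m σ' →L[ℂ] SliceSpace g m σ :=
  ContinuousLinearMap.adjoint (j g m σ) ∘L j g m σ'

/-- The subspace `N_Λ` of the elements of `N` with support in the closed set `Λ`, i.e. which vanish on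
the complement of `Λ`. -/
def supportedIn (g : Metric n) (m : ℝ) (Λ : Set (Spacetime n)) : Submodule ℂ (FieldSpace g m) where
  carrier := {f | Distribution.IsVanishingOn (FieldSpace.toDistr g m f) Λᶜ}
  zero_mem' _ _ := rfl
  add_mem' {f h} hf hh φ hφ := by
    rw [FieldSpace.toDistr_add_apply, hf φ hφ, hh φ hφ, add_zero]
  smul_mem' c f hf φ hφ := by rw [FieldSpace.toDistr_smul_apply, hf φ hφ, mul_zero]

instance (g : Metric n) (m : ℝ) (Λ : Set (Spacetime n)) : CompleteSpace (supportedIn g m Λ) := by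
  have hcl : IsClosed (supportedIn g m Λ : Set (FieldSpace g m)) := by
    have : (supportedIn g m Λ : Set (FieldSpace g m)) =
        ⋂ (φ : Test n) (_ : tsupport φ ⊆ Λᶜ), {f | FieldSpace.evalCLM g m φ f = 0} := by
      ext f
      simp only [Set.mem_iInter]
      exact Iff.rfl
    rw [this]
    exact isClosed_iInter fun φ => isClosed_iInter fun _ =>
      isClosed_eq (ContinuousLinearMap.continuous _) continuous_const
  exact hcl.isComplete.completeSpace_coe

/-- The orthogonal projection `e_Λ` of `N` onto `N_Λ`. -/
def e (g : Metric n) (m : ℝ) (Λ : Set (Spacetime n)) : FieldSpace g m →L[ℂ] FieldSpace g m :=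
  (supportedIn g m Λ).starProjection

/-- `C` separates `A` and `B`: outside `C`, the sets `A` and `B` lie in two disjoint open sets which
together fill the complement of `C`. -/
def Separates (C A B : Set (Spacetime n)) : Prop :=
  ∃ V W : Set (Spacetime n), IsOpen V ∧ IsOpen W ∧ Disjoint V W ∧ V ∪ W = Cᶜ ∧
    A \ C ⊆ V ∧ B \ C ⊆ W

/-- `u = (Δ + m²)⁻¹ f` for the Friedrichs extension of `Δ` on `L²(√g dt dx)`: the function `u` is in
the form domain, as a limit in `L²` of test functions which are Cauchy in the energy norm, and
`(Δ + m²) u = f` weakly. -/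
structure IsResolvent (g : Metric n) (m : ℝ) (f u : Spacetime n → ℝ) : Prop where
  memLp : MemLp u 2 g.vol
  formDomain : ∃ φ : ℕ → Test n,
    Tendsto (fun k => eLpNorm (fun p => u p - φ k p) 2 g.vol) atTop (𝓝 0) ∧
    Tendsto (fun k : ℕ × ℕ => g.energy m (φ k.1 - φ k.2) (φ k.1 - φ k.2)) atTop (𝓝 0)
  weak : ∀ χ : Test n,
    ∫ p, u p * (g.laplaceBeltrami χ p + m ^ 2 * χ p) ∂g.vol = ∫ p, f p * χ p ∂g.vol

/-- `E` is the kernel `E_m` of `(Δ + m²)⁻¹` on `L²(√g dt dx)`, continuous away from the diagonal. -/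
structure IsGreenKernel (g : Metric n) (m : ℝ) (E : Spacetime n → Spacetime n → ℝ) : Prop where
  continuousOn : ContinuousOn (fun q : Spacetime n × Spacetime n => E q.1 q.2) {q | q.1 ≠ q.2}
  integrable : ∀ φ : Test n, ∀ᵐ p ∂g.vol, Integrable (fun q => E p q * φ q) g.vol
  resolvent : ∀ φ : Test n, IsResolvent g m φ fun p => ∫ q, E p q * φ q ∂g.vol

end CurvedField
end

open MeasureTheory TopologicalSpace Filter Topology
open scoped Distributions ContDiff ComplexConjugate

noncomputable section

namespace CurvedField

variable {n : ℕ}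

/-! An element `f` of `N` is encoded by its potential `(Δ + m²)⁻¹ f` in the energy space. The
vectors `charge g m φ`, that is `(Δ + m²) φ`, are reproducing: their inner product with `f` is
`f(φ)`. Hence the closed span `charges g m O` of those with `supp φ ⊆ O` is the orthogonal
complement of the distributions which vanish on `O`. Locality of the operator enters as the
vanishing of the energy form on functions with disjoint supports.

Markoff property (`markoff`): let `V`, `W` be the two open sides of `C`, facing `A` and `B`. For `h
= e_B f`, subtract from `h` its projection `w` onto `charges g m W`. Then `h - w` vanishes on `W`,
and by locality it still vanishes on `V`, so it is supported in `C`; moreover `w` is orthogonal to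
`N_C` and to `N_A`. Thus `e_C h = h - w` and `e_A e_C h = e_A h`.

Propagator: `j_σ` is an isometry, which gives `U_{σ,σ} = 1` and the norm bound. The composition law
is the Markoff property for three slices, once `j_σ j_σ^*` is known to be the projection onto `N_{t
= σ}` (`j_comp_adjoint_j`). This means that an element of `N` carried by a slice contains no normal
derivatives of `δ(t - σ)`: a test function vanishing on the slice is a weak limit in the energy
space of truncations supported off the slice (`toDistr_eq_zero_of_vanishing`).

Kernel formulas: the resolvent preserves positivity, because an approximate absolute value does not
increase the energy (`inner_potential_nonneg`); so `E ≥ 0` off the diagonal, and Tonelli's theorem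
gives the formula on spacetime. On a slice nothing is assumed about the singularity of `E`. For
densities with disjoint supports the formula follows by mollifying in `t` (`slice_of_disjoint`). In
general the densities are cut into slabs of width `2 / (k + 1)` along one coordinate. Distant slabs
fall under the disjoint case; pairs of close slabs contribute at most a multiple of the sum of the
squared norms, which a trace inequality bounds by a multiple of `(k + 1)^(-1/2)`
(`exists_sum_norm_slab_le`). As `E ≥ 0`, the distant pairs approximate the full integrand from
below, and Fatou's lemma with dominated convergence gives the formula. -/

/-- The test function given by a smooth function with compact support. -/
def mkTest {E F : Type} [NormedAddCommGroup E] [NormedSpace ℝ E] [NormedAddCommGroup F]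
    [NormedSpace ℝ F] (f : E → F) (hf : ContDiff ℝ ∞ f) (hc : HasCompactSupport f) :
    𝓓((⊤ : Opens E), F) where
  toFun := f
  contDiff' := hf
  hasCompactSupport' := hc
  tsupport_subset' _ _ := trivial

@[simp] lemma coe_mkTest {E F : Type} [NormedAddCommGroup E] [NormedSpace ℝ E]
    [NormedAddCommGroup F] [NormedSpace ℝ F] (f : E → F) (hf : ContDiff ℝ ∞ f)
    (hc : HasCompactSupport f) : (mkTest f hf hc : E → F) = f := rfl

/-! ### Charges, locality and the Markoff property. -/

section Charge

variable {g : Metric n} {m : ℝ}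

namespace FieldSpace

lemma inner_def (f h : FieldSpace g m) : inner ℂ f h =
    ⟨inner ℝ (rePotential f) (rePotential h) + inner ℝ (imPotential f) (imPotential h),
      inner ℝ (rePotential f) (imPotential h) - inner ℝ (imPotential f) (rePotential h)⟩ := rfl

/-- The distribution `(Δ + m²) φ`. -/
def charge (g : Metric n) (m : ℝ) (φ : Test n) : FieldSpace g m := ofPotentials (toEnergy g m φ) 0

/-- The potential of `charge g m φ` is `φ` itself, and pairing `φ` with the potential of `f` is
evaluating `f` at `φ`. This turns support conditions into orthogonality relations. -/
lemma inner_charge (φ : Test n) (f : FieldSpace g m) :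
    inner ℂ (charge g m φ) f = toDistr g m f φ := by
  rw [inner_def, charge, rePotential_ofPotentials, imPotential_ofPotentials]
  apply Complex.ext
  · simp [real_inner_comm, ← inner_rePotential]
  · simp [real_inner_comm, ← inner_imPotential]

/-- The closed span of the distributions `(Δ + m²) φ` with `φ` supported in `O`. -/
def charges (g : Metric n) (m : ℝ) (O : Set (Spacetime n)) : Submodule ℂ (FieldSpace g m) :=
  (Submodule.span ℂ {f | ∃ φ : Test n, tsupport φ ⊆ O ∧ f = charge g m φ}).topologicalClosure

instance (O : Set (Spacetime n)) : CompleteSpace (charges g m O) :=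
  (Submodule.isClosed_topologicalClosure _).isComplete.completeSpace_coe

lemma charge_mem_charges {O : Set (Spacetime n)} {φ : Test n} (h : tsupport φ ⊆ O) :
    charge g m φ ∈ charges g m O :=
  Submodule.le_topologicalClosure _ (Submodule.subset_span ⟨φ, h, rfl⟩)

/-- Orthogonality to `h` is a closed linear condition, so it is enough to test it on the generators,
where `inner_charge` applies. -/
lemma inner_eq_zero_of_mem_charges {O : Set (Spacetime n)} {f h : FieldSpace g m}
    (hf : f ∈ charges g m O) (hh : ∀ φ : Test n, tsupport φ ⊆ O → toDistr g m h φ = 0) :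
    inner ℂ f h = 0 := by
  have hle : charges g m O ≤ (ℂ ∙ h)ᗮ := by
    refine Submodule.topologicalClosure_minimal _ (Submodule.span_le.2 ?_)
      (Submodule.isClosed_orthogonal _)
    rintro _ ⟨φ, hφ, rfl⟩
    rw [SetLike.mem_coe, Submodule.mem_orthogonal_singleton_iff_inner_left, inner_charge, hh φ hφ]
  exact Submodule.mem_orthogonal_singleton_iff_inner_left.1 (hle hf)

end FieldSpace

open FieldSpace

lemma mem_supportedIn {Λ : Set (Spacetime n)} {f : FieldSpace g m} :
    f ∈ supportedIn g m Λ ↔ ∀ φ : Test n, tsupport φ ⊆ Λᶜ → toDistr g m f φ = 0 := Iff.rfl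

lemma e_eq_zero_of_mem_charges {Λ O : Set (Spacetime n)} (h : O ⊆ Λᶜ) {f : FieldSpace g m}
    (hf : f ∈ charges g m O) : e g m Λ f = 0 := by
  refine (Submodule.starProjection_apply_eq_zero_iff _).2 ?_
  rw [Submodule.mem_orthogonal']
  exact fun k hk => inner_eq_zero_of_mem_charges hf fun φ hφ =>
    mem_supportedIn.1 hk φ (hφ.trans h)

lemma partials_eq_zero_of_notMem_tsupport {f : Spacetime n → ℝ} {p : Spacetime n}
    (hp : p ∉ tsupport f) : Metric.partials f p = 0 := by
  ext i
  have : fderiv ℝ f p = 0 :=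
    image_eq_zero_of_notMem_tsupport fun h => hp (tsupport_fderiv_subset ℝ h)
  simp [Metric.partials, this]

/-- Locality: the form involves only the values and first derivatives of both functions at the same
point. -/
lemma energy_eq_zero_of_disjoint (g : Metric n) (m : ℝ) {φ χ : Spacetime n → ℝ}
    (h : Disjoint (tsupport φ) (tsupport χ)) : g.energy m φ χ = 0 := by
  refine integral_eq_zero_of_ae (.of_forall fun p => ?_)
  by_cases hp : p ∈ tsupport φ
  · have hq : p ∉ tsupport χ := Set.disjoint_left.1 h hp
    simp [Metric.gradInner, partials_eq_zero_of_notMem_tsupport hq,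
      image_eq_zero_of_notMem_tsupport hq]
  · simp [Metric.gradInner, partials_eq_zero_of_notMem_tsupport hp,
      image_eq_zero_of_notMem_tsupport hp]

/-- A test function supported in the union of two disjoint open sets is the sum of its parts. -/
lemma exists_split {V W : Set (Spacetime n)} (hV : IsOpen V) (hW : IsOpen W) (hVW : Disjoint V W)
    {φ : Test n} (hφ : tsupport φ ⊆ V ∪ W) :
    ∃ φ₁ φ₂ : Test n, tsupport φ₁ ⊆ V ∧ tsupport φ₂ ⊆ W ∧ φ = φ₁ + φ₂ := by
  have key : ∀ {V W : Set (Spacetime n)}, IsOpen V → IsOpen W → Disjoint V W →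
      tsupport φ ⊆ V ∪ W → ∃ φ₁ : Test n, tsupport φ₁ ⊆ V ∧ ∀ p, φ₁ p = V.indicator φ p := by
    intro V W hV hW hVW hφ
    -- The set `tsupport φ ∩ Wᶜ` is closed, contains the support of the part in `V`, and lies in
    -- `V`. Hence cutting `φ` off at the boundary of `V` creates no discontinuity.
    have hsub : tsupport (V.indicator φ) ⊆ V := by
      have hcl : IsClosed (tsupport φ ∩ Wᶜ) := (isClosed_tsupport _).inter hW.isClosed_compl
      refine (closure_minimal ?_ hcl).trans fun p hp => (hφ hp.1).resolve_right hp.2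
      intro p hp
      have hpV : p ∈ V := Set.mem_of_indicator_ne_zero hp
      refine ⟨subset_tsupport _ ?_, Set.disjoint_left.1 hVW hpV⟩
      rwa [Function.mem_support, ← Set.indicator_of_mem hpV φ]
    refine ⟨mkTest (V.indicator φ) ?_ ?_, hsub, fun p => rfl⟩
    · refine contDiff_iff_contDiffAt.2 fun p => ?_
      by_cases hp : p ∈ V
      · refine φ.contDiff.contDiffAt.congr_of_eventuallyEq ?_
        filter_upwards [hV.mem_nhds hp] with q hq using Set.indicator_of_mem hq _
      · have : p ∉ tsupport (V.indicator φ) := fun h => hp (hsub h)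
        exact (contDiffAt_const (c := (0 : ℝ))).congr_of_eventuallyEq
          (notMem_tsupport_iff_eventuallyEq.1 this)
    · exact φ.hasCompactSupport.mono fun p hp => by
        have hpV : p ∈ V := Set.mem_of_indicator_ne_zero hp
        rwa [Function.mem_support, ← Set.indicator_of_mem hpV φ]
  obtain ⟨φ₁, h₁, h₁'⟩ := key hV hW hVW hφ
  obtain ⟨φ₂, h₂, h₂'⟩ := key hW hV hVW.symm (by rwa [Set.union_comm])
  refine ⟨φ₁, φ₂, h₁, h₂, TestFunction.ext fun p => ?_⟩
  change φ p = φ₁ p + φ₂ p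
  rw [h₁', h₂']
  by_cases hp : p ∈ V
  · rw [Set.indicator_of_mem hp, Set.indicator_of_notMem (Set.disjoint_left.1 hVW hp), add_zero]
  · rw [Set.indicator_of_notMem hp, zero_add]
    by_cases hq : p ∈ W
    · rw [Set.indicator_of_mem hq]
    · rw [Set.indicator_of_notMem hq]
      exact image_eq_zero_of_notMem_tsupport fun h => (hφ h).elim hp hq

/-- The Markoff property. -/
theorem markoff {A B C : Set (Spacetime n)} (h : Separates C A B) :
    e g m A ∘L e g m C ∘L e g m B = e g m A ∘L e g m B := by
  obtain ⟨V, W, hV, hW, hVW, hU, hA, hB⟩ := h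
  have hWA : W ⊆ Aᶜ := fun p hp hpA =>
    Set.disjoint_left.1 hVW (hA ⟨hpA, hU.subset (.inr hp)⟩) hp
  have hVB : V ⊆ Bᶜ := fun p hp hpB =>
    Set.disjoint_left.1 hVW hp (hB ⟨hpB, hU.subset (.inl hp)⟩)
  ext1 f
  simp only [ContinuousLinearMap.comp_apply]
  set h : FieldSpace g m := e g m B f
  have hh : h ∈ supportedIn g m B := Submodule.starProjection_apply_mem _ _
  -- Subtracting `w` projects `h` onto the distributions which vanish on `W`.
  set w : FieldSpace g m := (charges g m W).starProjection h
  have hw : w ∈ charges g m W := Submodule.starProjection_apply_mem _ _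
  -- By locality, charges of functions supported in `W` vanish as distributions on `V`, and this
  -- survives linear combinations and limits.
  have hwV : ∀ φ : Test n, tsupport φ ⊆ V → toDistr g m w φ = 0 := by
    intro φ hφ
    rw [← inner_charge, ← inner_conj_symm, inner_eq_zero_of_mem_charges hw, map_zero]
    intro χ hχ
    rw [charge, toDistr_ofPotentials, inner_toEnergy,
      energy_eq_zero_of_disjoint g m (hVW.mono hφ hχ)]
    simp
  have hC : e g m C h = h - w := by
    refine Submodule.eq_starProjection_of_mem_of_inner_eq_zero (K := supportedIn g m C)
      ?_ fun k hk => ?_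
    · refine mem_supportedIn.2 fun φ hφ => ?_
      obtain ⟨φ₁, φ₂, h₁, h₂, rfl⟩ := exists_split hV hW hVW (hφ.trans hU.superset)
      rw [map_add]
      -- On `V` both terms vanish: `h` because `V` misses `B`, and `w` by locality.
      have e₁ : toDistr g m (h - w) φ₁ = 0 := by
        rw [map_sub]
        change toDistr g m h φ₁ - toDistr g m w φ₁ = 0
        rw [mem_supportedIn.1 hh φ₁ (h₁.trans hVB), hwV φ₁ h₁, sub_zero]
      have e₂ : toDistr g m (h - w) φ₂ = 0 := by
        rw [← inner_charge, ← inner_conj_symm,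
          Submodule.starProjection_inner_eq_zero h _ (charge_mem_charges h₂), map_zero]
      rw [e₁, e₂, add_zero]
    · rw [sub_sub_cancel]
      exact inner_eq_zero_of_mem_charges hw fun φ hφ =>
        mem_supportedIn.1 hk φ (hφ.trans (Set.subset_union_right.trans hU.subset))
  rw [hC, map_sub, e_eq_zero_of_mem_charges hWA hw, sub_zero]

end Charge

/-! ### Elementary consequences of the isometry property of `j_σ`. -/

section Propagator

variable {g : Metric n} {m : ℝ}

lemma adjoint_j_comp_j (σ : ℝ) : ContinuousLinearMap.adjoint (j g m σ) ∘L j g m σ =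
    ContinuousLinearMap.id ℂ (SliceSpace g m σ) := by
  ext1 ψ
  refine ext_inner_left ℂ fun χ => ?_
  rw [ContinuousLinearMap.comp_apply, ContinuousLinearMap.adjoint_inner_right]
  rfl

lemma norm_j_le (σ : ℝ) : ‖j g m σ‖ ≤ 1 := (SliceSpace.deltaIsometry g m σ).norm_toContinuousLinearMap_le

lemma norm_U_le (σ σ' : ℝ) : ‖U g m σ σ'‖ ≤ 1 := by
  refine (ContinuousLinearMap.opNorm_comp_le _ _).trans ?_
  rw [LinearIsometryEquiv.norm_map]
  exact mul_le_one₀ (norm_j_le σ) (norm_nonneg _) (norm_j_le σ')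

lemma j_mem_supportedIn (σ : ℝ) (ψ : SliceSpace g m σ) :
    j g m σ ψ ∈ supportedIn g m {p | p.1 = σ} := by
  refine mem_supportedIn.2 fun φ hφ => ?_
  have h0 : restrictCLM σ φ = 0 := by
    ext x
    exact image_eq_zero_of_notMem_tsupport (x := ((σ, x) : Spacetime n)) fun h => hφ h rfl
  change tensorDelta σ (SliceSpace.toDistr g m σ ψ) φ = 0
  rw [tensorDelta_apply, h0, map_zero]

end Propagator

/-! ### The volume, the Laplace-Beltrami operator and the energy form. -/

instance : (volume : Measure (Spacetime n)).IsAddHaarMeasure :=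
  inferInstanceAs ((volume : Measure ℝ).prod (volume : Measure (Slice n))).IsAddHaarMeasure

namespace Metric

lemma density_pos (g : Metric n) (p : Spacetime n) : 0 < g.density p :=
  Real.sqrt_pos.2 (g.posDef p).det_pos

lemma contDiff_det (g : Metric n) : ContDiff ℝ ∞ fun p => (g.coeff p).det := by
  simp only [Matrix.det_apply']
  exact ContDiff.sum fun σ _ => contDiff_const.mul (contDiff_prod fun i _ => g.smooth _ _)

lemma contDiff_density (g : Metric n) : ContDiff ℝ ∞ g.density :=
  g.contDiff_det.sqrt fun p => (g.posDef p).det_pos.ne'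

lemma contDiff_inv (g : Metric n) (i j : Fin (n + 1)) :
    ContDiff ℝ ∞ fun p => (g.coeff p)⁻¹ i j := by
  simp only [Matrix.inv_def, Ring.inverse_eq_inv', Matrix.smul_apply, smul_eq_mul]
  refine (g.contDiff_det.inv fun p => (g.posDef p).det_pos.ne').mul ?_
  simp only [Matrix.adjugate_apply, Matrix.det_apply']
  refine ContDiff.sum fun σ _ => contDiff_const.mul (contDiff_prod fun k _ => ?_)
  by_cases h : σ k = j
  · simp only [Matrix.updateRow_apply, h, if_true]
    exact contDiff_const
  · simp only [Matrix.updateRow_apply, h, if_false]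
    exact g.smooth _ _

lemma integral_vol (g : Metric n) {E : Type*} [NormedAddCommGroup E] [NormedSpace ℝ E]
    (h : Spacetime n → E) : ∫ p, h p ∂g.vol = ∫ p, g.density p • h p := by
  rw [vol, integral_withDensity_eq_integral_toReal_smul
    g.continuous_density.measurable.ennreal_ofReal (.of_forall fun _ => ENNReal.ofReal_lt_top)]
  exact integral_congr_ae (.of_forall fun p => by
    simp only [ENNReal.toReal_ofReal (g.density_pos p).le])

instance (g : Metric n) : g.vol.IsOpenPosMeasure := by
  have h : (volume : Measure (Spacetime n)) ≪ g.vol :=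
    withDensity_absolutelyContinuous' g.continuous_density.measurable.ennreal_ofReal.aemeasurable
      (.of_forall fun p => by simpa using g.density_pos p)
  exact h.isOpenPosMeasure

lemma integrable_mul (g : Metric n) {f : Spacetime n → ℝ} (hf : Continuous f) (φ : Test n) :
    Integrable (fun p => f p * φ p) g.vol :=
  (hf.mul φ.continuous).integrable_of_hasCompactSupport φ.hasCompactSupport.mul_left

lemma contDiff_partials {f : Spacetime n → ℝ} (hf : ContDiff ℝ ∞ f) (i : Fin (n + 1)) :
    ContDiff ℝ ∞ fun p => partials f p i :=
  (hf.fderiv_right (m := ∞) (by norm_cast)).clm_apply contDiff_const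

/-- The components of `√g ∇χ`. -/
lemma contDiff_flux (g : Metric n) (χ : Test n) (i : Fin (n + 1)) :
    ContDiff ℝ ∞ fun p => g.density p * (g.coeff p)⁻¹.mulVec (partials χ p) i := by
  refine g.contDiff_density.mul ?_
  simp only [Matrix.mulVec, dotProduct]
  exact ContDiff.sum fun j _ => (g.contDiff_inv i j).mul (contDiff_partials χ.contDiff j)

lemma hasCompactSupport_flux (g : Metric n) (χ : Test n) (i : Fin (n + 1)) :
    HasCompactSupport fun p => g.density p * (g.coeff p)⁻¹.mulVec (partials χ p) i :=
  HasCompactSupport.intro χ.hasCompactSupport fun p hp => by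
    simp [partials_eq_zero_of_notMem_tsupport hp]

lemma continuous_laplaceBeltrami (g : Metric n) (χ : Test n) :
    Continuous (g.laplaceBeltrami χ) := by
  refine (g.continuous_density.inv₀ fun p => (g.density_pos p).ne').neg.mul ?_
  exact continuous_finsetSum _ fun i _ => (contDiff_partials (g.contDiff_flux χ i) i).continuous

/-- Integration by parts: `⟨φ, (Δ + m²) χ⟩` is the energy form. -/
lemma energy_eq_integral (g : Metric n) (m : ℝ) (φ χ : Test n) :
    g.energy m φ χ = ∫ p, φ p * (g.laplaceBeltrami χ p + m ^ 2 * χ p) ∂g.vol := by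
  -- With the factor `√g` absorbed into the flux, integration by parts takes place with respect to
  -- Lebesgue measure.
  set X : Fin (n + 1) → Spacetime n → ℝ :=
    fun i p => g.density p * (g.coeff p)⁻¹.mulVec (partials χ p) i with hX
  have hXs : ∀ i, ContDiff ℝ ∞ (X i) := fun i => g.contDiff_flux χ i
  have hXc : ∀ i, HasCompactSupport (X i) := fun i => g.hasCompactSupport_flux χ i
  have hφd : ∀ i, Continuous fun p => fderiv ℝ φ p (coordVec i) := fun i =>
    (contDiff_partials φ.contDiff i).continuous
  have hXd : ∀ i, Continuous fun p => fderiv ℝ (X i) p (coordVec i) := fun i =>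
    (contDiff_partials (hXs i) i).continuous
  have i1 : ∀ i, Integrable fun p => fderiv ℝ φ p (coordVec i) * X i p := fun i =>
    ((hφd i).mul (hXs i).continuous).integrable_of_hasCompactSupport (hXc i).mul_left
  have i2 : ∀ i, Integrable fun p => φ p * fderiv ℝ (X i) p (coordVec i) := fun i =>
    (φ.continuous.mul (hXd i)).integrable_of_hasCompactSupport φ.hasCompactSupport.mul_right
  have i3 : ∀ i, Integrable fun p => φ p * X i p := fun i =>
    (φ.continuous.mul (hXs i).continuous).integrable_of_hasCompactSupport
      φ.hasCompactSupport.mul_right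
  have i4 : Integrable fun p => g.density p * (m ^ 2 * (φ p * χ p)) :=
    (g.continuous_density.mul (continuous_const.mul
      (φ.continuous.mul χ.continuous))).integrable_of_hasCompactSupport
      ((φ.hasCompactSupport.mul_right).mul_left.mul_left)
  have parts : ∀ i, ∫ p, fderiv ℝ φ p (coordVec i) * X i p =
      -∫ p, φ p * fderiv ℝ (X i) p (coordVec i) := fun i => by
    rw [integral_mul_fderiv_eq_neg_fderiv_mul_of_integrable (i1 i) (i2 i) (i3 i)
      (fun p _ => (φ.contDiff.differentiable (by simp)) p)
      (fun p _ => ((hXs i).differentiable (by simp)) p), neg_neg]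
  rw [energy, integral_vol, integral_vol]
  calc ∫ p, g.density p • (g.gradInner φ χ p + m ^ 2 * (φ p * χ p))
      = ∫ p, ((∑ i, fderiv ℝ φ p (coordVec i) * X i p) +
          g.density p * (m ^ 2 * (φ p * χ p))) := by
        refine integral_congr_ae (.of_forall fun p => ?_)
        simp only [smul_eq_mul, mul_add, gradInner, dotProduct, Finset.mul_sum, hX]
        congr 1
        exact Finset.sum_congr rfl fun i _ => by simp only [partials]; ring
    _ = (∑ i, -∫ p, φ p * fderiv ℝ (X i) p (coordVec i)) +
          ∫ p, g.density p * (m ^ 2 * (φ p * χ p)) := by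
        rw [integral_add (integrable_finsetSum _ fun i _ => i1 i) i4,
          integral_finsetSum _ fun i _ => i1 i]
        simp only [parts]
    _ = ∫ p, ((∑ i, -(φ p * fderiv ℝ (X i) p (coordVec i))) +
          g.density p * (m ^ 2 * (φ p * χ p))) := by
        have i2' : ∀ i, Integrable fun p => -(φ p * fderiv ℝ (X i) p (coordVec i)) :=
          fun i => (i2 i).neg
        rw [integral_add (integrable_finsetSum _ fun i _ => i2' i) i4,
          integral_finsetSum _ fun i _ => i2' i]
        simp only [integral_neg]
    _ = _ := by
        refine integral_congr_ae (.of_forall fun p => ?_)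
        have hd := (g.density_pos p).ne'
        simp only [smul_eq_mul, laplaceBeltrami, Finset.sum_neg_distrib, ← Finset.mul_sum]
        change -(φ p * ∑ i, partials (X i) p i) + _ =
          g.density p * (φ p * (-(g.density p)⁻¹ * (∑ i, partials (X i) p i) + _))
        field_simp

lemma energy_self_nonneg (g : Metric n) (m : ℝ) (φ : Test n) : 0 ≤ g.energy m φ φ :=
  integral_nonneg fun _ => add_nonneg (g.gradInner_self_nonneg _ _)
    (mul_nonneg (sq_nonneg m) (mul_self_nonneg _))

lemma integral_sq_le_energy (g : Metric n) (m : ℝ) (φ : Test n) :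
    m ^ 2 * ∫ p, φ p ^ 2 ∂g.vol ≤ g.energy m φ φ := by
  rw [← integral_const_mul]
  refine integral_mono_of_nonneg (.of_forall fun _ => by positivity) (g.integrable_energy m φ φ)
    (.of_forall fun p => ?_)
  have := g.gradInner_self_nonneg φ p
  simp only [sq (φ p)]
  linarith

/-- Contractions operate on the energy form. -/
lemma energy_comp_le (g : Metric n) (m : ℝ) {L : ℝ} {h : ℝ → ℝ} (hs : ContDiff ℝ ∞ h)
    (h0 : h 0 = 0) (hL : ∀ x, |deriv h x| ≤ L) (φ χ : Test n) (hχ : ∀ p, χ p = h (φ p)) :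
    g.energy m χ χ ≤ L ^ 2 * g.energy m φ φ := by
  have hL0 : 0 ≤ L := (abs_nonneg _).trans (hL 0)
  -- The derivative bound controls the gradient term; together with `h 0 = 0` it also controls the
  -- mass term.
  have hlip : ∀ x, |h x| ≤ L * |x| := fun x => by
    have := Convex.norm_image_sub_le_of_norm_deriv_le (f := h) (s := Set.univ) (x := 0) (y := x)
      (fun y _ => (hs.differentiable (by simp)) y) (fun y _ => hL y) convex_univ trivial trivial
    simpa [h0] using this
  rw [energy, energy, ← integral_const_mul]
  refine integral_mono (g.integrable_energy m χ χ) ((g.integrable_energy m φ φ).const_mul _)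
    fun p => ?_
  have hp : partials χ p = deriv h (φ p) • partials φ p := by
    have e : (χ : Spacetime n → ℝ) = h ∘ φ := funext hχ
    ext i
    simp only [partials, e, Pi.smul_apply, smul_eq_mul]
    rw [fderiv_comp p ((hs.differentiable (by simp)) _) ((φ.contDiff.differentiable (by simp)) _)]
    simp [mul_comm]
  have e1 : g.gradInner χ χ p = deriv h (φ p) ^ 2 * g.gradInner φ φ p := by
    simp only [gradInner, hp, Matrix.mulVec_smul, smul_dotProduct, dotProduct_smul, smul_eq_mul]
    ring
  have e2 : deriv h (φ p) ^ 2 ≤ L ^ 2 := by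
    rw [← sq_abs]
    gcongr
    exact hL _
  have e3 : χ p * χ p ≤ L ^ 2 * (φ p * φ p) := by
    have h1 := hlip (φ p)
    rw [hχ p, ← sq, ← sq, ← mul_pow, sq_le_sq, abs_mul, abs_of_nonneg hL0]
    exact h1
  simp only [e1, mul_add]
  have := g.gradInner_self_nonneg φ p
  have h4 := mul_le_mul_of_nonneg_right e2 this
  have h5 := mul_le_mul_of_nonneg_left e3 (sq_nonneg m)
  linarith

end Metric

/-! ### Weak convergence and truncations near zero. -/

/-- The composition of a test function with a smooth function which fixes `0`. -/
def compTest (h : ℝ → ℝ) (hs : ContDiff ℝ ∞ h) (h0 : h 0 = 0) (φ : Test n) : Test n :=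
  mkTest (h ∘ φ) (hs.comp φ.contDiff) (φ.hasCompactSupport.comp_left h0)

/-- A sequence of vectors which is bounded in norm and converges weakly against a dense set
converges weakly. -/
lemma tendsto_inner_of_bounded {H : Type*} [NormedAddCommGroup H] [InnerProductSpace ℝ H]
    {x : ℕ → H} {y : H} {S : Set H} (hS : Dense S) {B : ℝ} (hB : ∀ k, ‖x k‖ ≤ B)
    (h : ∀ s ∈ S, Tendsto (fun k => inner ℝ s (x k)) atTop (𝓝 (inner ℝ s y))) (z : H) :
    Tendsto (fun k => inner ℝ z (x k)) atTop (𝓝 (inner ℝ z y)) := by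
  have hB0 : 0 ≤ B := (norm_nonneg _).trans (hB 0)
  rw [Metric.tendsto_atTop]
  intro ε hε
  -- The radius is chosen so that replacing `z` by `s` costs at most `ε / 2`, as `‖x k - y‖ ≤ B +
  -- ‖y‖ + 1`.
  obtain ⟨s, hs, hsz⟩ := Metric.dense_iff.1 hS z (ε / (2 * (B + ‖y‖ + 1))) (by positivity)
  rw [Metric.mem_ball] at hs
  obtain ⟨K, hK⟩ := Metric.tendsto_atTop.1 (h s hsz) (ε / 2) (by positivity)
  refine ⟨K, fun k hk => ?_⟩
  have h1 := hK k hk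
  rw [Real.dist_eq, ← inner_sub_right] at h1 ⊢
  have h2 : |inner ℝ (z - s) (x k - y)| ≤ ε / 2 := by
    refine (abs_real_inner_le_norm _ _).trans ?_
    have h3 : ‖x k - y‖ ≤ B + ‖y‖ + 1 := (norm_sub_le _ _).trans (by linarith [hB k])
    have h4 : ‖z - s‖ ≤ ε / (2 * (B + ‖y‖ + 1)) := by
      rw [← dist_eq_norm, dist_comm]; exact hs.le
    calc _ ≤ ε / (2 * (B + ‖y‖ + 1)) * (B + ‖y‖ + 1) := by gcongr
      _ = ε / 2 := by field_simp
  have e : inner ℝ z (x k - y) = inner ℝ (z - s) (x k - y) + inner ℝ s (x k - y) := by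
    rw [← inner_add_left, sub_add_cancel]
  rw [e]
  calc _ ≤ _ := abs_add_le _ _
    _ < ε := by linarith

/-- The smooth function `x ↦ x (1 - η(x))` which vanishes near `0`. -/
def truncate (x : ℝ) : ℝ := x * (1 - cutoff 0 x)

lemma contDiff_truncate : ContDiff ℝ ∞ truncate :=
  contDiff_id.mul (contDiff_const.sub (cutoff 0).contDiff)

lemma truncate_eq_zero {x : ℝ} (hx : |x| ≤ 1) : truncate x = 0 := by
  rw [truncate, (cutoff 0).one_of_mem_closedBall (by simpa [cutoff] using hx), sub_self, mul_zero]

lemma abs_truncate_sub_le (x : ℝ) : |truncate x - x| ≤ 2 := by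
  have e : truncate x - x = -(x * cutoff 0 x) := by rw [truncate]; ring
  rw [e, abs_neg, abs_mul, abs_of_nonneg (cutoff 0).nonneg]
  by_cases hx : |x| < 2
  · calc |x| * cutoff 0 x ≤ 2 * 1 := by gcongr; exact (cutoff 0).nonneg; exact (cutoff 0).le_one
      _ = 2 := by norm_num
  · rw [(cutoff 0).zero_of_le_dist (by simpa [cutoff] using hx), mul_zero]
    norm_num

/-- Beyond the outer radius `2` of the cutoff, `truncate` is the identity; so its derivative differs
from `1` by a continuous function with compact support. -/
lemma exists_deriv_truncate_le : ∃ L, ∀ x, |deriv truncate x| ≤ L := by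
  have h : Continuous fun x => deriv truncate x - 1 :=
    (contDiff_truncate.continuous_deriv (by simp)).sub continuous_const
  have hc : HasCompactSupport fun x => deriv truncate x - 1 := by
    refine HasCompactSupport.intro (isCompact_closedBall (0 : ℝ) 2) fun x hx => ?_
    have hx' : 2 < |x| := by simpa using hx
    have : truncate =ᶠ[𝓝 x] id := by
      filter_upwards [continuous_abs.continuousAt.eventually (lt_mem_nhds hx')] with y hy
      rw [truncate, (cutoff 0).zero_of_le_dist (by simpa [cutoff] using hy.le)]
      simp
    rw [this.deriv_eq, deriv_id, sub_self]
  obtain ⟨C, hC⟩ := hc.exists_bound_of_continuous h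
  refine ⟨C + 1, fun x => ?_⟩
  have := hC x
  rw [Real.norm_eq_abs] at this
  calc |deriv truncate x| = |(deriv truncate x - 1) + 1| := by rw [sub_add_cancel]
    _ ≤ |deriv truncate x - 1| + |1| := abs_add_le _ _
    _ ≤ C + 1 := by rw [abs_one]; linarith

/-! ### Elements of `N` carried by a slice, and the composition law. -/

section SliceRange

variable {g : Metric n} {m : ℝ}

lemma hasCompactSupport_mul_laplace (g : Metric n) (m : ℝ) (χ : Test n) :
    HasCompactSupport (fun p => g.laplaceBeltrami χ p + m ^ 2 * χ p) := by
  refine HasCompactSupport.intro χ.hasCompactSupport fun p hp => ?_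
  have h1 : ∀ i, Metric.partials (fun q => g.density q *
      (g.coeff q)⁻¹.mulVec (Metric.partials χ q) i) p = 0 := fun i => by
    refine partials_eq_zero_of_notMem_tsupport fun h => hp ?_
    refine closure_minimal (fun q hq => ?_) (isClosed_tsupport _) h
    by_contra hq'
    exact hq (by simp [partials_eq_zero_of_notMem_tsupport hq'])
  simp [Metric.laplaceBeltrami, h1, image_eq_zero_of_notMem_tsupport hp]

lemma integrable_mul_laplace (g : Metric n) (m : ℝ) (χ : Test n) :
    Integrable (fun p => g.laplaceBeltrami χ p + m ^ 2 * χ p) g.vol :=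
  Continuous.integrable_of_hasCompactSupport
    ((g.continuous_laplaceBeltrami χ).add (continuous_const.mul χ.continuous))
    (hasCompactSupport_mul_laplace g m χ)

/-- Uniformly convergent sequences of test functions with bounded energy converge weakly in the energy
space. -/
lemma tendsto_inner_toEnergy {φ : ℕ → Test n} {χ : Test n} {B : ℝ}
    (hB : ∀ k, g.energy m (φ k) (φ k) ≤ B) {ε : ℕ → ℝ} (hε : Tendsto ε atTop (𝓝 0))
    (h : ∀ k p, |φ k p - χ p| ≤ ε k) (u : EnergySpace g m) :
    Tendsto (fun k => inner ℝ u (toEnergy g m (φ k))) atTop (𝓝 (inner ℝ u (toEnergy g m χ))) := by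
  refine tendsto_inner_of_bounded (S := Set.range (toEnergy g m)) (denseRange_toEnergy g m)
    (B := √B) (fun k => ?_) ?_ u
  · rw [norm_toEnergy]
    exact Real.sqrt_le_sqrt (hB k)
  rintro _ ⟨ξ, rfl⟩
  -- Integration by parts moves both derivatives to the fixed test function `ξ`, so uniform
  -- convergence suffices against this dense set of vectors.
  simp only [real_inner_comm _ (toEnergy g m ξ), inner_toEnergy, Metric.energy_eq_integral]
  have hi := integrable_mul_laplace g m ξ
  set w := fun p => g.laplaceBeltrami ξ p + m ^ 2 * ξ p with hw
  have hwc : Continuous w :=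
    (g.continuous_laplaceBeltrami ξ).add (continuous_const.mul ξ.continuous)
  have hint : ∀ φ : Test n, Integrable (fun p => φ p * w p) g.vol := fun φ => by
    simpa only [mul_comm] using g.integrable_mul hwc φ
  rw [tendsto_iff_norm_sub_tendsto_zero]
  refine squeeze_zero (g := fun k => ε k * ∫ p, |w p| ∂g.vol) (fun _ => norm_nonneg _)
    (fun k => ?_) (by simpa using hε.mul_const (∫ p, |w p| ∂g.vol))
  rw [← integral_sub (hint _) (hint _), ← integral_const_mul]
  refine norm_integral_le_of_norm_le (hi.norm.const_mul _) (.of_forall fun p => ?_)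
  rw [← sub_mul, norm_mul]
  exact mul_le_mul_of_nonneg_right (h k p) (norm_nonneg _)

/-- The distributions in `N` only depend on the values on the slice `t = σ` if they are supported
there. -/
lemma toDistr_eq_zero_of_vanishing {σ : ℝ} {f : FieldSpace g m}
    (hf : f ∈ supportedIn g m {p | p.1 = σ}) {χ : Test n} (hχ : ∀ x, χ (σ, x) = 0) :
    FieldSpace.toDistr g m f χ = 0 := by
  obtain ⟨L, hL⟩ := exists_deriv_truncate_le
  -- Rescaling leaves the Lipschitz constant `L` unchanged, while the zone of vanishing `|x| ≤ 1 /
  -- (k + 1)` and the distance to the identity, at most `2 / (k + 1)`, shrink.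
  let h : ℕ → ℝ → ℝ := fun k x => (k + 1 : ℝ)⁻¹ * truncate ((k + 1) * x)
  have hs : ∀ k, ContDiff ℝ ∞ (h k) := fun k =>
    contDiff_const.mul (contDiff_truncate.comp (contDiff_const.mul contDiff_id))
  have h0 : ∀ k, h k 0 = 0 := fun k => by simp [h, truncate]
  have hd : ∀ k x, |deriv (h k) x| ≤ L := fun k x => by
    have : deriv (h k) x = deriv truncate ((k + 1) * x) := by
      have hk : (k + 1 : ℝ) ≠ 0 := by positivity
      have h1 : HasDerivAt (fun x : ℝ => (k + 1 : ℝ) * x) (k + 1) x := by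
        simpa using (hasDerivAt_id x).const_mul (k + 1 : ℝ)
      have h2 := (((contDiff_truncate.differentiable (by simp)) ((k + 1) * x)).hasDerivAt.comp x
        h1).const_mul (k + 1 : ℝ)⁻¹
      refine h2.deriv.trans ?_
      field_simp
    rw [this]
    exact hL _
  let φ : ℕ → Test n := fun k => compTest (h k) (hs k) (h0 k) χ
  have hφ0 : ∀ k, FieldSpace.toDistr g m f (φ k) = 0 := fun k => by
    refine mem_supportedIn.1 hf _ fun p hp hpσ => ?_
    -- The topological support of `φ k` lies in this closed set, which misses the slice because `χ`
    -- is zero there.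
    have hcl : IsClosed {p | 1 ≤ |(k + 1) * χ p|} :=
      isClosed_le continuous_const (continuous_const.mul χ.continuous).abs
    have hmem : 1 ≤ |(k + 1) * χ p| := by
      refine closure_minimal (fun q hq => ?_) hcl hp
      by_contra hlt
      replace hlt : |(k + 1) * χ q| < 1 := not_le.1 fun h => hlt h
      exact hq (by change h k (χ q) = 0; simp only [h, truncate_eq_zero hlt.le, mul_zero])
    have : χ p = 0 := by
      have := hχ p.2
      rwa [← (show p.1 = σ from hpσ)] at this
    rw [this] at hmem
    norm_num at hmem
  -- Bounded energy and uniform convergence give weak convergence of `φ k` to `χ`, so `f(χ)` is the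
  -- limit of the zeros `f(φ k)`.
  have hw := fun u : EnergySpace g m => tendsto_inner_toEnergy (φ := φ) (χ := χ)
    (fun k => g.energy_comp_le m (hs k) (h0 k) (hd k) χ (φ k) fun _ => rfl)
    (ε := fun k : ℕ => 2 * (1 / ((k : ℝ) + 1)))
    (by simpa using tendsto_one_div_add_atTop_nhds_zero_nat.const_mul (2 : ℝ))
    (fun k p => by
      have hk : (0 : ℝ) < k + 1 := by positivity
      have := abs_truncate_sub_le ((k + 1) * χ p)
      change |(k + 1 : ℝ)⁻¹ * truncate ((k + 1) * χ p) - χ p| ≤ _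
      have e : (k + 1 : ℝ)⁻¹ * truncate ((k + 1) * χ p) - χ p =
          (k + 1 : ℝ)⁻¹ * (truncate ((k + 1) * χ p) - (k + 1) * χ p) := by field_simp
      rw [e, abs_mul, abs_of_pos (inv_pos.2 hk), one_div, mul_comm]
      gcongr) u
  apply Complex.ext
  · rw [← FieldSpace.inner_rePotential]
    refine tendsto_nhds_unique (hw _) ?_
    simp [FieldSpace.inner_rePotential, hφ0]
  · rw [← FieldSpace.inner_imPotential]
    refine tendsto_nhds_unique (hw _) ?_
    simp [FieldSpace.inner_imPotential, hφ0]

/-- A distribution in `N` with support in a slice is of the form `ψ δ(t - σ)`. -/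
lemma mem_range_j {σ : ℝ} {f : FieldSpace g m} (hf : f ∈ supportedIn g m {p | p.1 = σ}) :
    ∃ ψ, j g m σ ψ = f := by
  refine (SliceSpace.mem_range_delta f).2 fun φ => ?_
  rw [← sub_eq_zero, ← map_sub]
  -- A test function and the lift of its restriction agree on the slice; the lemma is applied to
  -- their difference.
  refine toDistr_eq_zero_of_vanishing hf fun x => ?_
  have := congrArg (fun χ : SliceTest n => χ x) (restrictCLM_liftCLM σ (restrictCLM σ φ))
  simp only [restrictCLM_apply] at this
  change φ (σ, x) - liftCLM σ (restrictCLM σ φ) (σ, x) = 0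
  rw [this, sub_self]

/-- `j_σ j_σ^*` is the projection to the distributions supported in the slice. -/
lemma j_comp_adjoint_j (σ : ℝ) : j g m σ ∘L ContinuousLinearMap.adjoint (j g m σ) =
    e g m {p | p.1 = σ} := by
  ext1 f
  refine (Submodule.eq_starProjection_of_mem_of_inner_eq_zero
    (K := supportedIn g m {p | p.1 = σ}) (j_mem_supportedIn σ _) fun k hk => ?_).symm
  obtain ⟨ψ, rfl⟩ := mem_range_j hk
  have h := DFunLike.congr_fun (adjoint_j_comp_j (g := g) (m := m) σ)
    (ContinuousLinearMap.adjoint (j g m σ) f)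
  rw [ContinuousLinearMap.comp_apply, ContinuousLinearMap.id_apply] at h
  rw [← ContinuousLinearMap.adjoint_inner_left, map_sub]
  change inner ℂ (_ - ContinuousLinearMap.adjoint (j g m σ)
    (j g m σ (ContinuousLinearMap.adjoint (j g m σ) f))) ψ = 0
  rw [h, sub_self, inner_zero_left]

lemma e_comp_j (σ : ℝ) : e g m {p | p.1 = σ} ∘L j g m σ = j g m σ := by
  rw [← j_comp_adjoint_j, ContinuousLinearMap.comp_assoc, adjoint_j_comp_j,
    ContinuousLinearMap.comp_id]

lemma adjoint_j_comp_e (σ : ℝ) : ContinuousLinearMap.adjoint (j g m σ) ∘L e g m {p | p.1 = σ} =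
    ContinuousLinearMap.adjoint (j g m σ) := by
  rw [← j_comp_adjoint_j, ← ContinuousLinearMap.comp_assoc, adjoint_j_comp_j,
    ContinuousLinearMap.id_comp]

lemma separates_slices {σ σ' σ'' : ℝ} (h : σ' ∈ Set.uIcc σ σ'') :
    Separates (n := n) {p | p.1 = σ'} {p | p.1 = σ} {p | p.1 = σ''} := by
  have o1 : IsOpen {p : Spacetime n | p.1 < σ'} := isOpen_lt continuous_fst continuous_const
  have o2 : IsOpen {p : Spacetime n | σ' < p.1} := isOpen_lt continuous_const continuous_fst
  have d : Disjoint {p : Spacetime n | p.1 < σ'} {p : Spacetime n | σ' < p.1} :=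
    Set.disjoint_left.2 fun p (h1 : p.1 < σ') (h2 : σ' < p.1) => lt_asymm h1 h2
  rcases Set.mem_uIcc.1 h with ⟨h1, h2⟩ | ⟨h1, h2⟩
  · refine ⟨_, _, o1, o2, d, ?_, ?_, ?_⟩
    · ext p; exact (lt_or_lt_iff_ne : p.1 < σ' ∨ σ' < p.1 ↔ p.1 ≠ σ')
    · rintro p ⟨rfl, hp⟩; exact lt_of_le_of_ne h1 hp
    · rintro p ⟨rfl, hp⟩; exact lt_of_le_of_ne h2 (Ne.symm hp)
  · refine ⟨_, _, o2, o1, d.symm, ?_, ?_, ?_⟩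
    · ext p; exact or_comm.trans (lt_or_lt_iff_ne : p.1 < σ' ∨ σ' < p.1 ↔ p.1 ≠ σ')
    · rintro p ⟨rfl, hp⟩; exact lt_of_le_of_ne h2 (Ne.symm hp)
    · rintro p ⟨rfl, hp⟩; exact lt_of_le_of_ne h1 hp

/-- The propagator property. -/
theorem U_comp_U {σ σ' σ'' : ℝ} (h : σ' ∈ Set.uIcc σ σ'') :
    U g m σ σ' ∘L U g m σ' σ'' = U g m σ σ'' := by
  -- The outer projections can be inserted for free. The middle `j_σ' j_σ'^*` is a projection as
  -- well, and the Markoff property removes it.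
  calc U g m σ σ' ∘L U g m σ' σ''
      = (ContinuousLinearMap.adjoint (j g m σ) ∘L e g m {p | p.1 = σ}) ∘L
          (j g m σ' ∘L ContinuousLinearMap.adjoint (j g m σ')) ∘L
          (e g m {p | p.1 = σ''} ∘L j g m σ'') := by
        rw [e_comp_j, adjoint_j_comp_e]; rfl
    _ = ContinuousLinearMap.adjoint (j g m σ) ∘L
          (e g m {p | p.1 = σ} ∘L e g m {p | p.1 = σ'} ∘L e g m {p | p.1 = σ''}) ∘L
          j g m σ'' := by rw [j_comp_adjoint_j]; rfl
    _ = (ContinuousLinearMap.adjoint (j g m σ) ∘L e g m {p | p.1 = σ}) ∘L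
          (e g m {p | p.1 = σ''} ∘L j g m σ'') := by
        rw [markoff (separates_slices h)]; rfl
    _ = _ := by rw [e_comp_j, adjoint_j_comp_e]; rfl

end SliceRange

/-! ### Cauchy-Schwarz, domination, and kernels off the diagonal. -/

/-- The Cauchy-Schwarz inequality for integrals. -/
lemma sq_integral_mul_le {X : Type*} [MeasurableSpace X] {μ : Measure X} {f h : X → ℝ}
    (hf : Integrable (fun x => f x ^ 2) μ) (hh : Integrable (fun x => h x ^ 2) μ)
    (hfh : Integrable (fun x => f x * h x) μ) :
    (∫ x, f x * h x ∂μ) ^ 2 ≤ (∫ x, f x ^ 2 ∂μ) * ∫ x, h x ^ 2 ∂μ := by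
  -- The integral of `(f - t h)²` is a nonnegative quadratic polynomial in `t`, so its discriminant
  -- is at most zero.
  have key : ∀ t : ℝ, 0 ≤ (∫ x, h x ^ 2 ∂μ) * (t * t) + (-2 * ∫ x, f x * h x ∂μ) * t +
      ∫ x, f x ^ 2 ∂μ := fun t => by
    have : ∫ x, (f x - t * h x) ^ 2 ∂μ = (∫ x, h x ^ 2 ∂μ) * (t * t) +
        (-2 * ∫ x, f x * h x ∂μ) * t + ∫ x, f x ^ 2 ∂μ := by
      have e : ∀ x, (f x - t * h x) ^ 2 = ((t * t) * h x ^ 2 + (-2 * t) * (f x * h x)) + f x ^ 2 :=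
        fun x => by ring
      simp only [e]
      have i1 : Integrable (fun x => t * t * h x ^ 2) μ := hh.const_mul _
      have i2 : Integrable (fun x => -2 * t * (f x * h x)) μ := hfh.const_mul _
      have i3 : Integrable (fun x => t * t * h x ^ 2 + -2 * t * (f x * h x)) μ := i1.add i2
      rw [integral_add i3 hf, integral_add i1 i2, integral_const_mul, integral_const_mul]
      ring
    rw [← this]
    exact integral_nonneg fun x => sq_nonneg _
  have := discrim_le_zero key
  rw [discrim] at this
  linarith

/-- Test functions are dominated by nonnegative real-valued test functions. -/
lemma exists_dominating {E F : Type} [NormedAddCommGroup E] [NormedSpace ℝ E]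
    [FiniteDimensional ℝ E] [NormedAddCommGroup F] [NormedSpace ℝ F] (f : 𝓓((⊤ : Opens E), F)) :
    ∃ φ : 𝓓((⊤ : Opens E), ℝ), ∀ p, ‖f p‖ ≤ φ p := by
  obtain ⟨C, hC⟩ := f.hasCompactSupport.exists_bound_of_continuous f.continuous
  obtain ⟨R, hR⟩ := f.hasCompactSupport.isCompact.isBounded.subset_closedBall (0 : E)
  -- Taking `max R 1` keeps the inner radius positive when `R ≤ 0`.
  let b : ContDiffBump (0 : E) := ⟨max R 1, max R 1 + 1, by positivity, by linarith⟩
  have hC0 : 0 ≤ C := (norm_nonneg _).trans (hC 0)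
  refine ⟨mkTest (fun p => C * b p) (contDiff_const.mul b.contDiff) b.hasCompactSupport.mul_left,
    fun p => ?_⟩
  rw [coe_mkTest]
  by_cases hp : p ∈ tsupport f
  · rw [b.one_of_mem_closedBall (Metric.closedBall_subset_closedBall (le_max_left _ _) (hR hp)),
      mul_one]
    exact hC p
  · rw [image_eq_zero_of_notMem_tsupport hp, norm_zero]
    exact mul_nonneg hC0 b.nonneg

/-- A product measure without atoms does not charge the diagonal. -/
lemma ae_prod_ne {X : Type*} [TopologicalSpace X] [T2Space X] [SecondCountableTopology X]
    [MeasurableSpace X] [BorelSpace X] (μ ν : Measure X) [SFinite μ] [SFinite ν] [NullSingletonClass ν] :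
    ∀ᵐ z ∂μ.prod ν, z.1 ≠ z.2 := by
  have hm : MeasurableSet {z : X × X | z.1 ≠ z.2} := isClosed_diagonal.isOpen_compl.measurableSet
  refine (Measure.ae_prod_iff_ae_ae hm).2 (.of_forall fun x => ?_)
  have : ∀ᵐ y ∂ν, y ≠ x := by simp [ae_iff]
  filter_upwards [this] with y hy using hy.symm

/-- The diagonal is a null set, so the values of the kernel there are irrelevant. -/
lemma aestronglyMeasurable_of_continuousOn_offDiag {X : Type*} [TopologicalSpace X] [T2Space X]
    [SecondCountableTopology X] [MeasurableSpace X] [BorelSpace X] (μ ν : Measure X) [SFinite μ]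
    [SFinite ν] [NullSingletonClass ν] {K : X → X → ℝ}
    (hK : ContinuousOn (fun z : X × X => K z.1 z.2) {z | z.1 ≠ z.2}) :
    AEStronglyMeasurable (fun z : X × X => K z.1 z.2) (μ.prod ν) := by
  have hm : MeasurableSet {z : X × X | z.1 ≠ z.2} := isClosed_diagonal.isOpen_compl.measurableSet
  rw [← Measure.restrict_eq_self_of_ae_mem (ae_prod_ne μ ν)]
  exact hK.aestronglyMeasurable hm

/-- The sesquilinear form of a real kernel on complex functions, in terms of its values on real and
imaginary parts. -/
lemma integral_kernel_complex {X : Type*} [MeasurableSpace X] (μ : Measure X) [SFinite μ]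
    (K : X → X → ℝ) (f : X → ℂ) {a b c : ℝ}
    (h11 : Integrable (fun z : X × X => (f z.1).re * K z.1 z.2 * (f z.2).re) (μ.prod μ))
    (h22 : Integrable (fun z : X × X => (f z.1).im * K z.1 z.2 * (f z.2).im) (μ.prod μ))
    (h12 : Integrable (fun z : X × X => (f z.1).re * K z.1 z.2 * (f z.2).im) (μ.prod μ))
    (h21 : Integrable (fun z : X × X => (f z.1).im * K z.1 z.2 * (f z.2).re) (μ.prod μ))
    (e11 : ∫ z, (f z.1).re * K z.1 z.2 * (f z.2).re ∂μ.prod μ = a)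
    (e22 : ∫ z, (f z.1).im * K z.1 z.2 * (f z.2).im ∂μ.prod μ = b)
    (e12 : ∫ z, (f z.1).re * K z.1 z.2 * (f z.2).im ∂μ.prod μ = c)
    (e21 : ∫ z, (f z.1).im * K z.1 z.2 * (f z.2).re ∂μ.prod μ = c) :
    Integrable (fun z : X × X => conj (f z.1) * (K z.1 z.2 : ℂ) * f z.2) (μ.prod μ) ∧
      ((a + b : ℝ) : ℂ) = ∫ x, ∫ y, conj (f x) * (K x y : ℂ) * f y ∂μ ∂μ := by
  -- The imaginary part is the difference of the two mixed terms, whose integrals have the common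
  -- value `c`.
  have e : (fun z : X × X => conj (f z.1) * (K z.1 z.2 : ℂ) * f z.2) = fun z =>
      (((f z.1).re * K z.1 z.2 * (f z.2).re + (f z.1).im * K z.1 z.2 * (f z.2).im : ℝ) : ℂ) +
        Complex.I * (((f z.1).re * K z.1 z.2 * (f z.2).im -
          (f z.1).im * K z.1 z.2 * (f z.2).re : ℝ) : ℂ) := by
    ext z
    apply Complex.ext
    · simp
    · simp; ring
  have hint : Integrable (fun z : X × X => conj (f z.1) * (K z.1 z.2 : ℂ) * f z.2) (μ.prod μ) := by
    rw [e]
    exact (h11.add h22).ofReal.add ((h12.sub h21).ofReal.const_mul _)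
  refine ⟨hint, ?_⟩
  rw [← integral_prod (fun z : X × X => conj (f z.1) * (K z.1 z.2 : ℂ) * f z.2) hint, e,
    integral_add (h11.add h22).ofReal ((h12.sub h21).ofReal.const_mul _), integral_const_mul,
    integral_complex_ofReal, integral_complex_ofReal, integral_add h11 h22, integral_sub h12 h21, e11, e22, e12, e21]
  simp

/-- The real part of a complex test function. -/
def reTest {E : Type} [NormedAddCommGroup E] [NormedSpace ℝ E] (f : 𝓓((⊤ : Opens E), ℂ)) :
    𝓓((⊤ : Opens E), ℝ) :=
  mkTest (fun p => (f p).re) (Complex.reCLM.contDiff.comp f.contDiff)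
    (f.hasCompactSupport.comp_left Complex.zero_re)

/-- The imaginary part of a complex test function. -/
def imTest {E : Type} [NormedAddCommGroup E] [NormedSpace ℝ E] (f : 𝓓((⊤ : Opens E), ℂ)) :
    𝓓((⊤ : Opens E), ℝ) :=
  mkTest (fun p => (f p).im) (Complex.imCLM.contDiff.comp f.contDiff)
    (f.hasCompactSupport.comp_left Complex.zero_im)

@[simp] lemma reTest_apply {E : Type} [NormedAddCommGroup E] [NormedSpace ℝ E]
    (f : 𝓓((⊤ : Opens E), ℂ)) (p : E) : reTest f p = (f p).re := rfl

@[simp] lemma imTest_apply {E : Type} [NormedAddCommGroup E] [NormedSpace ℝ E]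
    (f : 𝓓((⊤ : Opens E), ℂ)) (p : E) : imTest f p = (f p).im := rfl

/-! ### The resolvent on test functions and the Green kernel on spacetime. -/

section Potential

variable {g : Metric n} {m : ℝ}

/-- Since the energy dominates `m²` times the squared `L²` norm, integration against `f` is bounded
in the energy norm with constant `‖f‖₂ / m`, and the Riesz theorem applies. This is where the
positive mass is needed. -/
lemma exists_potential (hm : 0 < m) (f : Test n) : ∃ u : EnergySpace g m,
    ∀ φ, inner ℝ u (toEnergy g m φ) = ∫ p, f p * φ p ∂g.vol := by
  let T : Test n →ₗ[ℝ] ℝ :=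
    { toFun := fun φ => ∫ p, f p * φ p ∂g.vol
      map_add' := fun φ χ => by
        rw [← integral_add (g.integrable_mul f.continuous φ) (g.integrable_mul f.continuous χ)]
        exact integral_congr_ae (.of_forall fun p => mul_add _ _ _)
      map_smul' := fun c φ => by
        rw [RingHom.id_apply, smul_eq_mul, ← integral_const_mul]
        exact integral_congr_ae (.of_forall fun p => mul_left_comm _ _ _) }
  refine FieldSpace.exists_riesz (T := T) ⟨√(∫ p, f p ^ 2 ∂g.vol) / m, fun φ => ?_⟩
  have sq_int : ∀ φ : Test n, Integrable (fun p => φ p ^ 2) g.vol := fun φ => by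
    simpa only [sq] using g.integrable_mul φ.continuous φ
  have h1 := sq_integral_mul_le (sq_int f) (sq_int φ) (g.integrable_mul f.continuous φ)
  have h2 := g.integral_sq_le_energy m φ
  have h3 : 0 ≤ ∫ p, f p ^ 2 ∂g.vol := integral_nonneg fun _ => sq_nonneg _
  refine Real.abs_le_sqrt h1 |>.trans ?_
  rw [Real.sqrt_mul h3, div_mul_eq_mul_div, mul_div_assoc]
  gcongr
  rw [le_div_iff₀ hm, mul_comm]
  refine Real.le_sqrt_of_sq_le ?_
  rw [mul_pow, Real.sq_sqrt (integral_nonneg fun _ => sq_nonneg _)]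
  exact h2

end Potential

section Green

variable {g : Metric n} {m : ℝ}

/-- The vector `(Δ + m²)⁻¹ f` of the energy space. -/
def potential (g : Metric n) (hm : 0 < m) (f : Test n) : EnergySpace g m :=
  (exists_potential hm f).choose

lemma inner_potential (hm : 0 < m) (f φ : Test n) :
    inner ℝ (potential g hm f) (toEnergy g m φ) = ∫ p, f p * φ p ∂g.vol :=
  (exists_potential hm f).choose_spec φ

/-- A smooth approximation of the absolute value. -/
def smoothAbs (ε x : ℝ) : ℝ := √(x ^ 2 + ε ^ 2) - ε

lemma contDiff_smoothAbs {ε : ℝ} (hε : 0 < ε) : ContDiff ℝ ∞ (smoothAbs ε) :=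
  (((contDiff_id.pow 2).add contDiff_const).sqrt fun x =>
    (add_pos_of_nonneg_of_pos (sq_nonneg x) (pow_pos hε 2)).ne').sub contDiff_const

lemma smoothAbs_zero {ε : ℝ} (hε : 0 < ε) : smoothAbs ε 0 = 0 := by
  simp [smoothAbs, Real.sqrt_sq hε.le]

lemma smoothAbs_nonneg (ε x : ℝ) : 0 ≤ smoothAbs ε x :=
  sub_nonneg.2 (Real.le_sqrt_of_sq_le (by nlinarith [sq_nonneg x]))

lemma sub_le_smoothAbs (ε x : ℝ) : x - ε ≤ smoothAbs ε x :=
  sub_le_sub_right (Real.le_sqrt_of_sq_le (by nlinarith [sq_nonneg ε])) _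

lemma abs_deriv_smoothAbs_le {ε : ℝ} (hε : 0 < ε) (x : ℝ) : |deriv (smoothAbs ε) x| ≤ 1 := by
  have h0 : 0 < x ^ 2 + ε ^ 2 := add_pos_of_nonneg_of_pos (sq_nonneg x) (pow_pos hε 2)
  have h1 : HasDerivAt (fun x : ℝ => x ^ 2 + ε ^ 2) (2 * x) x := by
    simpa using (hasDerivAt_pow 2 x).add_const (ε ^ 2)
  have h2 : HasDerivAt (smoothAbs ε) (2 * x / (2 * √(x ^ 2 + ε ^ 2))) x :=
    (h1.sqrt h0.ne').sub_const ε
  rw [h2.deriv, mul_div_mul_left _ _ two_ne_zero, abs_div, abs_of_nonneg (Real.sqrt_nonneg _)]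
  exact div_le_one_of_le₀ (Real.abs_le_sqrt (by nlinarith [sq_nonneg ε])) (Real.sqrt_nonneg _)

/-- The resolvent is positivity preserving. -/
lemma inner_potential_nonneg (hm : 0 < m) {f ψ : Test n} (hf : ∀ p, 0 ≤ f p)
    (hψ : ∀ p, 0 ≤ ψ p) : 0 ≤ inner ℝ (potential g hm ψ) (potential g hm f) := by
  set w := potential g hm f
  obtain ⟨v, hv, hvw⟩ := mem_closure_iff_seq_limit.1 ((denseRange_toEnergy g m) w)
  choose φ hφ using hv
  obtain rfl : (fun k => toEnergy g m (φ k)) = v := funext hφ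
  let ε : ℕ → ℝ := fun k => 1 / ((k : ℝ) + 1)
  have hε : ∀ k, 0 < ε k := fun k => by positivity
  have hε0 : Tendsto ε atTop (𝓝 0) := tendsto_one_div_add_atTop_nhds_zero_nat
  let h : ℕ → Test n := fun k =>
    compTest (smoothAbs (ε k)) (contDiff_smoothAbs (hε k)) (smoothAbs_zero (hε k)) (φ k)
  have hfi : Integrable f g.vol :=
    f.continuous.integrable_of_hasCompactSupport f.hasCompactSupport
  -- The vector `w` minimizes `‖v‖² - 2 ⟨w, v⟩`. Passing from `φ k` to its smoothed absolute value
  -- does not raise the first term and lowers the pairing by at most `ε k ∫ f`, since `f ≥ 0`. So `h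
  -- k` is again a minimizing sequence.
  have hbound : ∀ k, ‖toEnergy g m (h k) - w‖ ^ 2 ≤ ‖toEnergy g m (φ k)‖ ^ 2 -
      2 * inner ℝ w (toEnergy g m (φ k)) + 2 * (ε k * ∫ p, f p ∂g.vol) + ‖w‖ ^ 2 := fun k => by
    have h1 : ‖toEnergy g m (h k)‖ ^ 2 ≤ ‖toEnergy g m (φ k)‖ ^ 2 := by
      rw [← real_inner_self_eq_norm_sq, ← real_inner_self_eq_norm_sq, inner_toEnergy,
        inner_toEnergy]
      simpa using g.energy_comp_le m (contDiff_smoothAbs (hε k)) (smoothAbs_zero (hε k))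
        (abs_deriv_smoothAbs_le (hε k)) (φ k) (h k) fun _ => rfl
    have h2 : inner ℝ w (toEnergy g m (φ k)) - ε k * ∫ p, f p ∂g.vol ≤
        inner ℝ w (toEnergy g m (h k)) := by
      rw [inner_potential, inner_potential, ← integral_const_mul,
        ← integral_sub (g.integrable_mul f.continuous _) (hfi.const_mul _)]
      refine integral_mono ((g.integrable_mul f.continuous _).sub (hfi.const_mul _))
        (g.integrable_mul f.continuous _) fun p => ?_
      have := mul_le_mul_of_nonneg_left (sub_le_smoothAbs (ε k) (φ k p)) (hf p)
      change f p * φ k p - ε k * f p ≤ f p * smoothAbs (ε k) (φ k p)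
      linarith
    rw [norm_sub_sq_real, real_inner_comm w]
    linarith
  have hlim : Tendsto (fun k => toEnergy g m (h k)) atTop (𝓝 w) := by
    rw [tendsto_iff_norm_sub_tendsto_zero]
    have hsq : Tendsto (fun k => ‖toEnergy g m (h k) - w‖ ^ 2) atTop (𝓝 0) := by
      refine squeeze_zero (fun _ => sq_nonneg _) hbound ?_
      have := (((hvw.norm.pow 2).sub ((tendsto_const_nhds (x := w)).inner (𝕜 := ℝ) hvw |>.const_mul
        2)).add ((hε0.mul_const (∫ p, f p ∂g.vol)).const_mul 2)).add_const (‖w‖ ^ 2)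
      rw [real_inner_self_eq_norm_sq] at this
      convert this using 2
      ring
    simpa using hsq.sqrt
  -- Thus `w` is a limit of nonnegative functions, and pairing with the potential of `ψ ≥ 0` is
  -- integration against `ψ`.
  refine ge_of_tendsto' ((tendsto_const_nhds (x := potential g hm ψ)).inner (𝕜 := ℝ) hlim)
    fun k => ?_
  rw [inner_potential]
  exact integral_nonneg fun p => mul_nonneg (hψ p) (smoothAbs_nonneg (ε k) _)

/-- Convergence in `L²` implies convergence of the integrals against continuous functions with compact
support. -/
lemma tendsto_integral_mul_of_eLpNorm {u : Spacetime n → ℝ} (hu : MemLp u 2 g.vol)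
    {φ : ℕ → Test n} (h : Tendsto (fun k => eLpNorm (fun p => u p - φ k p) 2 g.vol) atTop (𝓝 0))
    {w : Spacetime n → ℝ} (hw : MemLp w 2 g.vol) :
    Tendsto (fun k => ∫ p, w p * φ k p ∂g.vol) atTop (𝓝 (∫ p, w p * u p ∂g.vol)) := by
  have hφ : ∀ k, MemLp (φ k) 2 g.vol := fun k =>
    (φ k).continuous.memLp_of_hasCompactSupport (φ k).hasCompactSupport
  refine tendsto_integral_of_L1' _ (hw.integrable_mul hu).aestronglyMeasurable
    (.of_forall fun k => hw.integrable_mul (hφ k)) ?_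
  have hb : Tendsto (fun k => eLpNorm w 2 g.vol * eLpNorm (fun p => u p - φ k p) 2 g.vol) atTop
      (𝓝 0) := by
    simpa using ENNReal.Tendsto.const_mul h (.inr hw.eLpNorm_ne_top)
  refine tendsto_of_tendsto_of_tendsto_of_le_of_le tendsto_const_nhds hb (fun _ => zero_le)
    fun k => ?_
  have e : (fun p => w p * φ k p) - (fun p => w p * u p) = w • (fun p => φ k p - u p) := by
    ext p; simp [mul_sub]
  have e' : eLpNorm (fun p => u p - φ k p) 2 g.vol = eLpNorm (fun p => φ k p - u p) 2 g.vol := by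
    rw [← eLpNorm_neg]; congr 1; ext p; simp
  rw [e']
  change eLpNorm ((fun p => w p * φ k p) - (fun p => w p * u p)) 1 g.vol ≤ _
  rw [e]
  exact eLpNorm_smul_le_mul_eLpNorm ((hφ k).sub hu).aestronglyMeasurable hw.aestronglyMeasurable

/-- This identifies the `L²` function `u` of `IsResolvent` with the Riesz vector `potential g hm f`:
the approximating test functions have a limit in the energy space, and the weak equation determines
it. -/
lemma IsResolvent.integral_mul (hm : 0 < m) {f : Test n} {u : Spacetime n → ℝ}
    (hu : IsResolvent g m f u) (h : Test n) :
    ∫ p, h p * u p ∂g.vol = inner ℝ (potential g hm h) (potential g hm f) := by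
  obtain ⟨φ, h1, h2⟩ := hu.formDomain
  have hmem : ∀ χ : Test n, MemLp χ 2 g.vol := fun χ =>
    χ.continuous.memLp_of_hasCompactSupport χ.hasCompactSupport
  have hc : CauchySeq fun k => toEnergy g m (φ k) := by
    rw [cauchySeq_iff_tendsto_dist_atTop_0]
    have := h2.sqrt
    rw [Real.sqrt_zero] at this
    refine this.congr fun k => ?_
    rw [dist_eq_norm, ← map_sub, norm_toEnergy]
    rfl
  obtain ⟨w, hw⟩ := cauchySeq_tendsto_of_complete hc
  obtain rfl : w = potential g hm f := by
    refine FieldSpace.energySpace_ext fun χ => ?_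
    have hL : MemLp (fun p => g.laplaceBeltrami χ p + m ^ 2 * χ p) 2 g.vol := by
      refine Continuous.memLp_of_hasCompactSupport ((g.continuous_laplaceBeltrami χ).add
        (continuous_const.mul χ.continuous)) ?_
      exact hasCompactSupport_mul_laplace g m χ
    have t1 := tendsto_integral_mul_of_eLpNorm hu.memLp h1 hL
    have t2 := hw.inner (𝕜 := ℝ) (tendsto_const_nhds (x := toEnergy g m χ))
    rw [inner_potential, ← hu.weak χ]
    simp only [inner_toEnergy, g.energy_eq_integral, mul_comm (φ _ _)] at t2
    simp only [mul_comm (u _)]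
    exact tendsto_nhds_unique t2 t1
  have t1 := tendsto_integral_mul_of_eLpNorm hu.memLp h1 (hmem h)
  have t2 := (tendsto_const_nhds (x := potential g hm h)).inner (𝕜 := ℝ) hw
  simp only [inner_potential] at t2
  exact tendsto_nhds_unique t1 t2

lemma exists_bump_subset {E : Type} [NormedAddCommGroup E] [NormedSpace ℝ E]
    [FiniteDimensional ℝ E] {p : E} {O : Set E} (hO : O ∈ 𝓝 p) :
    ∃ φ : 𝓓((⊤ : Opens E), ℝ), (∀ q, 0 ≤ φ q) ∧ (∀ q, q ∉ O → φ q = 0) ∧ φ p = 1 := by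
  obtain ⟨r, hr, hrO⟩ := Metric.mem_nhds_iff.1 hO
  let b : ContDiffBump p := ⟨r / 2, r, by positivity, by linarith⟩
  refine ⟨mkTest b b.contDiff b.hasCompactSupport, fun q => b.nonneg, fun q hq => ?_, ?_⟩
  · have : q ∉ Function.support b := by rw [b.support_eq]; exact fun h => hq (hrO h)
    simpa using this
  · exact b.one_of_mem_closedBall (Metric.mem_closedBall_self b.rIn_pos.le)

namespace IsGreenKernel

variable {E : Spacetime n → Spacetime n → ℝ}

/-- The Green kernel is nonnegative away from the diagonal. -/
lemma nonneg (hm : 0 < m) (hE : IsGreenKernel g m E) {p q : Spacetime n} (hpq : p ≠ q) :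
    0 ≤ E p q := by
  by_contra! hlt
  -- A strict negative bound `c` persists on a product of neighbourhoods. Bumps supported there
  -- would make the resolvent form at most `c ∫ ψ ∫ f < 0`, contrary to positivity.
  obtain ⟨c, hc0, hc⟩ : ∃ c, c < 0 ∧ E p q < c := ⟨E p q / 2, by linarith, by linarith⟩
  have hcont : ContinuousAt (fun z : Spacetime n × Spacetime n => E z.1 z.2) (p, q) :=
    hE.continuousOn.continuousAt (isClosed_diagonal.isOpen_compl.mem_nhds hpq)
  have hev : ∀ᶠ z : Spacetime n × Spacetime n in 𝓝 (p, q), E z.1 z.2 < c :=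
    hcont.eventually (gt_mem_nhds hc)
  rw [nhds_prod_eq, eventually_prod_iff] at hev
  obtain ⟨P, hP, Q, hQ, hPQ⟩ := hev
  obtain ⟨ψ, hψ0, hψ1, hψ2⟩ := exists_bump_subset hP
  obtain ⟨f, hf0, hf1, hf2⟩ := exists_bump_subset hQ
  have hpos : ∀ φ : Test n, (∀ q, 0 ≤ φ q) → ∀ p, φ p = 1 → 0 < ∫ p, φ p ∂g.vol :=
    fun φ h0 p h1 => φ.continuous.integral_pos_of_hasCompactSupport_nonneg_nonzero
      φ.hasCompactSupport h0 (x := p) (by rw [h1]; exact one_ne_zero)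
  have hint : ∀ φ : Test n, Integrable φ g.vol := fun φ =>
    φ.continuous.integrable_of_hasCompactSupport φ.hasCompactSupport
  have h1 : ∀ᵐ x ∂g.vol, ψ x * ∫ y, E x y * f y ∂g.vol ≤ ψ x * (c * ∫ y, f y ∂g.vol) := by
    filter_upwards [hE.integrable f] with x hx
    by_cases hxP : x ∈ {x | P x}
    · refine mul_le_mul_of_nonneg_left ?_ (hψ0 x)
      rw [← integral_const_mul]
      refine integral_mono hx ((hint f).const_mul c) fun y => ?_
      by_cases hyQ : y ∈ {y | Q y}
      · exact mul_le_mul_of_nonneg_right (hPQ hxP hyQ).le (hf0 y)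
      · simp [hf1 y hyQ]
    · simp [hψ1 x hxP]
  have h2 : ∫ x, ψ x * ∫ y, E x y * f y ∂g.vol ∂g.vol ≤
      ∫ x, ψ x * (c * ∫ y, f y ∂g.vol) ∂g.vol := by
    refine integral_mono_ae ?_ ((hint ψ).mul_const _) h1
    exact MemLp.integrable_mul (p := 2) (q := 2) (ψ.continuous.memLp_of_hasCompactSupport ψ.hasCompactSupport)
      (hE.resolvent f).memLp
  rw [(hE.resolvent f).integral_mul hm ψ, integral_mul_const] at h2
  have h3 := inner_potential_nonneg (g := g) hm hf0 hψ0
  have h4 := mul_pos (hpos ψ hψ0 p hψ2) (hpos f hf0 q hf2)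
  nlinarith

instance : NullSingletonClass g.vol :=
  ⟨fun p => withDensity_absolutelyContinuous _ _ (measure_singleton p)⟩

lemma aestronglyMeasurable (hE : IsGreenKernel g m E) :
    AEStronglyMeasurable (fun z : Spacetime n × Spacetime n => E z.1 z.2) (g.vol.prod g.vol) :=
  aestronglyMeasurable_of_continuousOn_offDiag _ _ hE.continuousOn

/-- For nonnegative factors the integrand is nonnegative almost everywhere, so Tonelli's theorem
reduces the claim to the iterated integral, a product of two `L²` functions. Domination covers the
general case. -/
lemma integrable_mul_mul (hm : 0 < m) (hE : IsGreenKernel g m E) (f h : Test n) :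
    Integrable (fun z : Spacetime n × Spacetime n => f z.1 * E z.1 z.2 * h z.2)
      (g.vol.prod g.vol) := by
  obtain ⟨φ, hφ⟩ := exists_dominating f
  obtain ⟨χ, hχ⟩ := exists_dominating h
  have hφ0 : ∀ p, 0 ≤ φ p := fun p => (norm_nonneg _).trans (hφ p)
  have hχ0 : ∀ p, 0 ≤ χ p := fun p => (norm_nonneg _).trans (hχ p)
  have hmeas : ∀ f h : Test n, AEStronglyMeasurable
      (fun z : Spacetime n × Spacetime n => f z.1 * E z.1 z.2 * h z.2) (g.vol.prod g.vol) :=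
    fun f h => ((f.continuous.comp continuous_fst).aestronglyMeasurable.mul
      hE.aestronglyMeasurable).mul (h.continuous.comp continuous_snd).aestronglyMeasurable
  have key : Integrable (fun z : Spacetime n × Spacetime n => φ z.1 * E z.1 z.2 * χ z.2)
      (g.vol.prod g.vol) := by
    refine (integrable_prod_iff (hmeas φ χ)).2 ⟨?_, ?_⟩
    · filter_upwards [hE.integrable χ] with p hp
      simpa only [mul_assoc] using hp.const_mul (φ p)
    · have : Integrable (fun p => φ p * ∫ q, E p q * χ q ∂g.vol) g.vol :=
        MemLp.integrable_mul (p := 2) (q := 2)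
          (φ.continuous.memLp_of_hasCompactSupport φ.hasCompactSupport)
          (hE.resolvent χ).memLp
      refine this.congr (.of_forall fun p => ?_)
      change φ p * ∫ q, E p q * χ q ∂g.vol = ∫ q, ‖φ p * E p q * χ q‖ ∂g.vol
      rw [← integral_const_mul]
      refine integral_congr_ae ?_
      have hne : ∀ᵐ q ∂g.vol, q ≠ p := by simp [ae_iff]
      filter_upwards [hne] with q hq
      rw [Real.norm_of_nonneg (mul_nonneg (mul_nonneg (hφ0 p) (hE.nonneg hm hq.symm)) (hχ0 q)),
        mul_assoc]
  refine key.mono (hmeas f h) ?_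
  filter_upwards [ae_prod_ne g.vol g.vol] with z hz
  have h0 := hE.nonneg hm hz
  rw [norm_mul, norm_mul, Real.norm_of_nonneg h0,
    Real.norm_of_nonneg (mul_nonneg (mul_nonneg (hφ0 _) h0) (hχ0 _))]
  gcongr
  · exact mul_nonneg (hφ0 _) h0
  · exact hφ _
  · exact hχ _

lemma integral_mul_mul (hm : 0 < m) (hE : IsGreenKernel g m E) (f h : Test n) :
    ∫ z : Spacetime n × Spacetime n, f z.1 * E z.1 z.2 * h z.2 ∂g.vol.prod g.vol =
      inner ℝ (potential g hm f) (potential g hm h) := by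
  rw [integral_prod _ (hE.integrable_mul_mul hm f h), ← (hE.resolvent h).integral_mul hm f]
  simp only [mul_assoc, integral_const_mul]

/-- Complex test functions are in `N`, with the norm given by the Green kernel. -/
theorem exists_fieldSpace (hm : 0 < m) (hE : IsGreenKernel g m E)
    (f : 𝓓((⊤ : Opens (Spacetime n)), ℂ)) :
    ∃ F : FieldSpace g m,
      (∀ φ : Test n, FieldSpace.toDistr g m F φ = ∫ p, f p * (φ p : ℂ) ∂g.vol) ∧
      Integrable (fun z : Spacetime n × Spacetime n =>
        conj (f z.1) * (E z.1 z.2 : ℂ) * f z.2) (g.vol.prod g.vol) ∧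
      ((‖F‖ ^ 2 : ℝ) : ℂ) = ∫ p, ∫ q, conj (f p) * (E p q : ℂ) * f q ∂g.vol ∂g.vol := by
  have key := integral_kernel_complex g.vol E f
    (hE.integrable_mul_mul hm (reTest f) (reTest f)) (hE.integrable_mul_mul hm (imTest f) (imTest f))
    (hE.integrable_mul_mul hm (reTest f) (imTest f)) (hE.integrable_mul_mul hm (imTest f) (reTest f))
    (hE.integral_mul_mul hm (reTest f) (reTest f)) (hE.integral_mul_mul hm (imTest f) (imTest f))
    (hE.integral_mul_mul hm (reTest f) (imTest f))
    ((hE.integral_mul_mul hm (imTest f) (reTest f)).trans (real_inner_comm _ _))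
  refine ⟨FieldSpace.ofPotentials (potential g hm (reTest f)) (potential g hm (imTest f)),
    fun φ => ?_, key.1, ?_⟩
  · rw [FieldSpace.toDistr_ofPotentials, inner_potential, inner_potential,
      ← integral_complex_ofReal, ← integral_complex_ofReal, ← integral_const_mul,
      ← integral_add (g.integrable_mul (reTest f).continuous φ).ofReal
        ((g.integrable_mul (imTest f).continuous φ).ofReal.const_mul _)]
    refine integral_congr_ae (.of_forall fun p => ?_)
    apply Complex.ext <;> simp
  · rw [FieldSpace.norm_sq_eq, FieldSpace.rePotential_ofPotentials,
      FieldSpace.imPotential_ofPotentials, ← real_inner_self_eq_norm_sq,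
      ← real_inner_self_eq_norm_sq]
    exact key.2

end IsGreenKernel

end Green

/-! ### Trace and slab inequalities in a flat Sobolev norm. -/

section Flat

open CurvedField.Metric (partials)

@[simp] lemma coordVec_zero : coordVec (n := n) 0 = ((1 : ℝ), (0 : Slice n)) := rfl

@[simp] lemma coordVec_succ (i : Fin n) :
    coordVec i.succ = ((0 : ℝ), (Pi.single i (1 : ℝ) : Slice n)) := rfl

lemma hasCompactSupport_sq {X : Type*} [TopologicalSpace X] {f : X → ℝ}
    (hf : HasCompactSupport f) : HasCompactSupport fun x => f x ^ 2 := by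
  simp only [sq]
  exact hf.mul_right

lemma abs_le_integral_abs_deriv {u : ℝ → ℝ} (hu : ContDiff ℝ 1 u) (hc : HasCompactSupport u)
    (σ : ℝ) : |u σ| ≤ ∫ t, |deriv u t| := by
  have h1 := hc.integral_Ioi_deriv_eq hu σ
  have hint : Integrable (deriv u) :=
    (hu.continuous_deriv le_rfl).integrable_of_hasCompactSupport hc.deriv
  calc |u σ| = ‖∫ t in Set.Ioi σ, deriv u t‖ := by rw [h1, norm_neg, Real.norm_eq_abs]
    _ ≤ ∫ t in Set.Ioi σ, |deriv u t| := norm_integral_le_integral_norm _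
    _ ≤ ∫ t, |deriv u t| := setIntegral_le_integral hint.abs (.of_forall fun t => abs_nonneg _)

lemma sq_sub_le_integral_sq_deriv {u : ℝ → ℝ} (hu : ContDiff ℝ 1 u) (hc : HasCompactSupport u)
    (σ τ : ℝ) : (u τ - u σ) ^ 2 ≤ |τ - σ| * ∫ t, deriv u t ^ 2 := by
  have key : ∀ {σ τ : ℝ}, σ ≤ τ → (u τ - u σ) ^ 2 ≤ |τ - σ| * ∫ t, deriv u t ^ 2 := by
    intro σ τ h
    have hd := hu.continuous_deriv le_rfl
    have hsq : Integrable fun t => deriv u t ^ 2 :=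
      (hd.pow 2).integrable_of_hasCompactSupport (hasCompactSupport_sq hc.deriv)
    have hint : Integrable (deriv u) := hd.integrable_of_hasCompactSupport hc.deriv
    have h1 := intervalIntegral.integral_deriv_eq_sub (a := σ) (b := τ)
      (fun x _ => hu.differentiable one_ne_zero x) (hint.intervalIntegrable)
    rw [← h1, intervalIntegral.integral_of_le h]
    -- Cauchy-Schwarz against the constant `1` on the interval produces its length.
    have h2 := sq_integral_mul_le (μ := volume.restrict (Set.Ioc σ τ)) (f := fun _ => (1 : ℝ))
      (h := deriv u) (by simp) hsq.integrableOn (by simp only [one_mul]; exact hint.integrableOn)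
    simp only [one_mul, one_pow, integral_const, smul_eq_mul, mul_one] at h2
    refine h2.trans ?_
    rw [measureReal_restrict_apply_univ, Real.volume_real_Ioc_of_le h,
      abs_of_nonneg (sub_nonneg.2 h)]
    exact mul_le_mul_of_nonneg_left
      (setIntegral_le_integral hsq (.of_forall fun t => sq_nonneg _)) (sub_nonneg.2 h)
  rcases le_total σ τ with h | h
  · exact key h
  · rw [abs_sub_comm, ← neg_sq, neg_sub]
    exact key h

lemma hasCompactSupport_slice_left {F : Type*} [Zero F] {u : Spacetime n → F}
    (hc : HasCompactSupport u) (x : Slice n) : HasCompactSupport fun t => u (t, x) :=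
  HasCompactSupport.intro (hc.isCompact.image continuous_fst) fun t ht => by
    by_contra h
    exact ht ⟨(t, x), subset_tsupport _ h, rfl⟩

lemma hasCompactSupport_slice_right {F : Type*} [Zero F] {u : Spacetime n → F}
    (hc : HasCompactSupport u) (t : ℝ) : HasCompactSupport fun x => u (t, x) :=
  HasCompactSupport.intro (hc.isCompact.image continuous_snd) fun x hx => by
    by_contra h
    exact hx ⟨(t, x), subset_tsupport _ h, rfl⟩

lemma hasDerivAt_slice {u : Spacetime n → ℝ} (hu : Differentiable ℝ u) (t : ℝ) (x : Slice n) :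
    HasDerivAt (fun t => u (t, x)) (partials u (t, x) 0) t := by
  have h1 : HasDerivAt (fun t : ℝ => ((t, x) : Spacetime n)) (1, 0) t :=
    (hasDerivAt_id t).prodMk (hasDerivAt_const t x)
  exact (hu (t, x)).hasFDerivAt.comp_hasDerivAt t h1

/-- The Sobolev norm with derivatives in the directions `t` and `x_i`. -/
def flatNorm (i : Fin n) (v : Spacetime n → ℝ) : ℝ :=
  ∫ p, (v p ^ 2 + partials v p 0 ^ 2 + partials v p i.succ ^ 2)

lemma continuous_partial (v : Test n) (k : Fin (n + 1)) :
    Continuous fun p => partials v p k :=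
  (Metric.contDiff_partials v.contDiff k).continuous

lemma hasCompactSupport_partial (v : Test n) (k : Fin (n + 1)) :
    HasCompactSupport fun p => partials v p k :=
  HasCompactSupport.intro v.hasCompactSupport fun p hp => by
    rw [partials_eq_zero_of_notMem_tsupport hp]; rfl

lemma integrable_sq_test (v : Test n) : Integrable fun p => v p ^ 2 :=
  (v.continuous.pow 2).integrable_of_hasCompactSupport
    (hasCompactSupport_sq v.hasCompactSupport)

lemma integrable_sq_partial (v : Test n) (k : Fin (n + 1)) :
    Integrable fun p => partials v p k ^ 2 :=
  ((continuous_partial v k).pow 2).integrable_of_hasCompactSupport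
    (hasCompactSupport_sq (hasCompactSupport_partial v k))

lemma flatNorm_eq (i : Fin n) (v : Test n) : flatNorm i v =
    (∫ p, v p ^ 2) + (∫ p, partials v p 0 ^ 2) + ∫ p, partials v p i.succ ^ 2 := by
  have h := integrable_sq_test v
  have h0 := integrable_sq_partial v 0
  have h1 := integrable_sq_partial v i.succ
  have h2 : Integrable fun p => v p ^ 2 + partials v p 0 ^ 2 := h.add h0
  rw [flatNorm, integral_add h2 h1, integral_add h h0]

lemma integral_sq_nonneg {X : Type*} [MeasurableSpace X] (μ : Measure X) (f : X → ℝ) :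
    0 ≤ ∫ x, f x ^ 2 ∂μ := integral_nonneg fun _ => sq_nonneg _

lemma flatNorm_nonneg (i : Fin n) (v : Spacetime n → ℝ) : 0 ≤ flatNorm i v :=
  integral_nonneg fun _ => by positivity

lemma integral_sq_le_flatNorm (i : Fin n) (v : Test n) : ∫ p, v p ^ 2 ≤ flatNorm i v := by
  rw [flatNorm_eq]
  linarith [integral_sq_nonneg volume (fun p => partials v p 0),
    integral_sq_nonneg volume (fun p => partials v p i.succ)]

lemma integral_sq_partial_zero_le_flatNorm (i : Fin n) (v : Test n) :
    ∫ p, partials v p 0 ^ 2 ≤ flatNorm i v := by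
  rw [flatNorm_eq]
  linarith [integral_sq_nonneg volume v,
    integral_sq_nonneg volume (fun p => partials v p i.succ)]

lemma partials_sq (v : Test n) (p : Spacetime n) (k : Fin (n + 1)) :
    partials (fun q => v q ^ 2) p k = 2 * (v p * partials v p k) := by
  have h := ((v.contDiff.differentiable (by simp)) p).hasFDerivAt.pow 2
  simp only [partials]
  rw [h.fderiv]
  simp [mul_assoc]

/-- A trace inequality for slices. -/
lemma integral_slice_sq_le (i : Fin n) (v : Test n) {w : Slice n → ℝ} (hw : Continuous w)
    (h0 : ∀ x, 0 ≤ w x) (h1 : ∀ x, w x ≤ 1) (σ : ℝ) :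
    ∫ x, w x * v (σ, x) ^ 2 ≤ 2 * √(∫ p : Spacetime n, w p.2 * v p ^ 2) * √(flatNorm i v) := by
  have hw2 : Continuous fun p : Spacetime n => w p.2 := hw.comp continuous_snd
  have c1 : Continuous fun p : Spacetime n => w p.2 * |v p| := hw2.mul v.continuous.abs
  have c2 : Continuous fun p : Spacetime n => |partials v p 0| := (continuous_partial v 0).abs
  have s1 : HasCompactSupport fun p : Spacetime n => w p.2 * |v p| :=
    v.hasCompactSupport.norm.mul_left
  have hsq : ContDiff ℝ 1 fun p => v p ^ 2 := (v.contDiff.pow 2).of_le (by norm_cast)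
  have hsqc : HasCompactSupport fun p => v p ^ 2 :=
    hasCompactSupport_sq v.hasCompactSupport
  have hprod : Integrable fun p : Spacetime n => w p.2 * |v p| * |partials v p 0| :=
    (c1.mul c2).integrable_of_hasCompactSupport s1.mul_right
  have hprod2 : Integrable (fun p : Spacetime n => w p.2 * |2 * (v p * partials v p 0)|)
      (volume.prod volume) := by
    refine (hprod.const_mul 2).congr (.of_forall fun p => ?_)
    simp only [abs_mul, abs_two]
    ring
  -- On each line in the `t`-direction, the value of `v²` at `σ` is bounded by the integral of `|∂_t
  -- (v²)|`.
  have step1 : ∫ x, w x * v (σ, x) ^ 2 ≤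
      ∫ x, ∫ t, w x * |2 * (v (t, x) * partials v (t, x) 0)| := by
    refine integral_mono ?_ hprod2.integral_prod_right fun x => ?_
    · refine Continuous.integrable_of_hasCompactSupport
        (hw.mul ((v.continuous.comp (by fun_prop)).pow 2)) ?_
      exact (hasCompactSupport_slice_right hsqc σ).mul_left
    · simp only [integral_const_mul]
      refine mul_le_mul_of_nonneg_left ?_ (h0 x)
      have hd : ∀ t, deriv (fun t => v (t, x) ^ 2) t = 2 * (v (t, x) * partials v (t, x) 0) :=
        fun t => by
          rw [(hasDerivAt_slice (hsq.differentiable one_ne_zero) t x).deriv, partials_sq]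
      have := abs_le_integral_abs_deriv (u := fun t => v (t, x) ^ 2)
        (hsq.comp (by fun_prop)) (hasCompactSupport_slice_left hsqc x) σ
      simp only [hd] at this
      exact (le_abs_self _).trans this
  rw [← integral_prod_symm _ hprod2] at step1
  have step2 : ∫ p : Spacetime n, w p.2 * |2 * (v p * partials v p 0)| =
      2 * ∫ p : Spacetime n, w p.2 * |v p| * |partials v p 0| := by
    rw [← integral_const_mul]
    refine integral_congr_ae (.of_forall fun p => ?_)
    simp only [abs_mul, abs_two]
    ring
  refine step1.trans ?_
  change ∫ p : Spacetime n, w p.2 * |2 * (v p * partials v p 0)| ≤ _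
  rw [step2, mul_assoc]
  refine mul_le_mul_of_nonneg_left ?_ zero_le_two
  have i1 : Integrable fun p : Spacetime n => (w p.2 * |v p|) ^ 2 :=
    (c1.pow 2).integrable_of_hasCompactSupport (hasCompactSupport_sq s1)
  have i2 : Integrable fun p : Spacetime n => |partials v p 0| ^ 2 := by
    simpa only [sq_abs] using integrable_sq_partial v 0
  have cs := sq_integral_mul_le i1 i2 hprod
  -- Here `w² ≤ w` because `0 ≤ w ≤ 1`. Keeping the weight with `v` alone is what later yields
  -- smallness on thin slabs.
  have b1 : ∫ p : Spacetime n, (w p.2 * |v p|) ^ 2 ≤ ∫ p : Spacetime n, w p.2 * v p ^ 2 := by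
    refine integral_mono i1 ((hw2.mul (v.continuous.pow 2)).integrable_of_hasCompactSupport
      hsqc.mul_left) fun p => ?_
    simp only [mul_pow, sq_abs]
    refine mul_le_mul_of_nonneg_right ?_ (sq_nonneg _)
    rw [sq]
    exact mul_le_of_le_one_left (h0 _) (h1 _)
  have b2 : ∫ p : Spacetime n, |partials v p 0| ^ 2 ≤ flatNorm i v := by
    simpa only [sq_abs] using integral_sq_partial_zero_le_flatNorm i v
  refine (Real.le_sqrt_of_sq_le (cs.trans (mul_le_mul b1 b2 (integral_sq_nonneg _ _)
    ((integral_sq_nonneg _ _).trans b1)))).trans_eq ?_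
  rw [Real.sqrt_mul ((integral_sq_nonneg _ _).trans b1)]

/-- The mass in a slab whose weight has a small primitive. -/
lemma integral_slab_sq_le (i : Fin n) (v : Test n) {b η : ℝ → ℝ} {κ : ℝ}
    (hη : ∀ x, HasDerivAt η (b x) x) (hb : Continuous b) (hκ : ∀ x, |η x| ≤ κ) :
    ∫ p : Spacetime n, b (p.2 i) * v p ^ 2 ≤ κ * flatNorm i v := by
  have hηc : Continuous η := continuous_iff_continuousAt.2 fun x => (hη x).continuousAt
  have hκ0 : 0 ≤ κ := (abs_nonneg _).trans (hκ 0)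
  have hproj : Continuous fun p : Spacetime n => p.2 i := by fun_prop
  have hd : ∀ p : Spacetime n, HasFDerivAt (fun p : Spacetime n => η (p.2 i))
      (b (p.2 i) • (ContinuousLinearMap.proj (R := ℝ) (φ := fun _ : Fin n => ℝ) i ∘L
        ContinuousLinearMap.snd ℝ ℝ (Slice n))) p := fun p =>
    (hη (p.2 i)).comp_hasFDerivAt p
      (ContinuousLinearMap.proj (R := ℝ) (φ := fun _ : Fin n => ℝ) i ∘L
        ContinuousLinearMap.snd ℝ ℝ (Slice n)).hasFDerivAt
  have hd' : ∀ p : Spacetime n, fderiv ℝ (fun p : Spacetime n => η (p.2 i)) p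
      (coordVec i.succ) = b (p.2 i) := fun p => by
    rw [(hd p).fderiv]; simp
  have hsq : ContDiff ℝ ∞ fun p => v p ^ 2 := v.contDiff.pow 2
  have hsqc : HasCompactSupport fun p => v p ^ 2 :=
    hasCompactSupport_sq v.hasCompactSupport
  have hs' : ∀ p, fderiv ℝ (fun q => v q ^ 2) p (coordVec i.succ) =
      2 * (v p * partials v p i.succ) := fun p => partials_sq v p i.succ
  have cvp : Continuous fun p => v p * partials v p i.succ :=
    v.continuous.mul (continuous_partial v i.succ)
  -- The weight `b` is the `x_i`-derivative of `η`. Integrating by parts replaces it by `η`, of size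
  -- `κ`, at the cost of a derivative of `v²`.
  have hparts := integral_mul_fderiv_eq_neg_fderiv_mul_of_integrable (μ := volume)
    (f := fun p => v p ^ 2) (g := fun p : Spacetime n => η (p.2 i)) (v := coordVec i.succ)
    (by
      simp only [hs']
      exact ((continuous_const.mul cvp).mul (hηc.comp hproj)).integrable_of_hasCompactSupport
        (v.hasCompactSupport.mul_right.mul_left.mul_right))
    (by
      simp only [hd']
      exact (hsq.continuous.mul (hb.comp hproj)).integrable_of_hasCompactSupport hsqc.mul_right)
    ((hsq.continuous.mul (hηc.comp hproj)).integrable_of_hasCompactSupport hsqc.mul_right)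
    (fun p _ => hsq.differentiable (by simp) p) (fun p _ => (hd p).differentiableAt)
  simp only [hd', hs'] at hparts
  simp only [mul_comm (b _)]
  rw [hparts, ← integral_neg, flatNorm, ← integral_const_mul]
  have h0 := integrable_sq_test v
  have h1 := integrable_sq_partial v 0
  have h2 := integrable_sq_partial v i.succ
  refine integral_mono ?_ (((h0.add h1).add h2).const_mul κ) fun p => ?_
  · exact (((continuous_const.mul cvp).mul (hηc.comp hproj)).integrable_of_hasCompactSupport
        (v.hasCompactSupport.mul_right.mul_left.mul_right)).neg
  · change -(2 * (v p * partials v p i.succ) * η (p.2 i)) ≤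
      κ * (v p ^ 2 + partials v p 0 ^ 2 + partials v p i.succ ^ 2)
    have e1 : |2 * (v p * partials v p i.succ)| ≤ v p ^ 2 + partials v p i.succ ^ 2 := by
      rw [abs_le]
      constructor <;> nlinarith [sq_nonneg (v p + partials v p i.succ),
        sq_nonneg (v p - partials v p i.succ)]
    calc -(2 * (v p * partials v p i.succ) * η (p.2 i))
        ≤ |2 * (v p * partials v p i.succ)| * |η (p.2 i)| := by
          rw [← abs_mul]; exact neg_le_abs _
      _ ≤ (v p ^ 2 + partials v p i.succ ^ 2) * κ := by
          gcongr
          exact hκ _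
      _ ≤ _ := by
          rw [mul_comm]
          refine mul_le_mul_of_nonneg_left ?_ hκ0
          linarith [sq_nonneg (partials v p 0)]

/-- Restrictions to neighbouring slices are close. -/
lemma integral_sq_slice_sub_le (i : Fin n) (v : Test n) (σ τ : ℝ) :
    ∫ x, (v (τ, x) - v (σ, x)) ^ 2 ≤ |τ - σ| * flatNorm i v := by
  have h0 : Integrable (fun p : Spacetime n => partials v p 0 ^ 2) (volume.prod volume) :=
    integrable_sq_partial v 0
  calc ∫ x, (v (τ, x) - v (σ, x)) ^ 2
      ≤ ∫ x, |τ - σ| * ∫ t, partials v (t, x) 0 ^ 2 := by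
        refine integral_mono ?_ (h0.integral_prod_right.const_mul _) fun x => ?_
        · refine Continuous.integrable_of_hasCompactSupport
            (((v.continuous.comp (by fun_prop)).sub (v.continuous.comp (by fun_prop))).pow 2) ?_
          exact hasCompactSupport_sq ((hasCompactSupport_slice_right v.hasCompactSupport τ).sub
            (hasCompactSupport_slice_right v.hasCompactSupport σ))
        · have hd : ∀ t, deriv (fun t => v (t, x)) t = partials v (t, x) 0 := fun t =>
            (hasDerivAt_slice (v.contDiff.differentiable (by simp)) t x).deriv
          have := sq_sub_le_integral_sq_deriv (u := fun t => v (t, x))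
            ((v.contDiff.of_le (by norm_cast)).comp (by fun_prop))
            (hasCompactSupport_slice_left v.hasCompactSupport x) σ τ
          simpa only [hd] using this
    _ = |τ - σ| * ∫ p : Spacetime n, partials v p 0 ^ 2 := by
        rw [integral_const_mul, ← integral_prod_symm _ h0]; rfl
    _ ≤ _ := mul_le_mul_of_nonneg_left (integral_sq_partial_zero_le_flatNorm i v) (abs_nonneg _)

end Flat

/-! ### Local control of the flat norm by the energy. -/

section Localization

open CurvedField.Metric (partials)

/-- Cauchy-Schwarz for the covector `df` and a coordinate vector. -/
lemma Metric.sq_partials_le (g : Metric n) (f : Spacetime n → ℝ) (p : Spacetime n)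
    (k : Fin (n + 1)) : partials f p k ^ 2 ≤ g.coeff p k k * g.gradInner f f p := by
  set A := g.coeff p with hA
  set ξ := partials f p with hξ
  have hpd := g.posDef p
  have hdet : IsUnit A.det := hpd.det_pos.ne'.isUnit
  -- The covector `c` is dual to the `k`-th coordinate vector: its `A⁻¹`-pairing with `ξ` is `ξ k`,
  -- and with itself `A k k`. The claim is then a discriminant inequality.
  set c : Fin (n + 1) → ℝ := A.mulVec (Pi.single k 1) with hc
  have h1 : A⁻¹.mulVec c = Pi.single k 1 := by
    rw [hc, Matrix.mulVec_mulVec, Matrix.nonsing_inv_mul _ hdet, Matrix.one_mulVec]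
  have hs : (A⁻¹).transpose = A⁻¹ := by
    have := hpd.inv.isHermitian
    simpa [Matrix.IsHermitian, Matrix.conjTranspose_eq_transpose_of_trivial] using this
  have h2 : c ⬝ᵥ A⁻¹.mulVec ξ = ξ k := by
    rw [Matrix.dotProduct_mulVec, ← Matrix.mulVec_transpose, hs, h1, single_one_dotProduct]
  have h3 : c k = A k k := by simp [hc]
  have key : ∀ t : ℝ, 0 ≤ A k k * (t * t) + (-2 * ξ k) * t + ξ ⬝ᵥ A⁻¹.mulVec ξ := fun t => by
    have h := hpd.inv.posSemidef.dotProduct_mulVec_nonneg (ξ - t • c)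
    rw [star_trivial] at h
    have e : (ξ - t • c) ⬝ᵥ A⁻¹.mulVec (ξ - t • c) =
        A k k * (t * t) + (-2 * ξ k) * t + ξ ⬝ᵥ A⁻¹.mulVec ξ := by
      simp only [Matrix.mulVec_sub, Matrix.mulVec_smul, h1, sub_dotProduct, dotProduct_sub,
        smul_dotProduct, dotProduct_smul, h2, dotProduct_single_one, h3, smul_eq_mul,
        Pi.sub_apply, Pi.smul_apply]
      ring
    rwa [← e]
  have := discrim_le_zero key
  rw [discrim] at this
  change ξ k ^ 2 ≤ A k k * (ξ ⬝ᵥ A⁻¹.mulVec ξ)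
  linarith

/-- The product of two test functions. -/
def mulTest (χ φ : Test n) : Test n :=
  mkTest (fun p => χ p * φ p) (χ.contDiff.mul φ.contDiff) χ.hasCompactSupport.mul_right

@[simp] lemma mulTest_apply (χ φ : Test n) (p : Spacetime n) : mulTest χ φ p = χ p * φ p := rfl

lemma partials_mulTest (χ φ : Test n) (p : Spacetime n) (k : Fin (n + 1)) :
    partials (mulTest χ φ) p k = χ p * partials φ p k + φ p * partials χ p k := by
  have h1 := (χ.contDiff.differentiable (by simp)) p
  have h2 := (φ.contDiff.differentiable (by simp)) p
  have e : (mulTest χ φ : Spacetime n → ℝ) = (χ : Spacetime n → ℝ) * φ := rfl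
  simp only [partials, e, fderiv_mul h1 h2]
  simp

/-- By the product rule the flat density of `χ φ` is at most `R |∇φ|² + S φ²`. The first term is
absorbed by the gradient part of the energy and the second by its mass part; the quotient by `√g` is
bounded since `χ` has compact support. -/
lemma exists_flatNorm_le (g : Metric n) {m : ℝ} (hm : 0 < m) (i : Fin n) (χ : Test n) :
    ∃ C : ℝ, 0 ≤ C ∧ ∀ φ : Test n, flatNorm i (mulTest χ φ) ≤ C * g.energy m φ φ := by
  let A : Spacetime n → ℝ := fun p => (g.density p)⁻¹ *
    (2 * χ p ^ 2 * (g.coeff p 0 0 + g.coeff p i.succ i.succ) +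
      (χ p ^ 2 + 2 * partials χ p 0 ^ 2 + 2 * partials χ p i.succ ^ 2) / m ^ 2)
  have hχ := χ.continuous
  have hd0 := continuous_partial χ 0
  have hdi := continuous_partial χ i.succ
  have hA : Continuous A := by
    refine (g.continuous_density.inv₀ fun p => (g.density_pos p).ne').mul (Continuous.add
      ((continuous_const.mul (hχ.pow 2)).mul ((g.continuous_coeff.matrix_elem 0 0).add
        (g.continuous_coeff.matrix_elem i.succ i.succ))) ?_)
    exact (((hχ.pow 2).add (continuous_const.mul (hd0.pow 2))).add
      (continuous_const.mul (hdi.pow 2))).div_const _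
  have hAc : HasCompactSupport A := HasCompactSupport.intro χ.hasCompactSupport fun p hp => by
    simp [A, image_eq_zero_of_notMem_tsupport hp, partials_eq_zero_of_notMem_tsupport hp]
  obtain ⟨C, hC⟩ := hAc.exists_bound_of_continuous hA
  have hC0 : 0 ≤ C := (norm_nonneg _).trans (hC 0)
  refine ⟨C, hC0, fun φ => ?_⟩
  rw [Metric.energy, g.integral_vol, ← integral_const_mul, flatNorm]
  have hint : Integrable fun p => g.density p • (g.gradInner φ φ p + m ^ 2 * (φ p * φ p)) := by
    refine (integrable_withDensity_iff_integrable_smul'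
      g.continuous_density.measurable.ennreal_ofReal
      (.of_forall fun _ => ENNReal.ofReal_lt_top)).1 (g.integrable_energy m φ φ) |>.congr
      (.of_forall fun p => ?_)
    simp only [ENNReal.toReal_ofReal (g.density_pos p).le]
  refine integral_mono (((integrable_sq_test _).add (integrable_sq_partial _ 0)).add
    (integrable_sq_partial _ i.succ)) (hint.const_mul C) fun p => ?_
  have hd := g.density_pos p
  have hG := g.gradInner_self_nonneg φ p
  have b0 := g.sq_partials_le φ p 0
  have bi := g.sq_partials_le φ p i.succ
  have hg0 : 0 ≤ g.coeff p 0 0 := (g.posDef p).diag_pos.le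
  have hgi : 0 ≤ g.coeff p i.succ i.succ := (g.posDef p).diag_pos.le
  have hsq : ∀ a b : ℝ, (a + b) ^ 2 ≤ 2 * a ^ 2 + 2 * b ^ 2 := fun a b => by
    nlinarith [sq_nonneg (a - b)]
  have e0 := hsq (χ p * partials φ p 0) (φ p * partials χ p 0)
  have ei := hsq (χ p * partials φ p i.succ) (φ p * partials χ p i.succ)
  have hm2 : m ^ 2 ≠ 0 := by positivity
  change mulTest χ φ p ^ 2 + partials (mulTest χ φ) p 0 ^ 2 +
    partials (mulTest χ φ) p i.succ ^ 2 ≤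
      C * (g.density p * (g.gradInner φ φ p + m ^ 2 * (φ p * φ p)))
  rw [partials_mulTest, partials_mulTest, mulTest_apply]
  set G := g.gradInner φ φ p
  set S := χ p ^ 2 + 2 * partials χ p 0 ^ 2 + 2 * partials χ p i.succ ^ 2 with hS
  set R := 2 * χ p ^ 2 * (g.coeff p 0 0 + g.coeff p i.succ i.succ) with hR
  have hS0 : 0 ≤ S := by positivity
  have hR0 : 0 ≤ R := by positivity
  have hRS : R + S / m ^ 2 ≤ C * g.density p := by
    have := (le_abs_self _).trans (hC p)
    change (g.density p)⁻¹ * (R + S / m ^ 2) ≤ C at this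
    rwa [inv_mul_le_iff₀ hd, mul_comm] at this
  have hSm : S / m ^ 2 * m ^ 2 = S := div_mul_cancel₀ _ hm2
  have hSm0 : 0 ≤ S / m ^ 2 := by positivity
  calc _ ≤ R * G + S * φ p ^ 2 := by
        have := mul_le_mul_of_nonneg_left b0 (sq_nonneg (χ p))
        have := mul_le_mul_of_nonneg_left bi (sq_nonneg (χ p))
        rw [hS, hR]
        nlinarith
    _ ≤ (R + S / m ^ 2) * (G + m ^ 2 * (φ p * φ p)) := by
        have h1 : 0 ≤ R * (m ^ 2 * (φ p * φ p)) := by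
          have := mul_self_nonneg (φ p); positivity
        have h2 := mul_nonneg hSm0 hG
        have h3 : S / m ^ 2 * (m ^ 2 * (φ p * φ p)) = S * φ p ^ 2 := by
          rw [← mul_assoc, hSm]; ring
        have e : (R + S / m ^ 2) * (G + m ^ 2 * (φ p * φ p)) = R * G + R * (m ^ 2 * (φ p * φ p)) +
          (S / m ^ 2 * G + S / m ^ 2 * (m ^ 2 * (φ p * φ p))) := by ring
        rw [e, h3]
        linarith
    _ ≤ (C * g.density p) * (G + m ^ 2 * (φ p * φ p)) := by
        refine mul_le_mul_of_nonneg_right hRS ?_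
        have := mul_self_nonneg (φ p)
        positivity
    _ = _ := by ring

/-- Test functions can be localized near a compact subset of a slice, with the Sobolev norm bounded by
the energy. -/
lemma exists_localization (g : Metric n) {m : ℝ} (hm : 0 < m) (i : Fin n) (σ : ℝ)
    (ψ : SliceTest n) : ∃ C : ℝ, 0 ≤ C ∧ ∀ φ : Test n, ∃ v : Test n,
      (∀ τ x, |τ - σ| ≤ 1 → ψ x * v (τ, x) = ψ x * φ (τ, x)) ∧
        flatNorm i v ≤ C * g.energy m φ φ := by
  obtain ⟨R, hR⟩ := ψ.hasCompactSupport.isCompact.isBounded.subset_closedBall (0 : Slice n)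
  let b : ContDiffBump (0 : Slice n) := ⟨max R 1, max R 1 + 1, by positivity, by linarith⟩
  -- The cutoff `χ` equals `1` on the support of `ψ` for all times within `1` of `σ`, and does not
  -- depend on `φ`.
  let χ : Test n := liftCLM σ (mkTest b b.contDiff b.hasCompactSupport)
  obtain ⟨C, hC, h⟩ := exists_flatNorm_le g hm i χ
  refine ⟨C, hC, fun φ => ⟨mulTest χ φ, fun τ x hτ => ?_, h φ⟩⟩
  by_cases hx : x ∈ tsupport ψ
  · have : χ (τ, x) = 1 := by
      change cutoff σ τ * b x = 1
      rw [(cutoff σ).one_of_mem_closedBall (by simpa [cutoff, Real.dist_eq] using hτ),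
        b.one_of_mem_closedBall (Metric.closedBall_subset_closedBall (le_max_left _ _) (hR hx)),
        one_mul]
    rw [mulTest_apply, this, one_mul]
  · rw [image_eq_zero_of_notMem_tsupport hx, zero_mul, zero_mul]

end Localization

/-! ### Potentials of smooth densities on a slice. -/

section SlicePotential

open CurvedField.Metric (partials)

namespace Metric

lemma sliceDensity_continuous (g : Metric n) (σ : ℝ) : Continuous fun x => g.density (σ, x) :=
  g.continuous_density.comp (by fun_prop)

lemma integral_sliceVol (g : Metric n) (σ : ℝ) {E : Type*} [NormedAddCommGroup E]
    [NormedSpace ℝ E] (h : Slice n → E) :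
    ∫ x, h x ∂g.sliceVol σ = ∫ x, g.density (σ, x) • h x := by
  rw [sliceVol, integral_withDensity_eq_integral_toReal_smul
    (g.sliceDensity_continuous σ).measurable.ennreal_ofReal
    (.of_forall fun _ => ENNReal.ofReal_lt_top)]
  exact integral_congr_ae (.of_forall fun x => by
    simp only [ENNReal.toReal_ofReal (g.density_pos (σ, x)).le])

instance (g : Metric n) (σ : ℝ) : IsLocallyFiniteMeasure (g.sliceVol σ) :=
  IsLocallyFiniteMeasure.withDensity_ofReal (g.sliceDensity_continuous σ)

end Metric

variable {g : Metric n} {m : ℝ}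

lemma continuous_slice_comp (φ : Test n) (τ : ℝ) : Continuous fun x => φ (τ, x) :=
  φ.continuous.comp (by fun_prop)

/-- The square of the norm of a density on a slice. -/
def sliceMass (g : Metric n) (σ : ℝ) (ψ : SliceTest n) : ℝ :=
  ∫ x, (g.density (σ, x) * ψ x) ^ 2

lemma sliceMass_nonneg (σ : ℝ) (ψ : SliceTest n) : 0 ≤ sliceMass g σ ψ :=
  integral_sq_nonneg _ _

/-- Cauchy-Schwarz on a slice with a weight. -/
lemma sq_integral_slice_le (σ : ℝ) (ψ : SliceTest n) {w u : Slice n → ℝ} (hw : Continuous w)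
    (h0 : ∀ x, 0 ≤ w x) (hu : Continuous u) (huc : HasCompactSupport u) :
    (∫ x, w x * (ψ x * u x) ∂g.sliceVol σ) ^ 2 ≤
      (∫ x, w x * (g.density (σ, x) * ψ x) ^ 2) * ∫ x, w x * u x ^ 2 := by
  have hd := g.sliceDensity_continuous σ
  have c1 : Continuous fun x => √(w x) * (g.density (σ, x) * ψ x) :=
    hw.sqrt.mul (hd.mul ψ.continuous)
  have s1 : HasCompactSupport fun x => √(w x) * (g.density (σ, x) * ψ x) :=
    ψ.hasCompactSupport.mul_left.mul_left
  have c2 : Continuous fun x => √(w x) * u x := hw.sqrt.mul hu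
  have s2 : HasCompactSupport fun x => √(w x) * u x := huc.mul_left
  have h := sq_integral_mul_le ((c1.pow 2).integrable_of_hasCompactSupport (μ := volume)
    (hasCompactSupport_sq s1)) ((c2.pow 2).integrable_of_hasCompactSupport
    (hasCompactSupport_sq s2)) ((c1.mul c2).integrable_of_hasCompactSupport s1.mul_right)
  simp only [mul_pow, Real.sq_sqrt (h0 _)] at h ⊢
  convert h using 2
  rw [g.integral_sliceVol]
  refine integral_congr_ae (.of_forall fun x => ?_)
  simp only [smul_eq_mul]
  calc g.density (σ, x) * (w x * (ψ x * u x))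
      = (√(w x) * √(w x)) * (g.density (σ, x) * (ψ x * u x)) := by
        rw [Real.mul_self_sqrt (h0 x)]; ring
    _ = _ := by ring

/-- The basic estimates for the distribution `ψ δ(t - σ)`: for slabs, and for nearby slices. -/
lemma exists_slice_estimates (g : Metric n) (hm : 0 < m) (i : Fin n) (σ : ℝ) (ψ : SliceTest n) :
    ∃ C : ℝ, 0 ≤ C ∧
      (∀ φ : Test n, (∫ x, ψ x * φ (σ, x) ∂g.sliceVol σ) ^ 2 ≤ C * g.energy m φ φ) ∧
      (∀ (φ : Test n) (τ : ℝ), |τ - σ| ≤ 1 → ((∫ x, ψ x * φ (τ, x) ∂g.sliceVol σ) -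
        ∫ x, ψ x * φ (σ, x) ∂g.sliceVol σ) ^ 2 ≤ |τ - σ| * (C * g.energy m φ φ)) ∧
      (∀ (b η : ℝ → ℝ) (κ : ℝ), (∀ x, HasDerivAt η (b x) x) → Continuous b → (∀ x, 0 ≤ b x) →
        (∀ x, b x ≤ 1) → (∀ x, |η x| ≤ κ) → ∀ φ : Test n,
          (∫ x, b (x i) * (ψ x * φ (σ, x)) ∂g.sliceVol σ) ^ 2 ≤
            (∫ x, b (x i) * (g.density (σ, x) * ψ x) ^ 2) * (√κ * (C * g.energy m φ φ))) := by
  obtain ⟨C, hC, h⟩ := exists_localization g hm i σ ψ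
  have hM := sliceMass_nonneg (g := g) σ ψ
  -- One constant serves all three bounds. The first summand covers the first two, which carry the
  -- whole mass of `ψ`; the second covers the slab bound, where the weighted mass stays explicit so
  -- that it can be summed over slabs.
  refine ⟨2 * C * sliceMass g σ ψ + 2 * C, by positivity, fun φ => ?_, fun φ τ hτ => ?_,
    fun b η κ hη hb b0 b1 hκ φ => ?_⟩ <;> obtain ⟨v, hv, hvC⟩ := h φ <;>
    have hE := g.energy_self_nonneg m φ <;> have hF := flatNorm_nonneg i v <;>
    have hCE : 0 ≤ C * g.energy m φ φ := mul_nonneg hC hE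
  · have h1 := sq_integral_slice_le (g := g) σ ψ (w := fun _ => (1 : ℝ)) continuous_const
      (fun _ => zero_le_one) (continuous_slice_comp v σ)
      (hasCompactSupport_slice_right v.hasCompactSupport σ)
    have h2 := integral_slice_sq_le i v (w := fun _ => (1 : ℝ)) continuous_const
      (fun _ => zero_le_one) (fun _ => le_rfl) σ
    simp only [one_mul, hv σ _ (by simp : |σ - σ| ≤ 1)] at h1 h2
    refine h1.trans ?_
    have h3 : √(∫ p, v p ^ 2) * √(flatNorm i v) ≤ flatNorm i v := by
      calc _ ≤ √(flatNorm i v) * √(flatNorm i v) := by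
            gcongr; exact integral_sq_le_flatNorm i v
        _ = _ := Real.mul_self_sqrt hF
    change sliceMass g σ ψ * _ ≤ _
    calc sliceMass g σ ψ * ∫ x, v (σ, x) ^ 2
        ≤ sliceMass g σ ψ * (2 * (C * g.energy m φ φ)) := by
          refine mul_le_mul_of_nonneg_left ?_ hM
          linarith
      _ ≤ _ := by nlinarith
  · have hcv := continuous_slice_comp v
    have hsv := fun τ => hasCompactSupport_slice_right v.hasCompactSupport τ
    have hi : ∀ τ, Integrable (fun x => ψ x * v (τ, x)) (g.sliceVol σ) := fun τ =>
      (ψ.continuous.mul (hcv τ)).integrable_of_hasCompactSupport ψ.hasCompactSupport.mul_right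
    have h1 := sq_integral_slice_le (g := g) σ ψ (w := fun _ => (1 : ℝ)) continuous_const
      (fun _ => zero_le_one) ((hcv τ).sub (hcv σ)) ((hsv τ).sub (hsv σ))
    have h2 := integral_sq_slice_sub_le i v σ τ
    simp only [one_mul] at h1
    simp only [← hv τ _ hτ, ← hv σ _ (by simp : |σ - σ| ≤ 1)]
    rw [← integral_sub (hi τ) (hi σ)]
    simp only [← mul_sub]
    refine h1.trans ?_
    change sliceMass g σ ψ * ∫ x, (v (τ, x) - v (σ, x)) ^ 2 ≤ _
    calc sliceMass g σ ψ * ∫ x, (v (τ, x) - v (σ, x)) ^ 2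
        ≤ sliceMass g σ ψ * (|τ - σ| * (C * g.energy m φ φ)) := by
          refine mul_le_mul_of_nonneg_left (h2.trans ?_) hM
          exact mul_le_mul_of_nonneg_left hvC (abs_nonneg _)
      _ = |τ - σ| * (sliceMass g σ ψ * (C * g.energy m φ φ)) := by ring
      _ ≤ _ := by
          refine mul_le_mul_of_nonneg_left ?_ (abs_nonneg _)
          nlinarith
  · have hw : Continuous fun x : Slice n => b (x i) := hb.comp (continuous_apply i)
    have h1 := sq_integral_slice_le (g := g) σ ψ hw
      (fun _ => b0 _) (continuous_slice_comp v σ)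
      (hasCompactSupport_slice_right v.hasCompactSupport σ)
    have h2 := integral_slice_sq_le i v hw (fun _ => b0 _) (fun _ => b1 _) σ
    have h3 := integral_slab_sq_le i v hη hb hκ
    have hκ0 : 0 ≤ κ := (abs_nonneg _).trans (hκ 0)
    simp only [hv σ _ (by simp : |σ - σ| ≤ 1)] at h1
    refine h1.trans (mul_le_mul_of_nonneg_left ?_
      (integral_nonneg fun x => mul_nonneg (b0 _) (sq_nonneg _)))
    refine h2.trans ?_
    -- The slab inequality bounds the weighted mass of `v` in the trace inequality, which gains the
    -- factor `√κ`.
    calc 2 * √(∫ p : Spacetime n, b (p.2 i) * v p ^ 2) * √(flatNorm i v)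
        ≤ 2 * √(κ * flatNorm i v) * √(flatNorm i v) := by gcongr
      _ = 2 * √κ * flatNorm i v := by
          rw [Real.sqrt_mul hκ0, mul_assoc, mul_assoc, Real.mul_self_sqrt hF, mul_assoc]
      _ ≤ 2 * √κ * (C * g.energy m φ φ) := by gcongr
      _ = √κ * (2 * (C * g.energy m φ φ)) := by ring
      _ ≤ _ := by
          refine mul_le_mul_of_nonneg_left ?_ (Real.sqrt_nonneg _)
          nlinarith [mul_nonneg hM hCE]

lemma integrable_slice (g : Metric n) (σ : ℝ) (ψ : SliceTest n) (φ : Test n) (τ : ℝ) :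
    Integrable (fun x => ψ x * φ (τ, x)) (g.sliceVol σ) :=
  (ψ.continuous.mul (continuous_slice_comp φ τ)).integrable_of_hasCompactSupport
    ψ.hasCompactSupport.mul_right

lemma exists_slicePotential (g : Metric n) (hm : 0 < m) (i : Fin n) (σ : ℝ) (ψ : SliceTest n) :
    ∃ u : EnergySpace g m, ∀ φ, inner ℝ u (toEnergy g m φ) =
      ∫ x, ψ x * φ (σ, x) ∂g.sliceVol σ := by
  let T : Test n →ₗ[ℝ] ℝ :=
    { toFun := fun φ => ∫ x, ψ x * φ (σ, x) ∂g.sliceVol σ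
      map_add' := fun φ χ => by
        rw [← integral_add (integrable_slice g σ ψ φ σ) (integrable_slice g σ ψ χ σ)]
        exact integral_congr_ae (.of_forall fun x => mul_add _ _ _)
      map_smul' := fun c φ => by
        rw [RingHom.id_apply, smul_eq_mul, ← integral_const_mul]
        exact integral_congr_ae (.of_forall fun x => mul_left_comm _ _ _) }
  obtain ⟨C, hC, h, -⟩ := exists_slice_estimates g hm i σ ψ
  refine FieldSpace.exists_riesz (T := T) ⟨√C, fun φ => ?_⟩
  rw [← Real.sqrt_mul hC]
  exact Real.abs_le_sqrt (h φ)

/-- The vector `(Δ + m²)⁻¹ (ψ δ(t - σ))` of the energy space. -/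
def slicePotential (g : Metric n) (hm : 0 < m) (i : Fin n) (σ : ℝ) (ψ : SliceTest n) :
    EnergySpace g m := (exists_slicePotential g hm i σ ψ).choose

lemma inner_slicePotential (hm : 0 < m) (i : Fin n) (σ : ℝ) (ψ : SliceTest n) (φ : Test n) :
    inner ℝ (slicePotential g hm i σ ψ) (toEnergy g m φ) = ∫ x, ψ x * φ (σ, x) ∂g.sliceVol σ :=
  (exists_slicePotential g hm i σ ψ).choose_spec φ

/-- By density the bound holds for every vector in place of the test function, in particular for `w`
itself. -/
lemma norm_le_of_inner_toEnergy {w : EnergySpace g m} {C : ℝ} (hC : 0 ≤ C)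
    (h : ∀ φ, inner ℝ w (toEnergy g m φ) ^ 2 ≤ C * g.energy m φ φ) : ‖w‖ ^ 2 ≤ C := by
  have key : ∀ z : EnergySpace g m, inner ℝ w z ^ 2 ≤ C * ‖z‖ ^ 2 := fun z => by
    have hcl : IsClosed {z : EnergySpace g m | inner ℝ w z ^ 2 ≤ C * ‖z‖ ^ 2} :=
      isClosed_le ((continuous_const.inner continuous_id).pow 2)
        (continuous_const.mul (continuous_norm.pow 2))
    refine hcl.closure_subset_iff.2 ?_ ((denseRange_toEnergy g m) z)
    rintro _ ⟨φ, rfl⟩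
    change inner ℝ w (toEnergy g m φ) ^ 2 ≤ C * ‖toEnergy g m φ‖ ^ 2
    rw [norm_toEnergy, Real.sq_sqrt (g.energy_self_nonneg m φ)]
    exact h φ
  have := key w
  rw [real_inner_self_eq_norm_sq] at this
  by_contra! hlt
  have h0 : 0 < ‖w‖ ^ 2 := hC.trans_lt hlt
  nlinarith

end SlicePotential

/-! ### Mollification of slice densities in the time direction. -/

section Mollify

variable {g : Metric n} {m : ℝ} {σ : ℝ}

/-- The probability measure on the time axis with the density `ρ`. -/
def timeMeasure (ρ : ContDiffBump σ) : Measure ℝ :=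
  volume.withDensity fun t => ENNReal.ofReal (ρ.normed volume t)

instance (ρ : ContDiffBump σ) : IsProbabilityMeasure (timeMeasure ρ) := by
  refine ⟨?_⟩
  rw [timeMeasure, withDensity_apply _ MeasurableSet.univ, Measure.restrict_univ,
    ← ofReal_integral_eq_lintegral_ofReal ρ.integrable_normed (.of_forall ρ.nonneg_normed),
    ρ.integral_normed, ENNReal.ofReal_one]

lemma timeMeasure_ae (ρ : ContDiffBump σ) : ∀ᵐ t ∂timeMeasure ρ, |t - σ| ≤ ρ.rOut := by
  rw [timeMeasure, ae_withDensity_iff ρ.continuous_normed.measurable.ennreal_ofReal]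
  refine .of_forall fun t ht => ?_
  by_contra h
  have h' : t ∉ Function.support (ρ.normed volume) := by
    rw [ρ.support_normed_eq, mem_ball_iff_norm, Real.norm_eq_abs]
    exact fun h'' => h h''.le
  rw [Function.notMem_support.1 h', ENNReal.ofReal_zero] at ht
  exact ht rfl

/-- The density of `ρ(t) dt dμ_σ(x)` with respect to the volume. -/
def mollifier (g : Metric n) (ρ : ContDiffBump σ) (p : Spacetime n) : ℝ :=
  ρ.normed volume p.1 * (g.density (σ, p.2) / g.density p)

lemma mollifier_nonneg (g : Metric n) (ρ : ContDiffBump σ) (p : Spacetime n) :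
    0 ≤ mollifier g ρ p :=
  mul_nonneg (ρ.nonneg_normed _) (div_nonneg (g.density_pos _).le (g.density_pos _).le)

lemma contDiff_mollifier (g : Metric n) (ρ : ContDiffBump σ) : ContDiff ℝ ∞ (mollifier g ρ) :=
  (ρ.contDiff_normed.comp contDiff_fst).mul
    ((g.contDiff_density.comp (contDiff_const.prodMk contDiff_snd)).div g.contDiff_density
      fun p => (g.density_pos p).ne')

/-- The smooth approximation of `ψ δ(t - σ)`. -/
def mollify (g : Metric n) (ρ : ContDiffBump σ) (ψ : SliceTest n) : Test n :=
  mkTest (fun p => mollifier g ρ p * ψ p.2)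
    ((contDiff_mollifier g ρ).mul (ψ.contDiff.comp contDiff_snd)) <| by
    refine HasCompactSupport.intro ((isCompact_closedBall σ ρ.rOut).prod
      ψ.hasCompactSupport.isCompact) fun p hp => ?_
    rw [Set.mem_prod, not_and_or] at hp
    rcases hp with hp | hp
    · have : ρ.normed volume p.1 = 0 := by
        rw [← Function.notMem_support, ρ.support_normed_eq]
        exact fun h => hp (Metric.ball_subset_closedBall h)
      rw [mollifier, this, zero_mul, zero_mul]
    · rw [image_eq_zero_of_notMem_tsupport hp, mul_zero]

lemma mollify_apply (g : Metric n) (ρ : ContDiffBump σ) (ψ : SliceTest n) (p : Spacetime n) :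
    mollify g ρ ψ p = mollifier g ρ p * ψ p.2 := rfl

/-- The quotient of densities in `mollifier` is there for this identity: it replaces the volume at
time `t` by the volume of the slice `σ`, leaving an exact product measure. -/
lemma withDensity_mollifier (g : Metric n) (ρ : ContDiffBump σ) :
    g.vol.withDensity (fun p => ENNReal.ofReal (mollifier g ρ p)) =
      (timeMeasure ρ).prod (g.sliceVol σ) := by
  have hm : Measurable fun p : Spacetime n => ENNReal.ofReal (mollifier g ρ p) :=
    (contDiff_mollifier g ρ).continuous.measurable.ennreal_ofReal
  rw [timeMeasure, Metric.sliceVol, prod_withDensity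
    ρ.continuous_normed.measurable.ennreal_ofReal
    (g.sliceDensity_continuous σ).measurable.ennreal_ofReal, Metric.vol,
    ← withDensity_mul _ g.continuous_density.measurable.ennreal_ofReal hm]
  refine congrArg _ (funext fun p => ?_)
  rw [Pi.mul_apply, ← ENNReal.ofReal_mul (g.density_pos p).le,
    ← ENNReal.ofReal_mul (ρ.nonneg_normed _), mollifier]
  congr 1
  have := (g.density_pos p).ne'
  field_simp

lemma measurable_mollifier (g : Metric n) (ρ : ContDiffBump σ) :
    Measurable fun p : Spacetime n => ENNReal.ofReal (mollifier g ρ p) :=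
  (contDiff_mollifier g ρ).continuous.measurable.ennreal_ofReal

lemma integral_mollify (ρ : ContDiffBump σ) (ψ : SliceTest n) (φ : Test n) :
    ∫ p, mollify g ρ ψ p * φ p ∂g.vol =
      ∫ t, ∫ x, ψ x * φ (t, x) ∂g.sliceVol σ ∂timeMeasure ρ := by
  have hint : Integrable (fun p : Spacetime n => ψ p.2 * φ p)
      ((timeMeasure ρ).prod (g.sliceVol σ)) :=
    ((ψ.continuous.comp continuous_snd).mul φ.continuous).integrable_of_hasCompactSupport
      φ.hasCompactSupport.mul_left
  rw [← integral_prod (fun p : Spacetime n => ψ p.2 * φ p) hint, ← withDensity_mollifier,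
    integral_withDensity_eq_integral_toReal_smul (measurable_mollifier g ρ)
      (.of_forall fun _ => ENNReal.ofReal_lt_top)]
  refine integral_congr_ae (.of_forall fun p => ?_)
  simp only [ENNReal.toReal_ofReal (mollifier_nonneg g ρ p), mollify_apply, smul_eq_mul, mul_assoc]

/-- The mollified distributions converge to `ψ δ(t - σ)` in the energy space. -/
lemma exists_norm_potential_mollify_sub_le (hm : 0 < m) (i : Fin n) (σ : ℝ) (ψ : SliceTest n) :
    ∃ C : ℝ, 0 ≤ C ∧ ∀ ρ : ContDiffBump σ, ρ.rOut ≤ 1 →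
      ‖potential g hm (mollify g ρ ψ) - slicePotential g hm i σ ψ‖ ^ 2 ≤ ρ.rOut * C := by
  obtain ⟨C, hC, -, h, -⟩ := exists_slice_estimates g hm i σ ψ
  refine ⟨C, hC, fun ρ hρ => norm_le_of_inner_toEnergy (mul_nonneg ρ.rOut_pos.le hC) fun φ => ?_⟩
  have hE := mul_nonneg hC (g.energy_self_nonneg m φ)
  rw [inner_sub_left, inner_potential, inner_slicePotential, integral_mollify]
  set T : ℝ → ℝ := fun t => ∫ x, ψ x * φ (t, x) ∂g.sliceVol σ
  have hint : Integrable (fun p : Spacetime n => ψ p.2 * φ p)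
      ((timeMeasure ρ).prod (g.sliceVol σ)) :=
    ((ψ.continuous.comp continuous_snd).mul φ.continuous).integrable_of_hasCompactSupport
      φ.hasCompactSupport.mul_left
  have hT : Integrable T (timeMeasure ρ) := hint.integral_prod_left
  -- As the time measure is a probability measure, the error is an average of the differences `T t -
  -- T σ`, which the estimate for nearby slices controls.
  have e : (∫ t, T t ∂timeMeasure ρ) - T σ = ∫ t, (T t - T σ) ∂timeMeasure ρ := by
    rw [integral_sub hT (integrable_const _), integral_const]
    simp
  change ((∫ t, T t ∂timeMeasure ρ) - T σ) ^ 2 ≤ _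
  rw [e, mul_assoc]
  have hb : ‖∫ t, (T t - T σ) ∂timeMeasure ρ‖ ≤
      √(ρ.rOut * (C * g.energy m φ φ)) * (timeMeasure ρ).real Set.univ := by
    refine norm_integral_le_of_norm_le_const ?_
    filter_upwards [timeMeasure_ae ρ] with t ht
    refine Real.abs_le_sqrt ((h φ t (ht.trans hρ)).trans ?_)
    exact mul_le_mul_of_nonneg_right ht hE
  rw [probReal_univ, mul_one, Real.norm_eq_abs] at hb
  rw [← sq_abs]
  exact (Real.le_sqrt (abs_nonneg _) (mul_nonneg ρ.rOut_pos.le hE)).1 hb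

/-- A sequence of shrinking bump functions. -/
def shrinkingBump (σ : ℝ) (k : ℕ) : ContDiffBump σ :=
  ⟨1 / ((k : ℝ) + 1) / 2, 1 / ((k : ℝ) + 1), by positivity, half_lt_self (by positivity)⟩

lemma shrinkingBump_rOut_le (σ : ℝ) (k : ℕ) : (shrinkingBump σ k).rOut ≤ 1 := by
  change 1 / ((k : ℝ) + 1) ≤ 1
  rw [div_le_one (by positivity)]
  linarith [(Nat.cast_nonneg k : (0 : ℝ) ≤ k)]

lemma tendsto_potential_mollify (hm : 0 < m) (i : Fin n) (σ : ℝ) (ψ : SliceTest n) :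
    Tendsto (fun k => potential g hm (mollify g (shrinkingBump σ k) ψ)) atTop
      (𝓝 (slicePotential g hm i σ ψ)) := by
  obtain ⟨C, -, h⟩ := exists_norm_potential_mollify_sub_le (g := g) hm i σ ψ
  rw [tendsto_iff_norm_sub_tendsto_zero]
  have hsq : Tendsto (fun k =>
      ‖potential g hm (mollify g (shrinkingBump σ k) ψ) - slicePotential g hm i σ ψ‖ ^ 2)
      atTop (𝓝 0) := by
    refine squeeze_zero (fun _ => sq_nonneg _) (fun k => h _ (shrinkingBump_rOut_le σ k)) ?_
    have := (tendsto_one_div_add_atTop_nhds_zero_nat (𝕜 := ℝ)).mul_const C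
    rwa [zero_mul] at this
  simpa using hsq.sqrt

end Mollify

/-! ### The slice kernel for densities with disjoint supports. -/

section FarApart

variable {g : Metric n} {m σ : ℝ} {E : Spacetime n → Spacetime n → ℝ}

/-- The kernel between functions with disjoint supports is continuous. -/
lemma continuous_mul_kernel_mul {X Y : Type*} [TopologicalSpace X] [TopologicalSpace Y]
    {K : X → X → ℝ} (hK : ContinuousOn (fun z : X × X => K z.1 z.2) {z | z.1 ≠ z.2})
    {π : X → Y} (hπ : Continuous π) {f h : Y → ℝ} (hf : Continuous f) (hh : Continuous h)
    [T2Space X] (hfh : Disjoint (tsupport f) (tsupport h)) :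
    Continuous fun z : X × X => f (π z.1) * K z.1 z.2 * h (π z.2) := by
  rw [continuous_iff_continuousAt]
  intro z
  by_cases hz : z.1 = z.2
  · have : (fun z : X × X => f (π z.1) * K z.1 z.2 * h (π z.2)) =ᶠ[𝓝 z] fun _ => 0 := by
      by_cases hf' : π z.1 ∈ tsupport f
      · have h1 : π z.2 ∈ (tsupport h)ᶜ := hz ▸ Set.disjoint_left.1 hfh hf'
        have h2 : Continuous fun z : X × X => π z.2 := hπ.comp continuous_snd
        filter_upwards [h2.continuousAt.eventually
          ((isClosed_tsupport h).isOpen_compl.mem_nhds h1)] with y hy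
        rw [image_eq_zero_of_notMem_tsupport hy, mul_zero]
      · have h2 : Continuous fun z : X × X => π z.1 := hπ.comp continuous_fst
        filter_upwards [h2.continuousAt.eventually
          ((isClosed_tsupport f).isOpen_compl.mem_nhds hf')] with y hy
        rw [image_eq_zero_of_notMem_tsupport hy, zero_mul, zero_mul]
    exact continuousAt_const.congr this.symm
  · refine ContinuousAt.mul (ContinuousAt.mul ?_
      (hK.continuousAt (isClosed_diagonal.isOpen_compl.mem_nhds hz))) ?_
    · exact (hf.comp (hπ.comp continuous_fst)).continuousAt
    · exact (hh.comp (hπ.comp continuous_snd)).continuousAt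

/-- The restriction of the Green kernel to a slice is continuous away from the diagonal. -/
lemma IsGreenKernel.continuousOn_slice (hE : IsGreenKernel g m E) (σ : ℝ) :
    ContinuousOn (fun z : Slice n × Slice n => E (σ, z.1) (σ, z.2)) {z | z.1 ≠ z.2} := by
  have hc : Continuous fun z : Slice n × Slice n =>
      (((σ, z.1) : Spacetime n), ((σ, z.2) : Spacetime n)) := by fun_prop
  exact hE.continuousOn.comp hc.continuousOn fun z hz h => hz (congrArg Prod.snd h)

/-- The pairing of mollified distributions, as an integral over the product of the mollified slices. -/
lemma IsGreenKernel.integral_mollify_mollify (hm : 0 < m) (hE : IsGreenKernel g m E)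
    (ρ : ContDiffBump σ) (ψ χ : SliceTest n) :
    Integrable (fun z : Spacetime n × Spacetime n => ψ z.1.2 * E z.1 z.2 * χ z.2.2)
      (((timeMeasure ρ).prod (g.sliceVol σ)).prod ((timeMeasure ρ).prod (g.sliceVol σ))) ∧
    ∫ z : Spacetime n × Spacetime n, ψ z.1.2 * E z.1 z.2 * χ z.2.2
      ∂((timeMeasure ρ).prod (g.sliceVol σ)).prod ((timeMeasure ρ).prod (g.sliceVol σ)) =
      inner ℝ (potential g hm (mollify g ρ ψ)) (potential g hm (mollify g ρ χ)) := by
  have hr := measurable_mollifier g ρ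
  have hrr : Measurable fun z : Spacetime n × Spacetime n =>
      ENNReal.ofReal (mollifier g ρ z.1) * ENNReal.ofReal (mollifier g ρ z.2) :=
    (hr.comp measurable_fst).mul (hr.comp measurable_snd)
  have hlt : ∀ᵐ z : Spacetime n × Spacetime n ∂g.vol.prod g.vol,
      ENNReal.ofReal (mollifier g ρ z.1) * ENNReal.ofReal (mollifier g ρ z.2) < ⊤ :=
    .of_forall fun z => ENNReal.mul_lt_top ENNReal.ofReal_lt_top ENNReal.ofReal_lt_top
  have e : ∀ z : Spacetime n × Spacetime n,
      (ENNReal.ofReal (mollifier g ρ z.1) * ENNReal.ofReal (mollifier g ρ z.2)).toReal •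
        (ψ z.1.2 * E z.1 z.2 * χ z.2.2) = mollify g ρ ψ z.1 * E z.1 z.2 * mollify g ρ χ z.2 :=
    fun z => by
      rw [ENNReal.toReal_mul, ENNReal.toReal_ofReal (mollifier_nonneg g ρ _),
        ENNReal.toReal_ofReal (mollifier_nonneg g ρ _), mollify_apply, mollify_apply, smul_eq_mul]
      ring
  rw [← withDensity_mollifier, prod_withDensity hr hr,
    integrable_withDensity_iff_integrable_smul' hrr hlt,
    integral_withDensity_eq_integral_toReal_smul hrr hlt]
  simp only [e]
  exact ⟨hE.integrable_mul_mul hm _ _, hE.integral_mul_mul hm _ _⟩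

/-- For densities with disjoint supports, the inner product is given by the restricted kernel. -/
lemma IsGreenKernel.slice_of_disjoint (hm : 0 < m) (hE : IsGreenKernel g m E) (i : Fin n) (σ : ℝ)
    {ψ χ : SliceTest n} (hd : Disjoint (tsupport ψ) (tsupport χ)) :
    Integrable (fun z : Slice n × Slice n => ψ z.1 * E (σ, z.1) (σ, z.2) * χ z.2)
      ((g.sliceVol σ).prod (g.sliceVol σ)) ∧
    ∫ z : Slice n × Slice n, ψ z.1 * E (σ, z.1) (σ, z.2) * χ z.2
      ∂(g.sliceVol σ).prod (g.sliceVol σ) =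
      inner ℝ (slicePotential g hm i σ ψ) (slicePotential g hm i σ χ) := by
  set μ := g.sliceVol σ
  set G : Spacetime n × Spacetime n → ℝ := fun z => ψ z.1.2 * E z.1 z.2 * χ z.2.2 with hG
  set γ : Slice n × Slice n → ℝ := fun z => ψ z.1 * E (σ, z.1) (σ, z.2) * χ z.2 with hγ
  -- The supports are disjoint in the space variables, so the singularity of `E` is avoided for all
  -- values of the two times.
  have hGc : Continuous G := continuous_mul_kernel_mul hE.continuousOn continuous_snd
    ψ.continuous χ.continuous hd
  have hγc : Continuous γ := hGc.comp
    (g := G) (f := fun z : Slice n × Slice n => (((σ, z.1) : Spacetime n), ((σ, z.2) : Spacetime n)))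
    (by fun_prop)
  set K₁ := tsupport ψ
  set K₂ := tsupport χ
  have hK₁ : IsCompact K₁ := ψ.hasCompactSupport.isCompact
  have hK₂ : IsCompact K₂ := χ.hasCompactSupport.isCompact
  have hγs : HasCompactSupport γ := HasCompactSupport.intro (hK₁.prod hK₂) fun z hz => by
    rw [Set.mem_prod, not_and_or] at hz
    rcases hz with hz | hz
    · simp [hγ, image_eq_zero_of_notMem_tsupport hz]
    · simp [hγ, image_eq_zero_of_notMem_tsupport hz]
  have hγi : Integrable γ (μ.prod μ) := hγc.integrable_of_hasCompactSupport hγs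
  refine ⟨hγi, ?_⟩
  -- uniform continuity in the time variables
  have hunif : ∀ ε > 0, ∃ δ > 0, ∀ t s x y, |t - σ| ≤ δ → |s - σ| ≤ δ → x ∈ K₁ → y ∈ K₂ →
      |G ((t, x), (s, y)) - γ (x, y)| ≤ ε := fun ε hε => by
    have hI : IsCompact (Metric.closedBall σ 1 : Set ℝ) := isCompact_closedBall _ _
    have hS := (hI.prod hK₁).prod (hI.prod hK₂)
    have := hS.uniformContinuousOn_of_continuous hGc.continuousOn
    rw [Metric.uniformContinuousOn_iff] at this
    obtain ⟨δ, hδ, h⟩ := this ε hε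
    refine ⟨min (δ / 2) 1, by positivity, fun t s x y ht hs hx hy => ?_⟩
    have hσ : σ ∈ (Metric.closedBall σ 1 : Set ℝ) := Metric.mem_closedBall_self zero_le_one
    have ht' := ht.trans (min_le_left _ _)
    have hs' := hs.trans (min_le_left _ _)
    refine (h ((t, x), (s, y)) ⟨⟨?_, hx⟩, ⟨?_, hy⟩⟩ ((σ, x), (σ, y)) ⟨⟨hσ, hx⟩, ⟨hσ, hy⟩⟩ ?_).le
    · exact ht.trans (min_le_right _ _)
    · exact hs.trans (min_le_right _ _)
    · simp only [Prod.dist_eq, dist_self, Real.dist_eq]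
      simp only [max_lt_iff]
      exact ⟨⟨by linarith, hδ⟩, ⟨by linarith, hδ⟩⟩
  have hlim : Tendsto (fun k => inner ℝ (potential g hm (mollify g (shrinkingBump σ k) ψ))
      (potential g hm (mollify g (shrinkingBump σ k) χ))) atTop (𝓝 (∫ z, γ z ∂μ.prod μ)) := by
    -- Forgetting the times preserves the measures. The limiting integral of `γ` can therefore be
    -- written over the same space as the mollified one, and the integrands compared pointwise.
    have hfin : ∀ ρ : ContDiffBump σ, MeasurePreserving
        (Prod.map Prod.snd Prod.snd : Spacetime n × Spacetime n → Slice n × Slice n)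
        (((timeMeasure ρ).prod μ).prod ((timeMeasure ρ).prod μ)) (μ.prod μ) := fun ρ =>
      measurePreserving_snd.prod measurePreserving_snd
    set M := (μ.prod μ).real (K₁ ×ˢ K₂) with hM
    rw [Metric.tendsto_atTop]
    intro ε hε
    -- The integrands differ only over `K₁ ×ˢ K₂`, of measure `M`; dividing by `M + 1` makes the
    -- total error less than `ε` even when `M = 0`.
    obtain ⟨δ, hδ, hδG⟩ := hunif (ε / (M + 1)) (by positivity)
    obtain ⟨k₀, hk₀⟩ := exists_nat_one_div_lt hδ
    refine ⟨k₀, fun k hk => ?_⟩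
    set ρ := shrinkingBump σ k
    have hρ : ρ.rOut ≤ δ := by
      refine le_trans ?_ hk₀.le
      change 1 / ((k : ℝ) + 1) ≤ 1 / ((k₀ : ℝ) + 1)
      gcongr
    set ν := (timeMeasure ρ).prod μ
    obtain ⟨i1, i2⟩ := hE.integral_mollify_mollify hm ρ ψ χ
    have i3 : Integrable (fun z : Spacetime n × Spacetime n => γ (z.1.2, z.2.2)) (ν.prod ν) :=
      (hfin ρ).integrable_comp_of_integrable hγi
    have i4 : ∫ z : Spacetime n × Spacetime n, γ (z.1.2, z.2.2) ∂ν.prod ν =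
        ∫ z, γ z ∂μ.prod μ := by
      rw [← (hfin ρ).map_eq, integral_map (hfin ρ).measurable.aemeasurable
        hγc.aestronglyMeasurable]
      rfl
    rw [← i2, ← i4, Real.dist_eq, ← integral_sub i1 i3]
    have hmK : MeasurableSet (K₁ ×ˢ K₂) :=
      (isClosed_tsupport _).measurableSet.prod (isClosed_tsupport _).measurableSet
    have hfinK : (μ.prod μ) (K₁ ×ˢ K₂) ≠ ⊤ := (hK₁.prod hK₂).measure_lt_top.ne
    have i5 : Integrable (fun z : Spacetime n × Spacetime n =>
        (K₁ ×ˢ K₂).indicator (fun _ => ε / (M + 1)) (z.1.2, z.2.2)) (ν.prod ν) :=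
      (hfin ρ).integrable_comp_of_integrable
        ((integrable_indicator_iff hmK).2 (integrableOn_const hfinK))
    have ht : ∀ᵐ p ∂ν, |p.1 - σ| ≤ ρ.rOut :=
      Measure.quasiMeasurePreserving_fst.ae (timeMeasure_ae ρ)
    have ht1 : ∀ᵐ z : Spacetime n × Spacetime n ∂ν.prod ν, |z.1.1 - σ| ≤ ρ.rOut :=
      Measure.quasiMeasurePreserving_fst.ae ht
    have ht2 : ∀ᵐ z : Spacetime n × Spacetime n ∂ν.prod ν, |z.2.1 - σ| ≤ ρ.rOut :=
      Measure.quasiMeasurePreserving_snd.ae ht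
    have hbound := norm_integral_le_of_norm_le i5 (f := fun z => G z - γ (z.1.2, z.2.2)) (by
      filter_upwards [ht1, ht2] with z h1 h2
      by_cases hz : (z.1.2, z.2.2) ∈ K₁ ×ˢ K₂
      · rw [Set.indicator_of_mem hz]
        exact hδG z.1.1 z.2.1 z.1.2 z.2.2 (h1.trans hρ) (h2.trans hρ) hz.1 hz.2
      · rw [Set.indicator_of_notMem hz]
        rw [Set.mem_prod, not_and_or] at hz
        rcases hz with hz | hz
        · simp [hG, hγ, image_eq_zero_of_notMem_tsupport hz]
        · simp [hG, hγ, image_eq_zero_of_notMem_tsupport hz])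
    refine hbound.trans_lt ?_
    have i6 : ∫ z : Spacetime n × Spacetime n,
        (K₁ ×ˢ K₂).indicator (fun _ => ε / (M + 1)) (z.1.2, z.2.2) ∂ν.prod ν =
        M * (ε / (M + 1)) := by
      have e : M * (ε / (M + 1)) =
          ∫ z, (K₁ ×ˢ K₂).indicator (fun _ => ε / (M + 1)) z ∂μ.prod μ := by
        rw [integral_indicator_const _ hmK, smul_eq_mul]
      rw [e, ← (hfin ρ).map_eq, integral_map (hfin ρ).measurable.aemeasurable
          (measurable_const.indicator hmK).aestronglyMeasurable]
      rfl
    rw [i6]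
    have hM0 : 0 ≤ M := measureReal_nonneg
    rw [mul_div_assoc', div_lt_iff₀ (by positivity)]
    nlinarith
  exact tendsto_nhds_unique hlim ((tendsto_potential_mollify hm i σ ψ).inner (𝕜 := ℝ)
    (tendsto_potential_mollify hm i σ χ))

end FarApart

/-! ### A one-dimensional partition of unity. -/

section Teeth

/-- A smooth bump on `[0, 2]` whose integer translates form a partition of unity. -/
def tooth (x : ℝ) : ℝ := Real.smoothTransition x - Real.smoothTransition (x - 1)

lemma contDiff_tooth : ContDiff ℝ ∞ tooth :=
  Real.smoothTransition.contDiff.sub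
    (Real.smoothTransition.contDiff.comp (contDiff_id.sub contDiff_const))

lemma tooth_nonneg (x : ℝ) : 0 ≤ tooth x :=
  sub_nonneg.2 (Real.smoothTransition.monotone (by linarith))

lemma tooth_le_one (x : ℝ) : tooth x ≤ 1 := by
  have h1 := Real.smoothTransition.le_one x
  have h2 := Real.smoothTransition.nonneg (x - 1)
  rw [tooth]
  linarith

lemma tooth_of_nonpos {x : ℝ} (hx : x ≤ 0) : tooth x = 0 := by
  rw [tooth, Real.smoothTransition.zero_of_nonpos hx,
    Real.smoothTransition.zero_of_nonpos (by linarith), sub_zero]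

lemma tooth_of_two_le {x : ℝ} (hx : 2 ≤ x) : tooth x = 0 := by
  rw [tooth, Real.smoothTransition.one_of_one_le (by linarith),
    Real.smoothTransition.one_of_one_le (by linarith), sub_self]

lemma mem_of_tooth_ne_zero {x : ℝ} (hx : tooth x ≠ 0) : 0 < x ∧ x < 2 :=
  ⟨not_le.1 fun h => hx (tooth_of_nonpos h), not_le.1 fun h => hx (tooth_of_two_le h)⟩

/-- Each tooth is a difference of consecutive shifts of one function, so the sum telescopes. -/
lemma sum_tooth (y : ℝ) (K : ℕ) : ∑ k ∈ Finset.range K, tooth (y - k) =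
    Real.smoothTransition y - Real.smoothTransition (y - K) := by
  have := Finset.sum_range_sub' (fun k : ℕ => Real.smoothTransition (y - k)) K
  simp only [Nat.cast_zero, sub_zero, Nat.cast_succ] at this
  rw [← this]
  exact Finset.sum_congr rfl fun k _ => by rw [tooth, sub_sub]

lemma sum_tooth_le_one (y : ℝ) (K : ℕ) : ∑ k ∈ Finset.range K, tooth (y - k) ≤ 1 := by
  rw [sum_tooth]
  have h1 := Real.smoothTransition.le_one y
  have h2 := Real.smoothTransition.nonneg (y - K)
  linarith

lemma sum_tooth_eq_one {y : ℝ} {K : ℕ} (h1 : 1 ≤ y) (h2 : y ≤ K) :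
    ∑ k ∈ Finset.range K, tooth (y - k) = 1 := by
  rw [sum_tooth, Real.smoothTransition.one_of_one_le h1,
    Real.smoothTransition.zero_of_nonpos (by linarith), sub_zero]

lemma exists_primitive_tooth : ∃ (η : ℝ → ℝ) (B : ℝ), (∀ x, HasDerivAt η (tooth x) x) ∧
    ∀ x, |η x| ≤ B := by
  have hc : Continuous tooth := contDiff_tooth.continuous
  have hs : HasCompactSupport tooth := HasCompactSupport.intro (isCompact_Icc (a := (0 : ℝ)) (b := 2))
    fun x hx => by
      by_contra h
      exact hx ⟨(mem_of_tooth_ne_zero h).1.le, (mem_of_tooth_ne_zero h).2.le⟩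
  have hi : Integrable tooth := hc.integrable_of_hasCompactSupport hs
  refine ⟨fun x => ∫ t in (0 : ℝ)..x, tooth t, ∫ t, ‖tooth t‖, fun x =>
    intervalIntegral.integral_hasDerivAt_right (hc.intervalIntegrable _ _)
      hc.stronglyMeasurable.stronglyMeasurableAtFilter hc.continuousAt, fun x => ?_⟩
  refine (intervalIntegral.norm_integral_le_integral_norm_uIoc (f := tooth)).trans ?_
  exact setIntegral_le_integral hi.norm (.of_forall fun _ => norm_nonneg _)

end Teeth

/-! ### Thin slabs: smallness of near-diagonal contributions. -/

section Slabs

variable {g : Metric n} {m : ℝ}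

/-- The function `ψ` multiplied by a weight which depends on one coordinate. -/
def slab (i : Fin n) (a c : ℝ) (ψ : SliceTest n) : SliceTest n :=
  mkTest (fun x => tooth (a * x i + c) * ψ x)
    ((contDiff_tooth.comp ((contDiff_const.mul (contDiff_apply ℝ ℝ i)).add contDiff_const)).mul
      ψ.contDiff) ψ.hasCompactSupport.mul_left

lemma slab_apply (i : Fin n) (a c : ℝ) (ψ : SliceTest n) (x : Slice n) :
    slab i a c ψ x = tooth (a * x i + c) * ψ x := rfl

lemma tsupport_slab_subset (i : Fin n) (a c : ℝ) (ψ : SliceTest n) :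
    tsupport (slab i a c ψ) ⊆ {x | 0 ≤ a * x i + c ∧ a * x i + c ≤ 2} := by
  have hf : Continuous fun x : Slice n => a * x i + c := by fun_prop
  refine closure_minimal (fun x hx => ?_)
    ((isClosed_le continuous_const hf).inter (isClosed_le hf continuous_const))
  have := mem_of_tooth_ne_zero (left_ne_zero_of_mul hx)
  exact ⟨this.1.le, this.2.le⟩

lemma slicePotential_sum (hm : 0 < m) (i : Fin n) (σ : ℝ) {ψ : SliceTest n} {ι : Type*}
    (s : Finset ι) (f : ι → SliceTest n) (h : ∀ x, ∑ k ∈ s, f k x = ψ x) :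
    ∑ k ∈ s, slicePotential g hm i σ (f k) = slicePotential g hm i σ ψ := by
  refine FieldSpace.energySpace_ext fun φ => ?_
  rw [sum_inner]
  simp only [inner_slicePotential]
  rw [← integral_finsetSum _ fun k _ => integrable_slice g σ (f k) φ σ]
  exact integral_congr_ae (.of_forall fun x => by simp only [← h x, Finset.sum_mul])

lemma integrable_weight_mul_sq (g : Metric n) (i : Fin n) (σ : ℝ) (ψ : SliceTest n) {b : ℝ → ℝ}
    (hb : Continuous b) : Integrable fun x : Slice n => b (x i) * (g.density (σ, x) * ψ x) ^ 2 := by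
  have h : Continuous fun x : Slice n => b (x i) * (g.density (σ, x) * ψ x) ^ 2 :=
    (hb.comp (continuous_apply i)).mul
      (((g.sliceDensity_continuous σ).mul ψ.continuous).pow 2)
  refine h.integrable_of_hasCompactSupport
    (HasCompactSupport.intro ψ.hasCompactSupport.isCompact fun x hx => ?_)
  simp [image_eq_zero_of_notMem_tsupport hx]

/-- The sum of the squares of the norms of thin slabs is small. -/
lemma exists_sum_norm_slab_le (hm : 0 < m) (i : Fin n) (σ : ℝ) (ψ : SliceTest n) :
    ∃ D : ℝ, ∀ (a : ℝ), 0 < a → ∀ (c : ℝ) (K : ℕ), ∑ k ∈ Finset.range K,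
      ‖slicePotential g hm i σ (slab i a (c - k) ψ)‖ ^ 2 ≤ D * √(1 / a) := by
  obtain ⟨C, hC, -, -, h⟩ := exists_slice_estimates g hm i σ ψ
  obtain ⟨η, B, hη, hB⟩ := exists_primitive_tooth
  have hB0 : 0 ≤ B := (abs_nonneg _).trans (hB 0)
  refine ⟨sliceMass g σ ψ * √B * C, fun a ha c K => ?_⟩
  let b : ℕ → ℝ → ℝ := fun k s => tooth (a * s + (c - k))
  have hb : ∀ k, Continuous (b k) := fun k => contDiff_tooth.continuous.comp (by fun_prop)
  have h1 : ∀ k : ℕ, ‖slicePotential g hm i σ (slab i a (c - k) ψ)‖ ^ 2 ≤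
      (∫ x, b k (x i) * (g.density (σ, x) * ψ x) ^ 2) * (√(B / a) * C) := fun k => by
    have hI : 0 ≤ ∫ x : Slice n, b k (x i) * (g.density (σ, x) * ψ x) ^ 2 :=
      integral_nonneg fun x => mul_nonneg (tooth_nonneg _) (sq_nonneg _)
    refine norm_le_of_inner_toEnergy (by positivity) fun φ => ?_
    rw [inner_slicePotential]
    -- Rescaling by `a` divides the primitive of the tooth by `a`, so `κ = B / a`. Summation over
    -- `k` costs nothing, because the teeth add up to at most `1`.
    have := h (b k) (fun s => η (a * s + (c - k)) / a) (B / a) (fun s => ?_) (hb k)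
      (fun s => tooth_nonneg _) (fun s => tooth_le_one _) (fun s => ?_) φ
    · simp only [slab_apply, mul_assoc] at this ⊢
      exact this
    · have h2 : HasDerivAt (fun s : ℝ => a * s + (c - k)) a s := by
        simpa using ((hasDerivAt_id s).const_mul a).add_const (c - (k : ℝ))
      have h3 := ((hη (a * s + (c - k))).comp s h2).div_const a
      rwa [mul_div_cancel_right₀ _ ha.ne'] at h3
    · rw [abs_div, abs_of_pos ha]
      gcongr
      exact hB _
  calc _ ≤ ∑ k ∈ Finset.range K,
        (∫ x, b k (x i) * (g.density (σ, x) * ψ x) ^ 2) * (√(B / a) * C) :=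
        Finset.sum_le_sum fun k _ => h1 k
    _ = (∫ x, ∑ k ∈ Finset.range K, b k (x i) * (g.density (σ, x) * ψ x) ^ 2) *
        (√(B / a) * C) := by
        rw [← Finset.sum_mul,
          integral_finsetSum _ fun k _ => integrable_weight_mul_sq g i σ ψ (hb k)]
    _ ≤ sliceMass g σ ψ * (√(B / a) * C) := by
        refine mul_le_mul_of_nonneg_right (integral_mono
          (integrable_finsetSum _ fun k _ => integrable_weight_mul_sq g i σ ψ (hb k)) ?_
          fun x => ?_) (by positivity)
        · simpa using integrable_weight_mul_sq g i σ ψ (continuous_const (y := (1 : ℝ)))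
        · simp only [← Finset.sum_mul]
          refine mul_le_of_le_one_left (sq_nonneg _) ?_
          have := sum_tooth_le_one (a * x i + c) K
          simpa only [b, add_sub_assoc] using this
    _ = _ := by
        rw [div_eq_mul_one_div B, Real.sqrt_mul hB0]
        ring

/-- The indices of slabs which are neither equal nor neighbours. -/
def farPairs (K : ℕ) : Finset (ℕ × ℕ) :=
  (Finset.range K ×ˢ Finset.range K).filter fun z => z.1 + 2 < z.2 ∨ z.2 + 2 < z.1

/-- The indices of slabs which are equal or neighbours. -/
def nearPairs (K : ℕ) : Finset (ℕ × ℕ) :=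
  (Finset.range K ×ˢ Finset.range K).filter fun z => ¬(z.1 + 2 < z.2 ∨ z.2 + 2 < z.1)

lemma sum_farPairs_add_sum_nearPairs {M : Type*} [AddCommMonoid M] (K : ℕ) (f : ℕ → ℕ → M) :
    ∑ z ∈ farPairs K, f z.1 z.2 + ∑ z ∈ nearPairs K, f z.1 z.2 =
      ∑ k ∈ Finset.range K, ∑ l ∈ Finset.range K, f k l := by
  rw [farPairs, nearPairs, Finset.sum_filter_add_sum_filter_not, Finset.sum_product]

/-- For a given `k`, at most the five indices from `k - 2` to `k + 2` are close. -/
lemma sum_nearPairs_fst_le (K : ℕ) {u : ℕ → ℝ} (hu : ∀ k, 0 ≤ u k) :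
    ∑ z ∈ nearPairs K, u z.1 ≤ 5 * ∑ k ∈ Finset.range K, u k := by
  rw [nearPairs, Finset.sum_filter, Finset.sum_product, Finset.mul_sum]
  refine Finset.sum_le_sum fun k _ => ?_
  rw [← Finset.sum_filter]
  dsimp only
  rw [Finset.sum_const, nsmul_eq_mul]
  refine mul_le_mul_of_nonneg_right ?_ (hu k)
  have h : ((Finset.range K).filter fun l => ¬(k + 2 < l ∨ l + 2 < k)) ⊆
      Finset.Icc (k - 2) (k + 2) := fun l hl => by
    rw [Finset.mem_filter] at hl
    rw [Finset.mem_Icc]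
    omega
  have := Finset.card_le_card h
  rw [Nat.card_Icc] at this
  exact_mod_cast (by omega : _ ≤ 5)

lemma sum_nearPairs_snd_le (K : ℕ) {u : ℕ → ℝ} (hu : ∀ k, 0 ≤ u k) :
    ∑ z ∈ nearPairs K, u z.2 ≤ 5 * ∑ k ∈ Finset.range K, u k := by
  refine le_trans (le_of_eq ?_) (sum_nearPairs_fst_le K hu)
  refine Finset.sum_nbij' Prod.swap Prod.swap ?_ ?_ (fun _ _ => rfl) (fun _ _ => rfl)
    (fun _ _ => rfl) <;>
  · intro z hz
    simp only [nearPairs, Finset.mem_filter, Finset.mem_product, Prod.fst_swap,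
      Prod.snd_swap] at hz ⊢
    exact ⟨hz.1.symm, fun h => hz.2 h.symm⟩

lemma abs_sum_nearPairs_inner_le {H : Type*} [NormedAddCommGroup H] [InnerProductSpace ℝ H]
    (K : ℕ) (u v : ℕ → H) : |∑ z ∈ nearPairs K, inner ℝ (u z.1) (v z.2)| ≤
      5 / 2 * (∑ k ∈ Finset.range K, ‖u k‖ ^ 2 + ∑ k ∈ Finset.range K, ‖v k‖ ^ 2) := by
  calc _ ≤ ∑ z ∈ nearPairs K, (‖u z.1‖ ^ 2 + ‖v z.2‖ ^ 2) / 2 := by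
        refine (Finset.abs_sum_le_sum_abs _ _).trans (Finset.sum_le_sum fun z _ => ?_)
        have h1 := abs_real_inner_le_norm (u z.1) (v z.2)
        nlinarith [sq_nonneg (‖u z.1‖ - ‖v z.2‖)]
    _ = ((∑ z ∈ nearPairs K, ‖u z.1‖ ^ 2) + ∑ z ∈ nearPairs K, ‖v z.2‖ ^ 2) / 2 := by
        rw [← Finset.sum_div, Finset.sum_add_distrib]
    _ ≤ _ := by
        have h1 := sum_nearPairs_fst_le K (u := fun k => ‖u k‖ ^ 2) fun _ => sq_nonneg _
        have h2 := sum_nearPairs_snd_le K (u := fun k => ‖v k‖ ^ 2) fun _ => sq_nonneg _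
        linarith

end Slabs

/-! ### The kernel formula on a slice. -/

/-- An increasing approximation with convergent integrals. -/
lemma integral_eq_of_tendsto_of_le {X : Type*} [MeasurableSpace X] {μ : Measure X} {h : X → ℝ}
    {f : ℕ → X → ℝ} {L : ℝ} (hh : AEStronglyMeasurable h μ) (hf : ∀ k, Integrable (f k) μ)
    (h0 : ∀ k, ∀ᵐ x ∂μ, 0 ≤ f k x) (hle : ∀ k, ∀ᵐ x ∂μ, f k x ≤ h x)
    (hlim : ∀ᵐ x ∂μ, Tendsto (fun k => f k x) atTop (𝓝 (h x)))
    (hL : Tendsto (fun k => ∫ x, f k x ∂μ) atTop (𝓝 L)) :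
    Integrable h μ ∧ ∫ x, h x ∂μ = L := by
  have hh0 : 0 ≤ᵐ[μ] h := by
    filter_upwards [h0 0, hle 0] with x h1 h2 using h1.trans h2
  have hi : Integrable h μ := by
    -- Fatou's lemma gives integrability of `h`, which then serves as its own dominating function.
    refine ⟨hh, (hasFiniteIntegral_iff_ofReal hh0).2 ?_⟩
    have e : ∫⁻ x, ENNReal.ofReal (h x) ∂μ =
        ∫⁻ x, liminf (fun k => ENNReal.ofReal (f k x)) atTop ∂μ := by
      refine lintegral_congr_ae ?_
      filter_upwards [hlim] with x hx
      exact ((ENNReal.continuous_ofReal.tendsto _).comp hx).liminf_eq.symm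
    rw [e]
    refine (lintegral_liminf_le' fun k => (hf k).aemeasurable.ennreal_ofReal).trans_lt ?_
    simp only [fun k => (ofReal_integral_eq_lintegral_ofReal (hf k) (h0 k)).symm]
    exact ((ENNReal.continuous_ofReal.tendsto _).comp hL).liminf_eq.trans_lt ENNReal.ofReal_lt_top
  refine ⟨hi, tendsto_nhds_unique (tendsto_integral_of_dominated_convergence h
    (fun k => (hf k).aestronglyMeasurable) hi (fun k => ?_) hlim) hL⟩
  filter_upwards [h0 k, hle k] with x h1 h2
  rwa [Real.norm_of_nonneg h1]

section SliceKernel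

variable {g : Metric n} {m : ℝ} {E : Spacetime n → Spacetime n → ℝ}

lemma Metric.ae_sliceVol_ne (g : Metric n) (σ : ℝ) (i : Fin n) (s : ℝ) :
    ∀ᵐ x ∂g.sliceVol σ, x i ≠ s :=
  (withDensity_absolutelyContinuous _ _).ae_le (Measure.ae_eval_ne (fun _ : Fin n => (volume : Measure ℝ)) i s)

lemma Metric.ae_prod_sliceVol_ne (g : Metric n) (σ : ℝ) (i : Fin n) :
    ∀ᵐ z : Slice n × Slice n ∂(g.sliceVol σ).prod (g.sliceVol σ), z.1 i ≠ z.2 i := by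
  have hm : MeasurableSet {z : Slice n × Slice n | z.1 i ≠ z.2 i} :=
    (isClosed_eq (by fun_prop) (by fun_prop)).isOpen_compl.measurableSet
  refine (Measure.ae_prod_iff_ae_ae hm).2 (.of_forall fun x => ?_)
  filter_upwards [g.ae_sliceVol_ne σ i (x i)] with y hy using hy.symm

/-- An enumeration of the slabs of width `2 / (k + 1)` which meet `[-R, R]`. -/
def slabs (i : Fin n) (R k : ℕ) (ψ : SliceTest n) (l : ℕ) : SliceTest n :=
  slab i ((k : ℝ) + 1) (((k : ℝ) + 1) * R + 1 - l) ψ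

lemma slabs_ne_zero {i : Fin n} {R k l : ℕ} {ψ : SliceTest n} {x : Slice n}
    (h : slabs i R k ψ l x ≠ 0) : (l : ℝ) < (k + 1) * x i + ((k + 1) * R + 1) ∧
      (k + 1) * x i + ((k + 1) * R + 1) < l + 2 := by
  have := mem_of_tooth_ne_zero (left_ne_zero_of_mul h)
  constructor <;> linarith

lemma slabs_nonneg {i : Fin n} {R k l : ℕ} {ψ : SliceTest n} (h : ∀ x, 0 ≤ ψ x) (x : Slice n) :
    0 ≤ slabs i R k ψ l x := mul_nonneg (tooth_nonneg _) (h x)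

/-- For `|x i| ≤ R` the argument of the teeth lies between `1` and `2 (k + 1) R + 1`, inside the
range where the integer translates sum to `1`. -/
lemma sum_slabs {i : Fin n} {R : ℕ} {ψ : SliceTest n} (hR : ∀ x, ψ x ≠ 0 → |x i| ≤ R) (k : ℕ)
    (x : Slice n) : ∑ l ∈ Finset.range (2 * (k + 1) * R + 2), slabs i R k ψ l x = ψ x := by
  simp only [slabs, slab_apply, ← Finset.sum_mul]
  by_cases hx : ψ x = 0
  · rw [hx, mul_zero]
  · have h := abs_le.1 (hR x hx)
    have hk : (0 : ℝ) < (k : ℝ) + 1 := by positivity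
    have := sum_tooth_eq_one (y := ((k : ℝ) + 1) * x i + (((k : ℝ) + 1) * R + 1))
      (K := 2 * (k + 1) * R + 2) (by nlinarith) (by push_cast; nlinarith)
    simp only [← add_sub_assoc] at this ⊢
    rw [this, one_mul]

/-- Slab `l` has shifted coordinate in the closed interval `[l, l + 2]`, so a gap greater than `2`
is needed for disjointness of the closed supports. -/
lemma disjoint_tsupport_slabs {i : Fin n} {R k l l' : ℕ} (ψ χ : SliceTest n)
    (h : l + 2 < l' ∨ l' + 2 < l) :
    Disjoint (tsupport (slabs i R k ψ l)) (tsupport (slabs i R k χ l')) := by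
  refine Set.disjoint_left.2 fun x hx hy => ?_
  obtain ⟨h1, h2⟩ := tsupport_slab_subset _ _ _ _ hx
  obtain ⟨h3, h4⟩ := tsupport_slab_subset _ _ _ _ hy
  rcases h with h | h
  · have : (l : ℝ) + 2 < l' := by exact_mod_cast h
    linarith
  · have : (l' : ℝ) + 2 < l := by exact_mod_cast h
    linarith

/-- The full double sum is the inner product for every `k`; the near pairs are at most `5 / 2` times
the two sums of squared norms, hence of order `√(1 / (k + 1))`. -/
lemma tendsto_sum_farPairs_inner (hm : 0 < m) (i : Fin n) (σ : ℝ) {R : ℕ} {ψ χ : SliceTest n}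
    (hψ : ∀ x, ψ x ≠ 0 → |x i| ≤ R) (hχ : ∀ x, χ x ≠ 0 → |x i| ≤ R) :
    Tendsto (fun k => ∑ z ∈ farPairs (2 * (k + 1) * R + 2),
      inner ℝ (slicePotential g hm i σ (slabs i R k ψ z.1))
        (slicePotential g hm i σ (slabs i R k χ z.2))) atTop
      (𝓝 (inner ℝ (slicePotential g hm i σ ψ) (slicePotential g hm i σ χ))) := by
  obtain ⟨D, hD⟩ := exists_sum_norm_slab_le (g := g) hm i σ ψ
  obtain ⟨D', hD'⟩ := exists_sum_norm_slab_le (g := g) hm i σ χ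
  have hs : Tendsto (fun k : ℕ => √(1 / ((k : ℝ) + 1))) atTop (𝓝 0) := by
    simpa using (tendsto_one_div_add_atTop_nhds_zero_nat (𝕜 := ℝ)).sqrt
  rw [tendsto_iff_dist_tendsto_zero]
  refine squeeze_zero (fun _ => dist_nonneg) (fun k => ?_)
    (by simpa only [mul_zero] using hs.const_mul (5 / 2 * (D + D')))
  have hk : (0 : ℝ) < (k : ℝ) + 1 := by positivity
  have h1 := sum_farPairs_add_sum_nearPairs (2 * (k + 1) * R + 2) fun l l' =>
    inner ℝ (slicePotential g hm i σ (slabs i R k ψ l)) (slicePotential g hm i σ (slabs i R k χ l'))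
  simp only [← inner_sum, ← sum_inner] at h1
  rw [slicePotential_sum hm i σ _ _ (sum_slabs hψ k), slicePotential_sum hm i σ _ _ (sum_slabs hχ k)]
    at h1
  rw [← h1, dist_self_add_right, Real.norm_eq_abs]
  refine (abs_sum_nearPairs_inner_le _ (fun l => slicePotential g hm i σ (slabs i R k ψ l))
    fun l => slicePotential g hm i σ (slabs i R k χ l)).trans ?_
  have h2 := hD _ hk (((k : ℝ) + 1) * R + 1) (2 * (k + 1) * R + 2)
  have h3 := hD' _ hk (((k : ℝ) + 1) * R + 1) (2 * (k + 1) * R + 2)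
  simp only [slabs]
  linarith

lemma exists_coord_bound (i : Fin n) (ψ : SliceTest n) :
    ∃ R : ℕ, ∀ x, ψ x ≠ 0 → |x i| ≤ R := by
  obtain ⟨r, hr⟩ := ψ.hasCompactSupport.isCompact.isBounded.subset_closedBall (0 : Slice n)
  refine ⟨⌈r⌉₊, fun x hx => ?_⟩
  have := hr (subset_tsupport _ hx)
  rw [mem_closedBall_zero_iff] at this
  exact (norm_le_pi_norm x i).trans (this.trans (Nat.le_ceil r))

namespace IsGreenKernel

lemma aestronglyMeasurable_slice (hE : IsGreenKernel g m E) (i : Fin n) (σ : ℝ) (ψ χ : SliceTest n) :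
    AEStronglyMeasurable (fun z : Slice n × Slice n => ψ z.1 * E (σ, z.1) (σ, z.2) * χ z.2)
      ((g.sliceVol σ).prod (g.sliceVol σ)) := by
  have : NullSingletonClass (g.sliceVol σ) := ⟨fun x => by
    refine measure_mono_null (fun y hy => ?_) (ae_iff.1 (g.ae_sliceVol_ne σ i (x i)))
    obtain rfl : y = x := hy
    exact not_not.2 rfl⟩
  exact ((ψ.continuous.comp continuous_fst).aestronglyMeasurable.mul
    (aestronglyMeasurable_of_continuousOn_offDiag (K := fun x y => E (σ, x) (σ, y)) _ _ (hE.continuousOn_slice σ))).mul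
      (χ.continuous.comp continuous_snd).aestronglyMeasurable

/-- The distant-pair parts of the integrand have known integrals, lie below the full integrand
because `E ≥ 0` off the diagonal, and eventually equal it at almost every point. -/
lemma slice_of_nonneg (hm : 0 < m) (hE : IsGreenKernel g m E) (i : Fin n) (σ : ℝ)
    {ψ χ : SliceTest n} (hψ : ∀ x, 0 ≤ ψ x) (hχ : ∀ x, 0 ≤ χ x) :
    Integrable (fun z : Slice n × Slice n => ψ z.1 * E (σ, z.1) (σ, z.2) * χ z.2)
      ((g.sliceVol σ).prod (g.sliceVol σ)) ∧
    ∫ z : Slice n × Slice n, ψ z.1 * E (σ, z.1) (σ, z.2) * χ z.2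
      ∂(g.sliceVol σ).prod (g.sliceVol σ) =
      inner ℝ (slicePotential g hm i σ ψ) (slicePotential g hm i σ χ) := by
  obtain ⟨R₁, hR₁⟩ := exists_coord_bound i ψ
  obtain ⟨R₂, hR₂⟩ := exists_coord_bound i χ
  set R := max R₁ R₂
  have hψR : ∀ x, ψ x ≠ 0 → |x i| ≤ R := fun x hx =>
    (hR₁ x hx).trans (Nat.cast_le.2 (le_max_left _ _))
  have hχR : ∀ x, χ x ≠ 0 → |x i| ≤ R := fun x hx =>
    (hR₂ x hx).trans (Nat.cast_le.2 (le_max_right _ _))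
  let F : ℕ → ℕ → ℕ → Slice n × Slice n → ℝ := fun k l l' z =>
    slabs i R k ψ l z.1 * E (σ, z.1) (σ, z.2) * slabs i R k χ l' z.2
  have hsplit : ∀ k z, ∑ p ∈ farPairs (2 * (k + 1) * R + 2), F k p.1 p.2 z +
      ∑ p ∈ nearPairs (2 * (k + 1) * R + 2), F k p.1 p.2 z =
        ψ z.1 * E (σ, z.1) (σ, z.2) * χ z.2 := fun k z => by
    rw [sum_farPairs_add_sum_nearPairs _ fun l l' => F k l l' z, ← sum_slabs hψR k z.1,
      ← sum_slabs hχR k z.2, Finset.sum_mul, Finset.sum_mul_sum]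
  have hfar : ∀ k, ∀ p ∈ farPairs (2 * (k + 1) * R + 2),
      Integrable (F k p.1 p.2) ((g.sliceVol σ).prod (g.sliceVol σ)) ∧
      ∫ z, F k p.1 p.2 z ∂(g.sliceVol σ).prod (g.sliceVol σ) =
        inner ℝ (slicePotential g hm i σ (slabs i R k ψ p.1))
          (slicePotential g hm i σ (slabs i R k χ p.2)) := fun k p hp =>
    hE.slice_of_disjoint hm i σ (disjoint_tsupport_slabs ψ χ (Finset.mem_filter.1 hp).2)
  have hF0 : ∀ᵐ z ∂(g.sliceVol σ).prod (g.sliceVol σ), ∀ k l l', 0 ≤ F k l l' z := by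
    filter_upwards [g.ae_prod_sliceVol_ne σ i] with z hz k l l'
    have hne : ((σ, z.1) : Spacetime n) ≠ (σ, z.2) := fun h =>
      hz (congrFun (congrArg Prod.snd h) i)
    exact mul_nonneg (mul_nonneg (slabs_nonneg hψ _) (hE.nonneg hm hne)) (slabs_nonneg hχ _)
  refine integral_eq_of_tendsto_of_le
    (f := fun k z => ∑ p ∈ farPairs (2 * (k + 1) * R + 2), F k p.1 p.2 z)
    (hE.aestronglyMeasurable_slice i σ ψ χ)
    (fun k => integrable_finsetSum _ fun p hp => (hfar k p hp).1) (fun k => ?_) (fun k => ?_) ?_ ?_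
  · filter_upwards [hF0] with z hz using Finset.sum_nonneg fun p _ => hz k p.1 p.2
  · filter_upwards [hF0] with z hz
    rw [← hsplit k z]
    exact le_add_of_nonneg_right (Finset.sum_nonneg fun p _ => hz k p.1 p.2)
  · filter_upwards [g.ae_prod_sliceVol_ne σ i] with z hz
    -- Two points in slabs whose indices differ by at most `2` have rescaled coordinates less than
    -- `4` apart. For larger `k` no near pair sees both points.
    obtain ⟨k₀, hk₀⟩ := exists_nat_gt (4 / |z.1 i - z.2 i|)
    rw [div_lt_iff₀ (abs_pos.2 (sub_ne_zero.2 hz))] at hk₀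
    refine tendsto_const_nhds.congr' ?_
    filter_upwards [eventually_ge_atTop k₀] with k hk
    rw [← hsplit k z, Finset.sum_eq_zero (s := nearPairs _) fun p hp => ?_, add_zero]
    by_contra h0
    obtain ⟨h1, h2⟩ := slabs_ne_zero (left_ne_zero_of_mul (left_ne_zero_of_mul h0))
    obtain ⟨h3, h4⟩ := slabs_ne_zero (right_ne_zero_of_mul h0)
    have hp' := (Finset.mem_filter.1 hp).2
    push Not at hp'
    have h5 : (p.2 : ℝ) ≤ p.1 + 2 := by exact_mod_cast hp'.1
    have h6 : (p.1 : ℝ) ≤ p.2 + 2 := by exact_mod_cast hp'.2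
    have h7 : (k₀ : ℝ) ≤ k := Nat.cast_le.2 hk
    have h8 : ((k : ℝ) + 1) * |z.1 i - z.2 i| < 4 := by
      rw [← abs_of_pos (by positivity : (0 : ℝ) < (k : ℝ) + 1), ← abs_mul, abs_lt]
      constructor <;> linarith
    have h9 := mul_le_mul_of_nonneg_right h7 (abs_nonneg (z.1 i - z.2 i))
    have h10 := abs_nonneg (z.1 i - z.2 i)
    linarith
  · refine (tendsto_sum_farPairs_inner (g := g) hm i σ hψR hχR).congr fun k => ?_
    rw [integral_finsetSum _ fun p hp => (hfar k p hp).1]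
    exact Finset.sum_congr rfl fun p hp => (hfar k p hp).2.symm

end IsGreenKernel

lemma slicePotential_add (hm : 0 < m) (i : Fin n) (σ : ℝ) (ψ χ : SliceTest n) :
    slicePotential g hm i σ (ψ + χ) = slicePotential g hm i σ ψ + slicePotential g hm i σ χ := by
  refine FieldSpace.energySpace_ext fun φ => ?_
  rw [inner_add_left, inner_slicePotential, inner_slicePotential, inner_slicePotential,
    ← integral_add (integrable_slice g σ ψ φ σ) (integrable_slice g σ χ φ σ)]
  exact integral_congr_ae (.of_forall fun x => add_mul _ _ _)

/-- Positive and negative parts would not be smooth; a dominating test function gives a smooth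
substitute. -/
lemma exists_nonneg_add_eq (ψ : SliceTest n) : ∃ a b : SliceTest n, (∀ x, 0 ≤ a x) ∧
    (∀ x, 0 ≤ b x) ∧ ψ + b = a := by
  obtain ⟨a, ha⟩ := exists_dominating ψ
  exact ⟨a, a - ψ, fun x => (norm_nonneg _).trans (ha x),
    fun x => sub_nonneg.2 ((le_abs_self _).trans (ha x)), add_sub_cancel _ _⟩

namespace IsGreenKernel

/-- The integral kernel of the resolvent on distributions carried by a slice. -/
lemma slice_kernel (hm : 0 < m) (hE : IsGreenKernel g m E) (i : Fin n) (σ : ℝ)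
    (ψ χ : SliceTest n) :
    Integrable (fun z : Slice n × Slice n => ψ z.1 * E (σ, z.1) (σ, z.2) * χ z.2)
      ((g.sliceVol σ).prod (g.sliceVol σ)) ∧
    ∫ z : Slice n × Slice n, ψ z.1 * E (σ, z.1) (σ, z.2) * χ z.2
      ∂(g.sliceVol σ).prod (g.sliceVol σ) =
      inner ℝ (slicePotential g hm i σ ψ) (slicePotential g hm i σ χ) := by
  have right : ∀ {ψ : SliceTest n} (_ : ∀ x, 0 ≤ ψ x) (χ : SliceTest n),
      Integrable (fun z : Slice n × Slice n => ψ z.1 * E (σ, z.1) (σ, z.2) * χ z.2)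
        ((g.sliceVol σ).prod (g.sliceVol σ)) ∧
      ∫ z : Slice n × Slice n, ψ z.1 * E (σ, z.1) (σ, z.2) * χ z.2
        ∂(g.sliceVol σ).prod (g.sliceVol σ) =
        inner ℝ (slicePotential g hm i σ ψ) (slicePotential g hm i σ χ) := fun {ψ} hψ χ => by
    obtain ⟨a, b, ha, hb, hab⟩ := exists_nonneg_add_eq χ
    obtain ⟨i1, e1⟩ := hE.slice_of_nonneg hm i σ hψ ha
    obtain ⟨i2, e2⟩ := hE.slice_of_nonneg hm i σ hψ hb
    have e : ∀ z : Slice n × Slice n, ψ z.1 * E (σ, z.1) (σ, z.2) * χ z.2 =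
        ψ z.1 * E (σ, z.1) (σ, z.2) * a z.2 - ψ z.1 * E (σ, z.1) (σ, z.2) * b z.2 := fun z => by
      rw [← hab]
      change _ = _ * (χ z.2 + b z.2) - _
      ring
    simp only [e]
    refine ⟨i1.sub i2, ?_⟩
    rw [integral_sub i1 i2, e1, e2, ← hab, slicePotential_add, inner_add_right, add_sub_cancel_right]
  obtain ⟨a, b, ha, hb, hab⟩ := exists_nonneg_add_eq ψ
  obtain ⟨i1, e1⟩ := right ha χ
  obtain ⟨i2, e2⟩ := right hb χ
  have e : ∀ z : Slice n × Slice n, ψ z.1 * E (σ, z.1) (σ, z.2) * χ z.2 =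
      a z.1 * E (σ, z.1) (σ, z.2) * χ z.2 - b z.1 * E (σ, z.1) (σ, z.2) * χ z.2 := fun z => by
    rw [← hab]
    change _ = (ψ z.1 + b z.1) * _ * _ - _
    ring
  simp only [e]
  refine ⟨i1.sub i2, ?_⟩
  rw [integral_sub i1 i2, e1, e2, ← hab, slicePotential_add, inner_add_left, add_sub_cancel_right]

/-- Complex test functions on a slice are in `N_σ`, with the norm given by the Green kernel. -/
theorem exists_sliceSpace (hm : 0 < m) (hE : IsGreenKernel g m E) (i : Fin n) (σ : ℝ)
    (ψ : 𝓓((⊤ : Opens (Slice n)), ℂ)) :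
    ∃ Ψ : SliceSpace g m σ,
      (∀ χ : SliceTest n, SliceSpace.toDistr g m σ Ψ χ = ∫ x, ψ x * (χ x : ℂ) ∂g.sliceVol σ) ∧
      Integrable (fun z : Slice n × Slice n =>
        conj (ψ z.1) * (E (σ, z.1) (σ, z.2) : ℂ) * ψ z.2) ((g.sliceVol σ).prod (g.sliceVol σ)) ∧
      ((‖Ψ‖ ^ 2 : ℝ) : ℂ) = ∫ x, ∫ y, conj (ψ x) * (E (σ, x) (σ, y) : ℂ) * ψ y
        ∂g.sliceVol σ ∂g.sliceVol σ := by
  have h := hE.slice_kernel hm i σ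
  have key := integral_kernel_complex (g.sliceVol σ) (fun x y => E (σ, x) (σ, y)) ψ
    (h (reTest ψ) (reTest ψ)).1 (h (imTest ψ) (imTest ψ)).1
    (h (reTest ψ) (imTest ψ)).1 (h (imTest ψ) (reTest ψ)).1
    (h (reTest ψ) (reTest ψ)).2 (h (imTest ψ) (imTest ψ)).2
    (h (reTest ψ) (imTest ψ)).2 ((h (imTest ψ) (reTest ψ)).2.trans (real_inner_comm _ _))
  set f := FieldSpace.ofPotentials (slicePotential g hm i σ (reTest ψ))
    (slicePotential g hm i σ (imTest ψ)) with hf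
  have hval : ∀ φ : Test n, FieldSpace.toDistr g m f φ =
      ∫ x, ψ x * ((φ (σ, x) : ℝ) : ℂ) ∂g.sliceVol σ := fun φ => by
    rw [hf, FieldSpace.toDistr_ofPotentials, inner_slicePotential, inner_slicePotential,
      ← integral_complex_ofReal, ← integral_complex_ofReal, ← integral_const_mul,
      ← integral_add (integrable_slice g σ (reTest ψ) φ σ).ofReal
        ((integrable_slice g σ (imTest ψ) φ σ).ofReal.const_mul _)]
    refine integral_congr_ae (.of_forall fun x => ?_)
    apply Complex.ext <;> simp
  have hlift : ∀ (χ : SliceTest n) (x : Slice n), liftCLM σ χ (σ, x) = χ x := fun χ x =>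
    DFunLike.congr_fun (restrictCLM_liftCLM σ χ) x
  -- The distribution `f` sees a test function only through its restriction to the slice, so it has
  -- the form `Ψ δ(t - σ)`.
  obtain ⟨Ψ, hΨ⟩ := (SliceSpace.mem_range_delta (σ := σ) f).2 fun φ => by
    rw [hval, hval]
    simp only [hlift, restrictCLM_apply]
  refine ⟨Ψ, fun χ => ?_, key.1, ?_⟩
  · have e : SliceSpace.toDistr g m σ Ψ χ = FieldSpace.toDistr g m f (liftCLM σ χ) := by
      rw [← hΨ, SliceSpace.toDistr_delta, tensorDelta_apply, restrictCLM_liftCLM]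
    rw [e, hval]
    simp only [hlift]
  · rw [← SliceSpace.norm_delta, hΨ, FieldSpace.norm_sq_eq, hf, FieldSpace.rePotential_ofPotentials,
      FieldSpace.imPotential_ofPotentials, ← real_inner_self_eq_norm_sq,
      ← real_inner_self_eq_norm_sq]
    exact key.2

end IsGreenKernel

end SliceKernel

end CurvedField
end

theorem mainTheorem1 (n : ℕ) (g : CurvedField.Metric n) (m : ℝ) (hm : 0 < m) :
    (∀ σ σ' σ'' : ℝ, σ' ∈ Set.uIcc σ σ'' →
      CurvedField.U g m σ σ' ∘L CurvedField.U g m σ' σ'' = CurvedField.U g m σ σ'') ∧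
    (∀ σ : ℝ, CurvedField.U g m σ σ =
      ContinuousLinearMap.id ℂ (CurvedField.SliceSpace g m σ)) ∧
    (∀ σ σ' : ℝ, ‖CurvedField.U g m σ σ'‖ ≤ 1) ∧
    (∀ A B C : Set (CurvedField.Spacetime n), IsClosed A → IsClosed B → IsClosed C →
      CurvedField.Separates C A B →
      CurvedField.e g m A ∘L CurvedField.e g m C ∘L CurvedField.e g m B =
        CurvedField.e g m A ∘L CurvedField.e g m B) ∧
    (∀ E : CurvedField.Spacetime n → CurvedField.Spacetime n → ℝ,
      CurvedField.IsGreenKernel g m E →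
      (∀ f : 𝓓((⊤ : Opens (CurvedField.Spacetime n)), ℂ),
        ∃ F : CurvedField.FieldSpace g m,
          (∀ φ : CurvedField.Test n, CurvedField.FieldSpace.toDistr g m F φ =
            ∫ p, f p * (φ p : ℂ) ∂g.vol) ∧
          Integrable (fun z : CurvedField.Spacetime n × CurvedField.Spacetime n =>
            conj (f z.1) * (E z.1 z.2 : ℂ) * f z.2) (g.vol.prod g.vol) ∧
          ((‖F‖ ^ 2 : ℝ) : ℂ) =
            ∫ p, ∫ q, conj (f p) * (E p q : ℂ) * f q ∂g.vol ∂g.vol) ∧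
      (1 ≤ n → ∀ (σ : ℝ) (ψ : 𝓓((⊤ : Opens (CurvedField.Slice n)), ℂ)),
        ∃ Ψ : CurvedField.SliceSpace g m σ,
          (∀ χ : CurvedField.SliceTest n, CurvedField.SliceSpace.toDistr g m σ Ψ χ =
            ∫ x, ψ x * (χ x : ℂ) ∂g.sliceVol σ) ∧
          Integrable (fun z : CurvedField.Slice n × CurvedField.Slice n =>
            conj (ψ z.1) * (E (σ, z.1) (σ, z.2) : ℂ) * ψ z.2)
            ((g.sliceVol σ).prod (g.sliceVol σ)) ∧
          ((‖Ψ‖ ^ 2 : ℝ) : ℂ) =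
            ∫ x, ∫ y, conj (ψ x) * (E (σ, x) (σ, y) : ℂ) * ψ y
              ∂g.sliceVol σ ∂g.sliceVol σ)) := by
  refine ⟨fun σ σ' σ'' h => CurvedField.U_comp_U h, fun σ => CurvedField.adjoint_j_comp_j σ,
    fun σ σ' => CurvedField.norm_U_le σ σ', fun A B C _ _ _ h => CurvedField.markoff h,
    -- The condition `1 ≤ n` supplies the coordinate `0` along which slabs are cut. For `n = 0` the
    -- slice is a point, and the formula would involve `E` on the diagonal, where `IsGreenKernel`
    -- does not constrain it.
    fun E hE => ⟨fun f => hE.exists_fieldSpace hm f, fun hn σ ψ =>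
      hE.exists_sliceSpace hm ⟨0, hn⟩ σ ψ⟩⟩
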